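/- Let $G$ be a connected semisimple complex Lie group. A (complex) super vector space is a finite-dimensional complex vector space with a fixed decomposition $V = V_0 \boxplus V_1$ into an even part $V_0$ and an odd part $V_1$; an action of $G$ on $V$ is a pair of holomorphic linear representations of $G$ on $V_0$ and on $V_1$. Direct sums and duals of such actions are formed parity by parity: $(V\oplus W)_\epsilon = V_\epsilon\oplus W_\epsilon$ and $(W^*)_\epsilon = (W_\epsilon)^*$ with the contragredient action. Decompose $V_0 = U_1\oplus\dots\oplus U_k$ and $V_1 = Y_1\oplus\dots\oplus Y_l$ into irreducible $G$-submodules (this is unique up to $G$-equivariant automorphisms). The super symmetric algebra $P(V) = S(V_0)\otimes\bigwedge(V_1)$ is the direct sum, over $\mathbf i\in\mathbb N^k$ and $\mathbf j\in\mathbb N^l$, of the $G$-stable subspaces $$P^{(\mathbf i,\mathbf j)}(V) = S^{i_1}U_1\otimes\dots\otimes S^{i_k}U_k\otimes\bigwedge\nolimits^{j_1}Y_1\otimes\dots\otimes\bigwedge\nolimits^{j_l}Y_l .$$ The pair $(G,V)$ is called super multiplicity-free (super MF) if $\dim\operatorname{Hom}_G\bigl(P^{(\mathbf i,\mathbf j)}(V),\Gamma\bigr)\le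 1$ for all $\mathbf i,\mathbf j$ and all irreducible representations $\Gamma$ of $G$. Let $G$ act on super vector spaces $V = V_0\boxplus V_1$ and $W = W_0\boxplus W_1$. Then $V\oplus W$ is super MF if and only if $V\oplus W^*$ is super MF. -/

import Mathlib

open scoped Manifold ContDiff TensorProduct

namespace SuperMF

/-! A complex super vector space `V = V₀ ⊞ V₁` is given by its even part `V₀` and its odd part
`V₁`, two finite-dimensional complex vector spaces.  A representation of `G` on it is a pair
`ρ₀`, `ρ₁` of representations of `G` on `V₀` and on `V₁`.  Direct sums and duals are formed
parity by parity. -/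

/-- A representation of a complex Lie group on a complex vector space is holomorphic if all its
matrix coefficients `g ↦ φ (ρ g v)` are holomorphic (complex analytic) functions on the group. -/
def IsHolomorphicRep {E : Type*} [NormedAddCommGroup E] [NormedSpace ℂ E]
    {G : Type*} [Group G] [TopologicalSpace G] [ChartedSpace E G]
    {V : Type*} [AddCommGroup V] [Module ℂ V] (ρ : Representation ℂ G V) : Prop :=
  ∀ (v : V) (φ : Module.Dual ℂ V), ContMDiff 𝓘(ℂ, E) 𝓘(ℂ, ℂ) ω (fun g : G => φ (ρ g v))

section Rep

variable {G : Type*} [Group G]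
  {V V₀ V₁ : Type*} [AddCommGroup V] [Module ℂ V]
  [AddCommGroup V₀] [Module ℂ V₀] [AddCommGroup V₁] [Module ℂ V₁]

/-- The action of `G` on the symmetric algebra `S(V)` by algebra endomorphisms that extends the
action on `V`. -/
noncomputable def symRep (ρ : Representation ℂ G V) :
    Representation ℂ G (SymmetricAlgebra ℂ V) where
  toFun g := (SymmetricAlgebra.lift (SymmetricAlgebra.ι ℂ V ∘ₗ ρ g)).toLinearMap
  map_one' := by
    have h : SymmetricAlgebra.lift (SymmetricAlgebra.ι ℂ V ∘ₗ ρ 1)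
        = AlgHom.id ℂ (SymmetricAlgebra ℂ V) := by
      apply SymmetricAlgebra.algHom_ext
      ext v
      simp
    rw [h]
    rfl
  map_mul' g g' := by
    have h : SymmetricAlgebra.lift (SymmetricAlgebra.ι ℂ V ∘ₗ ρ (g * g'))
        = (SymmetricAlgebra.lift (SymmetricAlgebra.ι ℂ V ∘ₗ ρ g)).comp
          (SymmetricAlgebra.lift (SymmetricAlgebra.ι ℂ V ∘ₗ ρ g')) := by
      apply SymmetricAlgebra.algHom_ext
      ext v
      simp
    rw [h]
    rfl

/-- The action of `G` on the exterior algebra `⋀(V)` by algebra endomorphisms that extends the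
action on `V`. -/
noncomputable def extRep (ρ : Representation ℂ G V) :
    Representation ℂ G (ExteriorAlgebra ℂ V) where
  toFun g := (ExteriorAlgebra.map (ρ g)).toLinearMap
  map_one' := by
    rw [map_one, Module.End.one_eq_id, ExteriorAlgebra.map_id]
    rfl
  map_mul' g g' := by
    rw [map_mul, Module.End.mul_eq_comp, ← ExteriorAlgebra.map_comp_map]
    rfl

/-- The super symmetric algebra `P(V) = S(V₀) ⊗ ⋀(V₁)` as a representation of `G`. -/
noncomputable def superSymRep (ρ₀ : Representation ℂ G V₀) (ρ₁ : Representation ℂ G V₁) :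
    Representation ℂ G (SymmetricAlgebra ℂ V₀ ⊗[ℂ] ExteriorAlgebra ℂ V₁) :=
  (symRep ρ₀).tprod (extRep ρ₁)

/-- A decomposition `V = U 0 ⊕ ⋯ ⊕ U (k - 1)` of a representation into irreducible
subrepresentations. -/
structure IrredDecomposition (ρ : Representation ℂ G V) (k : ℕ) where
  /-- the summands -/
  U : Fin k → Subrepresentation ρ
  irreducible : ∀ p, (U p).toRepresentation.IsIrreducible
  isInternal : DirectSum.IsInternal (fun p => (U p).toSubmodule)

/-- The subspace `S^{i₁}(U₁) ⊗ ⋯ ⊗ S^{i_k}(U_k)` of `S(V)`: the span of all products of `i₁`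
vectors of `U₁`, ..., and `i_k` vectors of `U_k`. -/
noncomputable def symComponent {k : ℕ} (U : Fin k → Submodule ℂ V) (i : Fin k → ℕ) :
    Submodule ℂ (SymmetricAlgebra ℂ V) :=
  ∏ p, (U p).map (SymmetricAlgebra.ι ℂ V) ^ i p

/-- The subspace `⋀^{j₁}(U₁) ⊗ ⋯ ⊗ ⋀^{j_l}(U_l)` of `⋀(V)`: the span of all products of `j₁`
vectors of `U₁`, ..., and `j_l` vectors of `U_l`, in this order. -/
noncomputable def extComponent {l : ℕ} (U : Fin l → Submodule ℂ V) (j : Fin l → ℕ) :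
    Submodule ℂ (ExteriorAlgebra ℂ V) :=
  (List.ofFn fun q => (U q).map (ExteriorAlgebra.ι ℂ) ^ j q).prod

theorem symComponent_stable (ρ : Representation ℂ G V) {k : ℕ} (U : Fin k → Subrepresentation ρ)
    (i : Fin k → ℕ) (g : G) :
    (symComponent (fun p => (U p).toSubmodule) i).map (symRep ρ g)
      ≤ symComponent (fun p => (U p).toSubmodule) i := by
  unfold symComponent
  change Submodule.map
    (SymmetricAlgebra.lift (SymmetricAlgebra.ι ℂ V ∘ₗ ρ g)).toLinearMap _ ≤ _
  have hmap : Submodule.map (SymmetricAlgebra.lift (SymmetricAlgebra.ι ℂ V ∘ₗ ρ g)).toLinearMap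
      (∏ p, (U p).toSubmodule.map (SymmetricAlgebra.ι ℂ V) ^ i p)
      = ∏ p, (((U p).toSubmodule.map (SymmetricAlgebra.ι ℂ V)).map
        (SymmetricAlgebra.lift (SymmetricAlgebra.ι ℂ V ∘ₗ ρ g)).toLinearMap) ^ i p := by
    have := map_prod (Submodule.mapHom (SymmetricAlgebra.lift (SymmetricAlgebra.ι ℂ V ∘ₗ ρ g)))
      (fun p => (U p).toSubmodule.map (SymmetricAlgebra.ι ℂ V) ^ i p) Finset.univ
    simp only [map_pow] at this
    exact this
  rw [hmap]
  refine Finset.prod_le_prod' fun p _ => pow_le_pow_left' ?_ _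
  rintro _ ⟨_, ⟨v, hv, rfl⟩, rfl⟩
  refine ⟨ρ g v, (U p).apply_mem_toSubmodule g hv, ?_⟩
  simp

theorem extComponent_stable (ρ : Representation ℂ G V) {l : ℕ} (U : Fin l → Subrepresentation ρ)
    (j : Fin l → ℕ) (g : G) :
    (extComponent (fun q => (U q).toSubmodule) j).map (extRep ρ g)
      ≤ extComponent (fun q => (U q).toSubmodule) j := by
  unfold extComponent
  change Submodule.map (ExteriorAlgebra.map (ρ g)).toLinearMap _ ≤ _
  have hmap := map_list_prod (Submodule.mapHom (ExteriorAlgebra.map (ρ g)))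
    (List.ofFn fun q => (U q).toSubmodule.map (ExteriorAlgebra.ι ℂ) ^ j q)
  refine le_trans (le_of_eq hmap) ?_
  rw [List.map_ofFn]
  refine List.Forall₂.prod_le_prod' ?_
  rw [List.forall₂_iff_get]
  refine ⟨by simp, fun n h₁ h₂ => ?_⟩
  simp only [List.get_eq_getElem, List.getElem_ofFn, Function.comp_apply, map_pow]
  refine pow_le_pow_left' ?_ _
  rintro _ ⟨_, ⟨v, hv, rfl⟩, rfl⟩
  refine ⟨ρ g v, (U _).apply_mem_toSubmodule g hv, ?_⟩
  simp

/-- The `G`-stable direct summand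
`P^{(i,j)}(V) = S^{i₁}(U₁) ⊗ ⋯ ⊗ S^{i_k}(U_k) ⊗ ⋀^{j₁}(Y₁) ⊗ ⋯ ⊗ ⋀^{j_l}(Y_l)` of `P(V)` that
belongs to decompositions `V₀ = U₁ ⊕ ⋯ ⊕ U_k` and `V₁ = Y₁ ⊕ ⋯ ⊕ Y_l`. -/
noncomputable def component {ρ₀ : Representation ℂ G V₀} {ρ₁ : Representation ℂ G V₁} {k l : ℕ}
    (U : Fin k → Subrepresentation ρ₀) (Y : Fin l → Subrepresentation ρ₁)
    (i : Fin k → ℕ) (j : Fin l → ℕ) : Subrepresentation (superSymRep ρ₀ ρ₁) where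
  toSubmodule := Submodule.map₂ (TensorProduct.mk ℂ _ _)
    (symComponent (fun p => (U p).toSubmodule) i) (extComponent (fun q => (Y q).toSubmodule) j)
  apply_mem_toSubmodule g x hx := by
    suffices h : Submodule.map₂ (TensorProduct.mk ℂ _ _)
        (symComponent (fun p => (U p).toSubmodule) i) (extComponent (fun q => (Y q).toSubmodule) j)
        ≤ Submodule.comap (superSymRep ρ₀ ρ₁ g) (Submodule.map₂ (TensorProduct.mk ℂ _ _)
          (symComponent (fun p => (U p).toSubmodule) i)
          (extComponent (fun q => (Y q).toSubmodule) j)) from h hx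
    rw [Submodule.map₂_le]
    intro a ha b hb
    exact Submodule.apply_mem_map₂ _
      (symComponent_stable ρ₀ U i g ⟨a, ha, rfl⟩) (extComponent_stable ρ₁ Y j g ⟨b, hb, rfl⟩)

/-- `(G, V)` is super multiplicity-free: for the decomposition of `V₀` and `V₁` into irreducible
submodules (which is unique up to a `G`-equivariant automorphism, so that the choice does not
matter), `dim Hom_G(P^{(i,j)}(V), Γ) ≤ 1` for all multi-indices `(i,j)` and all irreducible
representations `Γ` of `G`.  Every finite-dimensional `Γ` is isomorphic to one in `Type`. -/
def IsSuperMF (ρ₀ : Representation ℂ G V₀) (ρ₁ : Representation ℂ G V₁) : Prop :=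
  ∃ (k l : ℕ) (D₀ : IrredDecomposition ρ₀ k) (D₁ : IrredDecomposition ρ₁ l),
    ∀ (i : Fin k → ℕ) (j : Fin l → ℕ)
      (Γ : Type) [AddCommGroup Γ] [Module ℂ Γ] [FiniteDimensional ℂ Γ]
      (γ : Representation ℂ G Γ), γ.IsIrreducible →
        Module.rank ℂ
          (Representation.IntertwiningMap (component D₀.U D₁.U i j).toRepresentation γ) ≤ 1

end Rep

end SuperMF

/-! Once every component P^{(i,j)} is completely reducible, Schur's lemma turns "every irreducible
occurs at most once" into "the algebra of equivariant endomorphisms is commutative"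
(`isSuperMF_iff`). This form of the condition survives the passage from W to W*, even though the
components themselves change.

Complete reducibility comes from a Kempf–Ness argument. For an irreducible representation, the sum
of squared Frobenius norms of the matrices of the differential attains its minimum on the conjugacy
orbit, and at a minimum the moment map ∑ [X_i, X_i*] vanishes. Vanishing is inherited by tensor
products and makes orthogonal complements of stable subspaces stable. Every component is an
equivariant image of a tensor product of irreducibles, hence completely reducible
(`semisimpleOn_component`). Connectedness lets one pass between subspaces stable under G and under
the differential.

A decomposition of V ⊕ W can be matched with one of V ⊕ W*: the submodule V has a complement that is
the sum of some of the irreducible summands, and this complement is isomorphic to W. Dualizing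
exactly these summands gives V ⊕ W* (`exists_contragredientFlip`). It remains to see what flipping
some blocks does in each parity.

Even part (`commOn_of_contragredient`). A linear map on polynomials of multidegree d has a unique
extension to a differential operator ∑ P_b ∂^b with all b of multidegree d, and by uniqueness it
inherits equivariance. The partial Fourier transform x ↦ ∂, ∂ ↦ -x on the flipped variables is an
automorphism of the Weyl algebra that exchanges the action with the contragredient one. The
transformed operator commutes with the Euler operators, so it preserves every multidegree. If
equivariant endomorphisms commute in all multidegrees before flipping, the transformed operators
commute, hence so do the original ones. The exterior factor only enters as a space of matrix
coefficients.

Odd part (`exists_star`). A partial Hodge star is a linear isomorphism of exterior algebras that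
carries nonzero components to components, replacing j_q by dim Y_q - j_q on flipped blocks. It is
equivariant up to a character, which does not affect commutants. Double duality gives the converse
direction. -/

namespace SuperMF

/-! ### Stable submodules, complete reducibility and commutants -/

section Commutants

variable {G : Type*}

/-- A submodule that is stable under all operators `ρ g`. -/
def Stable {Y : Type*} [AddCommGroup Y] [Module ℂ Y] (T : G → Y →ₗ[ℂ] Y)
    (N : Submodule ℂ Y) : Prop :=
  ∀ g, ∀ x ∈ N, T g x ∈ N

/-- Every stable submodule of `N` has a stable complement in `N`. -/
def SemisimpleOn {Y : Type*} [AddCommGroup Y] [Module ℂ Y] (T : G → Y →ₗ[ℂ] Y)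
    (N : Submodule ℂ Y) : Prop :=
  ∀ M ≤ N, Stable T M → ∃ M' ≤ N, Stable T M' ∧ M ⊓ M' = ⊥ ∧ M ⊔ M' = N

/-- Linear maps preserving `N` that are equivariant on `N` commute with each other on `N`. -/
def CommOn {Y : Type*} [AddCommGroup Y] [Module ℂ Y] (T : G → Y →ₗ[ℂ] Y)
    (N : Submodule ℂ Y) : Prop :=
  ∀ f h : Y →ₗ[ℂ] Y, (∀ x ∈ N, f x ∈ N) → (∀ x ∈ N, h x ∈ N) →
    (∀ g, ∀ x ∈ N, f (T g x) = T g (f x)) → (∀ g, ∀ x ∈ N, h (T g x) = T g (h x)) →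
    ∀ x ∈ N, f (h x) = h (f x)

theorem exists_linearMap_leftInverse_on {Y Z : Type*} [AddCommGroup Y] [Module ℂ Y]
    [AddCommGroup Z] [Module ℂ Z] (L : Y →ₗ[ℂ] Z) (N : Submodule ℂ Y)
    (hinj : ∀ x ∈ N, L x = 0 → x = 0) : ∃ L' : Z →ₗ[ℂ] Y, ∀ x ∈ N, L' (L x) = x := by
  obtain ⟨g, hg⟩ := (L.domRestrict N).exists_leftInverse_of_injective (by
    rw [LinearMap.ker_eq_bot']
    rintro ⟨x, hx⟩ h
    exact Subtype.ext (hinj x hx h))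
  refine ⟨N.subtype ∘ₗ g, fun x hx => ?_⟩
  have := LinearMap.congr_fun hg ⟨x, hx⟩
  simpa using congrArg Subtype.val this

/-- Conjugation by an isomorphism N ≅ N' identifies the two commutants. Equivariance is needed only
up to a nonzero scalar depending on g, because such a scalar cancels in a commutation relation; this
freedom absorbs the determinant character of the Hodge star. -/
theorem CommOn.of_equiv {Y Z : Type*} [AddCommGroup Y] [Module ℂ Y]
    [AddCommGroup Z] [Module ℂ Z] {T : G → Y →ₗ[ℂ] Y} {T' : G → Z →ₗ[ℂ] Z}
    {N : Submodule ℂ Y} {N' : Submodule ℂ Z} (h : CommOn T' N') (hN : Stable T N)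
    (L : Y →ₗ[ℂ] Z) (hinj : ∀ x ∈ N, L x = 0 → x = 0) (hmap : N.map L = N')
    (hL : ∀ g, ∃ c : ℂ, c ≠ 0 ∧ ∀ x ∈ N, L (T g x) = c • T' g (L x)) : CommOn T N := by
  obtain ⟨L', hL'⟩ := exists_linearMap_leftInverse_on L N hinj
  have key : ∀ f : Y →ₗ[ℂ] Y, (∀ x ∈ N, f x ∈ N) → (∀ g, ∀ x ∈ N, f (T g x) = T g (f x)) →
      (∀ z ∈ N', (L ∘ₗ f ∘ₗ L') z ∈ N') ∧
      (∀ g, ∀ z ∈ N', (L ∘ₗ f ∘ₗ L') (T' g z) = T' g ((L ∘ₗ f ∘ₗ L') z)) := by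
    intro f hf hfT
    subst hmap
    constructor
    · rintro _ ⟨x, hx, rfl⟩
      exact ⟨f x, hf x hx, by simp [hL' x hx]⟩
    · rintro g _ ⟨x, hx, rfl⟩
      obtain ⟨c, hc, hcL⟩ := hL g
      have h1 : T' g (L x) = c⁻¹ • L (T g x) := by rw [hcL x hx, inv_smul_smul₀ hc]
      have h2 : T' g (L (f x)) = c⁻¹ • L (T g (f x)) := by
        rw [hcL _ (hf x hx), inv_smul_smul₀ hc]
      simp only [LinearMap.comp_apply, hL' x hx, h1, h2, map_smul, hL' _ (hN g x hx), hfT g x hx]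
  intro f k hf hk hfT hkT x hx
  have hx' : L x ∈ N' := hmap ▸ ⟨x, hx, rfl⟩
  have := h _ _ (key f hf hfT).1 (key k hk hkT).1 (key f hf hfT).2 (key k hk hkT).2 (L x) hx'
  simp only [LinearMap.comp_apply, hL' x hx, hL' _ (hf x hx), hL' _ (hk x hx)] at this
  rw [← sub_eq_zero]
  apply hinj _ (N.sub_mem (hf _ (hk _ hx)) (hk _ (hf _ hx)))
  rw [map_sub, this, sub_self]

theorem exists_minimal_stable {V : Type*} [AddCommGroup V] [Module ℂ V] [FiniteDimensional ℂ V]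
    (T : G → V →ₗ[ℂ] V) (R : Submodule ℂ V) (hR : Stable T R) (hR0 : R ≠ ⊥) :
    ∃ M ≤ R, Stable T M ∧ M ≠ ⊥ ∧ ∀ M' ≤ M, Stable T M' → M' = ⊥ ∨ M' = M := by
  obtain ⟨M, ⟨h1, h2, h3⟩, hmin⟩ := WellFounded.has_min
    (wellFounded_lt (α := Submodule ℂ V)) {M | M ≤ R ∧ Stable T M ∧ M ≠ ⊥} ⟨R, le_rfl, hR, hR0⟩
  refine ⟨M, h1, h2, h3, fun M' hM' hs => ?_⟩
  by_contra! hne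
  exact hmin M' ⟨hM'.trans h1, hs, hne.1⟩ (lt_of_le_of_ne hM' hne.2)

theorem exists_equivariant_projection {V : Type*} [AddCommGroup V] [Module ℂ V]
    (T : G → V →ₗ[ℂ] V) (M M' : Submodule ℂ V) (hM : Stable T M) (hM' : Stable T M')
    (hc : IsCompl M M') :
    ∃ p : V →ₗ[ℂ] M, (∀ x : M, p x = x) ∧ (∀ x ∈ M', p x = 0) ∧
      ∀ g x, (p (T g x) : V) = T g (p x) := by
  refine ⟨M.projectionOnto M' hc, fun x => by simp, fun x hx => by simp [hx], fun g x => ?_⟩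
  obtain ⟨a, ha, b, hb, rfl⟩ := Submodule.mem_sup.1
    (show x ∈ M ⊔ M' by rw [hc.sup_eq_top]; trivial)
  have h1 : M.projectionOnto M' hc a = ⟨a, ha⟩ := M.projectionOnto_apply_left hc ⟨a, ha⟩
  have h2 : M.projectionOnto M' hc (T g a) = ⟨T g a, hM g a ha⟩ :=
    M.projectionOnto_apply_left hc ⟨_, hM g a ha⟩
  have h3 : M.projectionOnto M' hc b = 0 := by simp [hb]
  have h4 : M.projectionOnto M' hc (T g b) = 0 := by simp [hM' g b hb]
  simp [map_add, h1, h2, h3, h4]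

end Commutants

/-! ### Multiplicity-freeness as commutativity of the endomorphism algebra -/

section MultiplicityFree

variable {G : Type*} [Group G]

theorem irreducible_of_stable {V : Type*} [AddCommGroup V] [Module ℂ V]
    (ρ : Representation ℂ G V) [Nontrivial V]
    (h : ∀ M : Submodule ℂ V, Stable (fun g => ρ g) M → M = ⊥ ∨ M = ⊤) : ρ.IsIrreducible where
  exists_pair_ne := ⟨⊥, ⊤, fun h => bot_ne_top (α := Submodule ℂ V)
    (congrArg Subrepresentation.toSubmodule h)⟩
  eq_bot_or_eq_top S := by
    rcases h S.toSubmodule (fun g x hx => S.apply_mem_toSubmodule g hx) with h | h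
    · exact Or.inl (Subrepresentation.toSubmodule_injective h)
    · exact Or.inr (Subrepresentation.toSubmodule_injective h)

theorem eq_bot_or_eq_top_of_irreducible {V : Type*} [AddCommGroup V] [Module ℂ V]
    {ρ : Representation ℂ G V} (hρ : ρ.IsIrreducible)
    (M : Submodule ℂ V) (hM : Stable (fun g => ρ g) M) : M = ⊥ ∨ M = ⊤ := by
  rcases hρ.eq_bot_or_eq_top ⟨M, fun g x hx => hM g x hx⟩ with h | h
  · exact Or.inl (congrArg Subrepresentation.toSubmodule h)
  · exact Or.inr (congrArg Subrepresentation.toSubmodule h)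

/-- A nonzero commutator would have an irreducible submodule M in its image. Projection onto M spans
its Hom space, so every endomorphism acts on it by a scalar under composition; scalars commute, so
the projection kills the commutator, contradicting that M lies in the image. -/
theorem comm_of_rank_le_one {V : Type*} [AddCommGroup V] [Module ℂ V] [FiniteDimensional ℂ V]
    (π : Representation ℂ G V) (hss : SemisimpleOn (fun g => π g) ⊤)
    (hmf : ∀ (Γ : Type) [AddCommGroup Γ] [Module ℂ Γ] [FiniteDimensional ℂ Γ]
      (γ : Representation ℂ G Γ), γ.IsIrreducible →
        Module.rank ℂ (Representation.IntertwiningMap π γ) ≤ 1)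
    (f h : Representation.IntertwiningMap π π) : f * h = h * f := by
  by_contra hne
  set c : Representation.IntertwiningMap π π := f * h - h * f with hc
  have hc0 : c ≠ 0 := sub_ne_zero.2 hne
  have hR : Stable (fun g => π g) c.range.toSubmodule :=
    fun g x hx => c.range.apply_mem_toSubmodule g hx
  obtain ⟨M, hMR, hMs, hM0, hMmin⟩ := exists_minimal_stable _ _ hR (by
    intro h0
    apply hc0
    ext1
    exact LinearMap.range_eq_bot.1 h0)
  obtain ⟨M', -, hM's, hinf, hsup⟩ := hss M le_top hMs
  obtain ⟨p, hp, -, hpT⟩ := exists_equivariant_projection _ M M' hMs hM's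
    ⟨disjoint_iff.2 hinf, codisjoint_iff.2 hsup⟩
  let S : Subrepresentation π := ⟨M, fun g x hx => hMs g x hx⟩
  -- The test representations Γ live in `Type`, so M is copied onto a coordinate space.
  let e : M ≃ₗ[ℂ] (Fin (Module.finrank ℂ M) → ℂ) := (Module.finBasis ℂ M).equivFun
  let γ : Representation ℂ G (Fin (Module.finrank ℂ M) → ℂ) :=
    { toFun := fun g => e.conj (S.toRepresentation g)
      map_one' := by simp [LinearEquiv.conj_apply, Module.End.one_eq_id]
      map_mul' := fun g k => by
        rw [map_mul, Module.End.mul_eq_comp, LinearEquiv.conj_comp]; rfl }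
  have hγ : ∀ g (x : M), γ g (e x) = e (S.toRepresentation g x) := fun g x => by
    simp [γ, LinearEquiv.conj_apply]
  have : Nontrivial M := Submodule.nontrivial_iff_ne_bot.2 hM0
  have : Nontrivial (Fin (Module.finrank ℂ M) → ℂ) := e.symm.toEquiv.nontrivial
  have hirr : γ.IsIrreducible := by
    apply irreducible_of_stable
    intro N hN
    have hs : Stable (fun g => π g) ((N.comap e.toLinearMap).map M.subtype) := by
      rintro g _ ⟨x, hx, rfl⟩
      refine ⟨S.toRepresentation g x, ?_, rfl⟩
      have := hN g (e x) hx
      simp only [hγ] at this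
      exact this
    rcases hMmin _ (by rintro _ ⟨x, -, rfl⟩; exact x.2) hs with h0 | h0
    · left
      rw [eq_bot_iff]
      intro y hy
      have : ((e.symm y : M) : V) ∈ (N.comap e.toLinearMap).map M.subtype :=
        ⟨e.symm y, by simpa using hy, rfl⟩
      rw [h0] at this
      simpa using this
    · right
      rw [eq_top_iff]
      intro y _
      have : ((e.symm y : M) : V) ∈ (N.comap e.toLinearMap).map M.subtype := by
        rw [h0]; exact (e.symm y).2
      obtain ⟨z, hz, hzy⟩ := this
      have : z = e.symm y := Subtype.ext hzy
      subst this
      simpa using hz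
  let P : Representation.IntertwiningMap π γ :=
    ⟨e.toLinearMap ∘ₗ p, fun g => by
      ext1 x
      simp only [LinearMap.comp_apply, LinearEquiv.coe_coe, hγ]
      congr 1
      exact Subtype.ext (hpT g x)⟩
  have hP0 : P ≠ 0 := by
    intro h0
    obtain ⟨x, hx⟩ := exists_ne (0 : M)
    apply hx
    have := congrArg (fun F => F.toLinearMap (x : V)) h0
    simpa [P, hp] using this
  have hrank := rank_le_one_iff.1 (hmf _ γ hirr)
  obtain ⟨F, hF⟩ := hrank
  obtain ⟨c0, hc0F⟩ := hF P
  have hc00 : c0 ≠ 0 := by rintro rfl; exact hP0 (by rw [← hc0F, zero_smul])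
  -- The Hom space is the line through P, so precomposition with an endomorphism is multiplication
  -- by a scalar.
  have hscal : ∀ k : Representation.IntertwiningMap π π, ∃ a : ℂ, P.comp k = a • P := by
    intro k
    obtain ⟨a, ha⟩ := hF (P.comp k)
    refine ⟨a * c0⁻¹, ?_⟩
    rw [← ha, ← hc0F, smul_smul, mul_assoc, inv_mul_cancel₀ hc00, mul_one]
  obtain ⟨a, ha⟩ := hscal f
  obtain ⟨b, hb⟩ := hscal h
  have ha' : ∀ x, P (f x) = a • P x := fun x => congrArg (fun F => F x) ha
  have hb' : ∀ x, P (h x) = b • P x := fun x => congrArg (fun F => F x) hb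
  have hPc : ∀ x, P (c x) = 0 := by
    intro x
    have : c x = f (h x) - h (f x) := rfl
    rw [this, map_sub, ha', hb', hb', ha', smul_smul, smul_smul, mul_comm, sub_self]
  obtain ⟨x, hx⟩ := exists_ne (0 : M)
  obtain ⟨y, hy⟩ := hMR x.2
  apply hx
  have h1 := hPc y
  have h2 : c y = x := hy
  rw [h2] at h1
  have h3 : P (x : V) = e x := by
    change e (p x) = e x
    rw [hp]
  rw [h3] at h1
  simpa using h1

/-- A nonzero f is surjective and has an equivariant section s by complete reducibility. For any
other h, Schur makes h ∘ s a scalar c, and commutativity of s ∘ f with s ∘ h forces h = c f. -/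
theorem rank_le_one_of_comm {V : Type*} [AddCommGroup V] [Module ℂ V] [FiniteDimensional ℂ V]
    (π : Representation ℂ G V) (hss : SemisimpleOn (fun g => π g) ⊤)
    (hcomm : ∀ f h : Representation.IntertwiningMap π π, f * h = h * f)
    {Γ : Type*} [AddCommGroup Γ] [Module ℂ Γ] [FiniteDimensional ℂ Γ]
    (γ : Representation ℂ G Γ) (hγ : γ.IsIrreducible) :
    Module.rank ℂ (Representation.IntertwiningMap π γ) ≤ 1 := by
  rw [rank_le_one_iff]
  by_cases hall : ∀ f : Representation.IntertwiningMap π γ, f = 0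
  · exact ⟨0, fun f => ⟨0, by rw [hall f, smul_zero]⟩⟩
  push Not at hall
  obtain ⟨f, hf⟩ := hall
  refine ⟨f, fun h => ?_⟩
  have hsurj : Function.Surjective f :=
    (Representation.IsIrreducible.surjective_or_eq_zero f).resolve_right hf
  obtain ⟨M', -, hM's, hinf, hsup⟩ := hss f.ker.toSubmodule le_top
    (fun g x hx => f.ker.apply_mem_toSubmodule g hx)
  have hmem : ∀ x, x ∈ f.ker.toSubmodule ↔ f x = 0 := fun x => Iff.rfl
  have hbij : Function.Bijective (f.toLinearMap.domRestrict M') := by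
    constructor
    · rw [← LinearMap.ker_eq_bot, LinearMap.ker_eq_bot']
      rintro ⟨x, hx⟩ h0
      have : x ∈ f.ker.toSubmodule ⊓ M' := ⟨h0, hx⟩
      rw [hinf] at this
      exact Subtype.ext this
    · intro y
      obtain ⟨x, rfl⟩ := hsurj y
      obtain ⟨a, ha, b, hb, rfl⟩ := Submodule.mem_sup.1
        (show x ∈ f.ker.toSubmodule ⊔ M' by rw [hsup]; trivial)
      refine ⟨⟨b, hb⟩, ?_⟩
      change f b = f (a + b)
      rw [map_add, (hmem a).1 ha, zero_add]
  let E := LinearEquiv.ofBijective _ hbij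
  have hE : ∀ x : M', E x = f x := fun x => rfl
  let s : Representation.IntertwiningMap γ π :=
    ⟨M'.subtype ∘ₗ E.symm.toLinearMap, fun g => by
      ext1 y
      obtain ⟨x, rfl⟩ := E.surjective y
      have : γ g (E x) = E ⟨π g x, hM's g x x.2⟩ := by
        rw [hE, hE, ← f.isIntertwining]
      simp only [LinearMap.comp_apply, LinearEquiv.coe_coe, this, LinearEquiv.symm_apply_apply]
      rfl⟩
  have hfs : ∀ y, f (s y) = y := fun y => E.apply_symm_apply y
  have hsinj : Function.Injective s := fun x y hxy => by rw [← hfs x, hxy, hfs]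
  obtain ⟨c, hc⟩ := Representation.IsIrreducible.algebraMap_intertwiningMap_bijective_of_isAlgClosed
    (ρ := γ) |>.2 (h.comp s)
  have hc' : ∀ y, h (s y) = c • y := fun y => (congrArg (fun F => F y) hc).symm
  refine ⟨c, ?_⟩
  ext x
  -- Evaluated at x this reads s f s h x = s h s f x; cancelling f ∘ s = 1 and the injective s
  -- leaves h x = c f x.
  have := congrArg (fun F => F x) (hcomm (s.comp f) (s.comp h))
  have h2 : s (f (s (h x))) = s (h (s (f x))) := this
  rw [hfs] at h2
  have h3 := hsinj h2
  rw [hc'] at h3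
  exact h3.symm

end MultiplicityFree
end SuperMF

namespace SuperMF

/-! ### Minimal vectors in conjugacy orbits and the moment map -/

section KempfNess

open Filter Topology

section NormedAlgebra

variable {A ι : Type*} [NormedRing A] [Fintype ι]

/-- The sum of the squared norms of the conjugates of a tuple of elements of a normed ring. -/
noncomputable def conjEnergy (X : ι → A) (h : Aˣ) : ℝ :=
  ∑ i, ‖(h : A) * X i * (h⁻¹ : Aˣ)‖ ^ 2

theorem bddBelow_range_conjEnergy (X : ι → A) : BddBelow (Set.range (conjEnergy X)) :=
  ⟨0, by rintro _ ⟨h, rfl⟩; exact Finset.sum_nonneg fun i _ => sq_nonneg _⟩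

/-- Along a minimizing sequence the conjugates are bounded, and the conjugating elements can be
rescaled to norm one, so compactness yields a limit of both. The limit b may be singular, but it is
nonzero and still intertwines X with the limit tuple W. -/
theorem exists_limit_conjEnergy [NormedAlgebra ℂ A] [FiniteDimensional ℂ A] [Nontrivial A]
    (X : ι → A) : ∃ (b : A) (W : ι → A), b ≠ 0 ∧ (∀ i, b * X i = W i * b) ∧
      ∑ i, ‖W i‖ ^ 2 = sInf (Set.range (conjEnergy X)) := by
  have hbdd := bddBelow_range_conjEnergy X
  obtain ⟨u, -, hu, humem⟩ := exists_seq_tendsto_sInf (Set.range_nonempty (conjEnergy X)) hbdd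
  choose h hh using humem
  have : ProperSpace A := FiniteDimensional.proper ℂ _
  obtain ⟨C, hC⟩ := hu.bddAbove_range
  -- Conjugation does not see the scale of h, and the relation a X = Z a involves no inverse, so it
  -- passes to the limit.
  let a : ℕ → A := fun k => ((‖(h k : A)‖ : ℂ)⁻¹) • (h k : A)
  let Z : ℕ → ι → A := fun k i => (h k : A) * X i * ((h k)⁻¹ : Aˣ)
  have ha : ∀ k, ‖a k‖ = 1 := by
    intro k
    have : ‖(h k : A)‖ ≠ 0 := norm_ne_zero_iff.2 (h k).ne_zero
    simp [a, norm_smul, this]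
  have haX : ∀ k i, a k * X i = Z k i * a k := by
    intro k i
    simp [a, Z, mul_assoc]
  have hZ : ∀ k i, ‖Z k i‖ ≤ C + 1 := by
    intro k i
    have h1 : ‖Z k i‖ ^ 2 ≤ conjEnergy X (h k) :=
      Finset.single_le_sum (f := fun i => ‖Z k i‖ ^ 2) (fun i _ => sq_nonneg _) (Finset.mem_univ i)
    have h2 : conjEnergy X (h k) ≤ C := by rw [hh]; exact hC ⟨k, rfl⟩
    nlinarith [norm_nonneg (Z k i), sq_nonneg (‖Z k i‖ - 1)]
  have hbd : Bornology.IsBounded (Metric.closedBall (0 : A) 1 ×ˢ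
      Metric.closedBall (0 : ι → A) (|C + 1|)) :=
    Metric.isBounded_closedBall.prod Metric.isBounded_closedBall
  obtain ⟨⟨b, W⟩, -, φ, hφ, hlim⟩ := tendsto_subseq_of_bounded hbd (x := fun k => (a k, Z k))
    (fun k => ⟨by simp [ha], by
      rw [mem_closedBall_zero_iff, pi_norm_le_iff_of_nonneg (abs_nonneg _)]
      exact fun i => (hZ k i).trans (le_abs_self _)⟩)
  have hlb : Tendsto (fun k => a (φ k)) atTop (𝓝 b) := (continuous_fst.tendsto _).comp hlim
  have hlW : ∀ i, Tendsto (fun k => Z (φ k) i) atTop (𝓝 (W i)) := fun i =>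
    ((continuous_apply i).tendsto _).comp ((continuous_snd.tendsto _).comp hlim)
  have hb1 : ‖b‖ = 1 := tendsto_nhds_unique hlb.norm (by simp [ha])
  refine ⟨b, W, by rintro rfl; simp at hb1, fun i => ?_, ?_⟩
  · refine tendsto_nhds_unique (hlb.mul_const (X i)) ?_
    simp_rw [haX]
    exact (hlW i).mul hlb
  · refine tendsto_nhds_unique ?_ (hu.comp hφ.tendsto_atTop)
    have h1 : (u ∘ φ) = fun k => ∑ i, ‖Z (φ k) i‖ ^ 2 := by
      ext k
      exact (hh (φ k)).symm
    rw [h1]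
    exact tendsto_finsetSum _ fun i _ => (hlW i).norm.pow 2

theorem hasDerivAt_conj_mul_star [NormedAlgebra ℝ A] [CompleteSpace A] [StarRing A]
    [ContinuousStar A] [StarModule ℝ A] (ℓ : A →L[ℝ] ℝ) (a y : A) :
    HasDerivAt (fun t : ℝ => ℓ ((NormedSpace.exp (t • a) * y * NormedSpace.exp (t • -a)) *
      star (NormedSpace.exp (t • a) * y * NormedSpace.exp (t • -a))))
      (ℓ ((a * y - y * a) * star y + y * star (a * y - y * a))) 0 := by
  have he : HasDerivAt (fun t : ℝ => NormedSpace.exp (t • a)) a 0 := by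
    simpa using hasDerivAt_exp_smul_const (𝕂 := ℝ) a (0 : ℝ)
  have he' : HasDerivAt (fun t : ℝ => NormedSpace.exp (t • -a)) (-a) 0 := by
    simpa only [zero_smul, NormedSpace.exp_zero, one_mul] using
      hasDerivAt_exp_smul_const (𝕂 := ℝ) (-a) (0 : ℝ)
  have hW := (he.mul_const y).mul he'
  simp only [zero_smul, NormedSpace.exp_zero, one_mul, mul_one, mul_neg, ← sub_eq_add_neg] at hW
  have h1 := hW.mul hW.star
  simp only [Pi.mul_apply, zero_smul, NormedSpace.exp_zero, one_mul, mul_one] at h1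
  exact ℓ.hasFDerivAt.comp_hasDerivAt (0 : ℝ) h1

theorem exp_smul_mul_exp_smul_neg [NormedAlgebra ℝ A] [CompleteSpace A] (a : A) (t : ℝ) :
    NormedSpace.exp (t • a) * NormedSpace.exp (t • -a) = 1 := by
  have : NormedAlgebra ℚ A := NormedAlgebra.restrictScalars ℚ ℝ A
  rw [smul_neg, ← NormedSpace.exp_add_of_commute (Commute.neg_right (Commute.refl _))]
  simp

end NormedAlgebra

open scoped Matrix Matrix.Norms.Frobenius

variable {n ι : Type*} [Fintype n] [DecidableEq n]

/-- The kernel of an intertwiner is invariant under X, so it is trivial when X acts irreducibly and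
a is nonzero. This rules out degeneration of the limit and makes the infimum of the energy a
minimum. -/
theorem isUnit_of_intertwines (X Z : ι → Matrix n n ℂ)
    (hX : ∀ N : Submodule ℂ (n → ℂ), (∀ i, ∀ v ∈ N, X i *ᵥ v ∈ N) → N = ⊥ ∨ N = ⊤)
    (a : Matrix n n ℂ) (ha : a ≠ 0) (haX : ∀ i, a * X i = Z i * a) : IsUnit a := by
  rw [← Matrix.mulVec_injective_iff_isUnit]
  rcases hX (LinearMap.ker a.mulVecLin) (by
    intro i v hv
    simp only [LinearMap.mem_ker, Matrix.mulVecLin_apply] at hv ⊢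
    rw [Matrix.mulVec_mulVec, haX, ← Matrix.mulVec_mulVec, hv, Matrix.mulVec_zero]) with h | h
  · exact LinearMap.ker_eq_bot.1 h
  · exfalso
    apply ha
    rw [LinearMap.ker_eq_top] at h
    ext i j
    have := congrFun (LinearMap.congr_fun h (Pi.single j 1)) i
    simpa using this

variable [Fintype ι]

theorem exists_conjEnergy_le [Nonempty n] (X : ι → Matrix n n ℂ)
    (hX : ∀ N : Submodule ℂ (n → ℂ), (∀ i, ∀ v ∈ N, X i *ᵥ v ∈ N) → N = ⊥ ∨ N = ⊤) :
    ∃ t : (Matrix n n ℂ)ˣ, ∀ h, conjEnergy X t ≤ conjEnergy X h := by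
  obtain ⟨b, W, hb, hbX, hE⟩ := exists_limit_conjEnergy X
  obtain ⟨t, ht⟩ := isUnit_of_intertwines X W hX b hb hbX
  have hW : ∀ i, (t : Matrix n n ℂ) * X i * (t⁻¹ : (Matrix n n ℂ)ˣ) = W i := by
    intro i
    rw [ht, hbX, ← ht, Units.mul_inv_cancel_right]
  refine ⟨t, fun k => ?_⟩
  have : conjEnergy X t = sInf (Set.range (conjEnergy X)) := by
    rw [← hE]
    simp only [conjEnergy, hW]
  rw [this]
  exact csInf_le (bddBelow_range_conjEnergy X) ⟨k, rfl⟩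

theorem frobenius_norm_sq_eq_trace (A : Matrix n n ℂ) : ‖A‖ ^ 2 = (A * Aᴴ).trace.re := by
  rw [Matrix.frobenius_norm_def, ← Real.sqrt_eq_rpow, Real.sq_sqrt (by positivity)]
  simp only [Matrix.trace, Matrix.diag, Matrix.mul_apply, Matrix.conjTranspose_apply, Complex.re_sum]
  refine Finset.sum_congr rfl fun i _ => Finset.sum_congr rfl fun j _ => ?_
  rw [Complex.star_def, Complex.mul_conj, Complex.ofReal_re, Complex.normSq_eq_norm_sq]
  norm_cast

/-- The moment map of a tuple of matrices. -/
noncomputable def moment (Y : ι → Matrix n n ℂ) : Matrix n n ℂ :=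
  ∑ i, (Y i * (Y i)ᴴ - (Y i)ᴴ * Y i)

theorem moment_isHermitian (Y : ι → Matrix n n ℂ) : (moment Y)ᴴ = moment Y := by
  simp [moment, Matrix.conjTranspose_sum, Matrix.conjTranspose_sub, Matrix.conjTranspose_mul]

/-- The moment matrix M is itself the gradient direction: the energy along exp(tM) has derivative 2
tr(M M*) = 2‖M‖² at 0, which must vanish at a minimum. -/
theorem moment_eq_zero_of_conjEnergy_le (Y : ι → Matrix n n ℂ)
    (hY : ∀ h, conjEnergy Y 1 ≤ conjEnergy Y h) : moment Y = 0 := by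
  set M := moment Y with hM
  -- The one-parameter group generated by M, given as a curve of units.
  let g : ℝ → (Matrix n n ℂ)ˣ := fun t =>
    ⟨NormedSpace.exp (t • M), NormedSpace.exp (t • -M), exp_smul_mul_exp_smul_neg M t, by
      have := exp_smul_mul_exp_smul_neg (-M) t
      rwa [neg_neg] at this⟩
  let ℓ : Matrix n n ℂ →L[ℝ] ℝ :=
    LinearMap.toContinuousLinearMap (Complex.reLm ∘ₗ
      (Matrix.traceLinearMap n ℂ ℂ).restrictScalars ℝ)
  have hℓ : ∀ B, ℓ B = B.trace.re := fun B => rfl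
  have hF : HasDerivAt (fun t => conjEnergy Y (g t))
      (∑ i, ((M * Y i - Y i * M) * (Y i)ᴴ + Y i * (M * Y i - Y i * M)ᴴ).trace.re) 0 := by
    simp only [conjEnergy, frobenius_norm_sq_eq_trace]
    exact HasDerivAt.fun_sum fun i _ => hasDerivAt_conj_mul_star ℓ M (Y i)
  have hmin : IsLocalMin (fun t => conjEnergy Y (g t)) 0 := by
    refine Filter.Eventually.of_forall fun t => ?_
    have h0 : g 0 = 1 := by
      ext1
      simp [g]
    simp only [h0]
    exact hY _
  have h0 := hmin.hasDerivAt_eq_zero hF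
  have hH : Mᴴ = M := moment_isHermitian Y
  have hsum : ∑ i, ((M * Y i - Y i * M) * (Y i)ᴴ + Y i * (M * Y i - Y i * M)ᴴ).trace.re
      = 2 * (M * Mᴴ).trace.re := by
    have h1 : ∀ i, ((M * Y i - Y i * M) * (Y i)ᴴ + Y i * (M * Y i - Y i * M)ᴴ).trace
        = 2 * (M * (Y i * (Y i)ᴴ - (Y i)ᴴ * Y i)).trace := by
      intro i
      simp only [Matrix.conjTranspose_sub, Matrix.conjTranspose_mul, hH, sub_mul, mul_sub,
        Matrix.trace_add, Matrix.trace_sub]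
      have a1 : (M * Y i * (Y i)ᴴ).trace = (M * (Y i * (Y i)ᴴ)).trace := by rw [mul_assoc]
      have a2 : (Y i * M * (Y i)ᴴ).trace = (M * ((Y i)ᴴ * Y i)).trace := by
        rw [mul_assoc, Matrix.trace_mul_comm, mul_assoc]
      have a3 : (Y i * ((Y i)ᴴ * M)).trace = (M * (Y i * (Y i)ᴴ)).trace := by
        rw [← mul_assoc, Matrix.trace_mul_comm]
      have a4 : (Y i * (M * (Y i)ᴴ)).trace = (M * ((Y i)ᴴ * Y i)).trace := by
        rw [Matrix.trace_mul_comm, mul_assoc]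
      rw [a1, a2, a3, a4]
      ring
    rw [← Complex.re_sum, Finset.sum_congr rfl fun i _ => h1 i, ← Finset.mul_sum,
      ← Matrix.trace_sum, ← Finset.mul_sum, hH]
    simp [hM, moment]
  rw [hsum, ← frobenius_norm_sq_eq_trace] at h0
  have : ‖M‖ = 0 := by nlinarith [norm_nonneg M]
  exact norm_eq_zero.1 this

theorem exists_conj_moment_eq_zero (X : ι → Matrix n n ℂ)
    (hX : ∀ N : Submodule ℂ (n → ℂ), (∀ i, ∀ v ∈ N, X i *ᵥ v ∈ N) → N = ⊥ ∨ N = ⊤) :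
    ∃ t : (Matrix n n ℂ)ˣ,
      moment (fun i => (t : Matrix n n ℂ) * X i * ((t⁻¹ : (Matrix n n ℂ)ˣ) : Matrix n n ℂ)) = 0 := by
  rcases isEmpty_or_nonempty n with hn | hn
  · exact ⟨1, Subsingleton.elim _ _⟩
  obtain ⟨t, ht⟩ := exists_conjEnergy_le X hX
  refine ⟨t, moment_eq_zero_of_conjEnergy_le _ fun h => ?_⟩
  have h1 := ht (h * t)
  simpa [conjEnergy, mul_assoc] using h1

end KempfNess

/-! ### Invariant complements when the moment map vanishes -/

section Moment

open scoped Matrix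

variable {n ι : Type*} [Fintype n] [DecidableEq n] [Fintype ι]

/-- Vanishing moment means ∑ ‖A_i* v‖² = ∑ ‖A_i v‖² for all v. Summing over an orthonormal basis of
N, the N-components of the vectors A_i* b_k already account for the whole right-hand side, since
both are sums of |⟨A_i b_l, b_k⟩|². So nothing is left for the components orthogonal to N. -/
theorem conjTranspose_mulVec_mem_of_moment_eq_zero (Y : ι → Matrix n n ℂ) (hY : moment Y = 0)
    (N : Submodule ℂ (EuclideanSpace ℂ n))
    (hN : ∀ i, ∀ v ∈ N, Matrix.toEuclideanLin (Y i) v ∈ N) :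
    ∀ i, ∀ v ∈ N, Matrix.toEuclideanLin (Y i)ᴴ v ∈ N := by
  set A : ι → EuclideanSpace ℂ n →ₗ[ℂ] EuclideanSpace ℂ n := fun i => Matrix.toEuclideanLin (Y i)
    with hA
  have hadj : ∀ i, Matrix.toEuclideanLin (Y i)ᴴ = LinearMap.adjoint (A i) := fun i =>
    Matrix.toEuclideanLin_conjTranspose_eq_adjoint (Y i)
  simp only [hadj]
  have hmom : ∀ v : EuclideanSpace ℂ n,
      ∑ i, ‖LinearMap.adjoint (A i) v‖ ^ 2 = ∑ i, ‖A i v‖ ^ 2 := by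
    intro v
    have h1 : ∑ i, (A i (LinearMap.adjoint (A i) v) - LinearMap.adjoint (A i) (A i v)) = 0 := by
      have h2 := congrArg (fun B : Matrix n n ℂ => Matrix.toEuclideanLin B v) hY
      simp only [moment, map_sum, map_sub, LinearMap.sum_apply, LinearMap.sub_apply, map_zero,
        LinearMap.zero_apply] at h2
      rw [← h2]
      refine Finset.sum_congr rfl fun i _ => ?_
      rw [← hadj]
      simp [hA, Matrix.toLpLin_apply, Matrix.mulVec_mulVec]
    have h3 := congrArg (fun w => RCLike.re (inner ℂ w v)) h1
    simp only [sum_inner, inner_sub_left, map_sum, map_sub, inner_zero_left, map_zero] at h3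
    rw [Finset.sum_sub_distrib, sub_eq_zero] at h3
    have h4 : ∀ i, RCLike.re (inner ℂ (A i (LinearMap.adjoint (A i) v)) v)
        = ‖LinearMap.adjoint (A i) v‖ ^ 2 := fun i => by
      rw [← LinearMap.adjoint_inner_right, inner_self_eq_norm_sq]
    have h5 : ∀ i, RCLike.re (inner ℂ (LinearMap.adjoint (A i) (A i v)) v) = ‖A i v‖ ^ 2 :=
      fun i => by rw [LinearMap.adjoint_inner_left, inner_self_eq_norm_sq]
    simpa only [h4, h5] using h3
  let b := stdOrthonormalBasis ℂ N
  let P := N.starProjection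
  -- the part of `A i ^* v` orthogonal to `N` has total square norm zero
  have hsplit : ∀ w : EuclideanSpace ℂ n, ‖w‖ ^ 2 = ‖P w‖ ^ 2 + ‖w - P w‖ ^ 2 := by
    intro w
    have := Submodule.norm_sq_eq_add_norm_sq_starProjection w N
    rw [Submodule.starProjection_orthogonal_val] at this
    exact this
  have hPar : ∀ w ∈ N, ‖w‖ ^ 2 = ∑ k, ‖inner ℂ (b k : EuclideanSpace ℂ n) w‖ ^ 2 := by
    intro w hw
    have := b.sum_sq_norm_inner_right ⟨w, hw⟩
    simpa using this.symm
  -- The compression of A_i to N and its adjoint have the same Hilbert–Schmidt norm; as N is stable,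
  -- compressing A_i loses nothing.
  have hmid : ∑ k, ∑ i, ‖P (LinearMap.adjoint (A i) (b k))‖ ^ 2 = ∑ k, ∑ i, ‖A i (b k)‖ ^ 2 := by
    rw [Finset.sum_comm, Finset.sum_comm (s := Finset.univ (α := Fin _))]
    refine Finset.sum_congr rfl fun i _ => ?_
    have h1 : ∀ k, ‖P (LinearMap.adjoint (A i) (b k))‖ ^ 2
        = ∑ l, ‖inner ℂ (A i (b l)) (b k : EuclideanSpace ℂ n)‖ ^ 2 := by
      intro k
      rw [hPar _ (N.starProjection_apply_mem _)]
      refine Finset.sum_congr rfl fun l _ => ?_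
      rw [← N.inner_starProjection_left_eq_right, Submodule.starProjection_eq_self_iff.2 (b l).2,
        LinearMap.adjoint_inner_right]
    have h2 : ∀ k, ‖A i (b k)‖ ^ 2
        = ∑ l, ‖inner ℂ (b l : EuclideanSpace ℂ n) (A i (b k))‖ ^ 2 := fun k =>
      hPar _ (hN i _ (b k).2)
    simp only [h1, h2]
    rw [Finset.sum_comm]
    refine Finset.sum_congr rfl fun l _ => Finset.sum_congr rfl fun k _ => ?_
    rw [norm_inner_symm]
  have hzero : ∑ k, ∑ i, ‖LinearMap.adjoint (A i) (b k) - P (LinearMap.adjoint (A i) (b k))‖ ^ 2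
      = 0 := by
    have h1 : ∑ k, ∑ i, ‖LinearMap.adjoint (A i) (b k)‖ ^ 2 = ∑ k, ∑ i, ‖A i (b k)‖ ^ 2 :=
      Finset.sum_congr rfl fun k _ => hmom _
    simp only [hsplit (LinearMap.adjoint (A _) _), Finset.sum_add_distrib, hmid] at h1
    linarith
  have hb : ∀ k i, LinearMap.adjoint (A i) (b k) ∈ N := by
    intro k i
    rw [Finset.sum_eq_zero_iff_of_nonneg (fun _ _ => Finset.sum_nonneg fun _ _ => sq_nonneg _)]
      at hzero
    have h1 := hzero k (Finset.mem_univ _)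
    rw [Finset.sum_eq_zero_iff_of_nonneg (fun _ _ => sq_nonneg _)] at h1
    have h2 := h1 i (Finset.mem_univ _)
    have h3 : LinearMap.adjoint (A i) (b k) = P (LinearMap.adjoint (A i) (b k)) := by
      rw [← sub_eq_zero, ← norm_eq_zero]
      exact pow_eq_zero_iff (two_ne_zero) |>.1 h2
    rw [h3]
    exact N.starProjection_apply_mem _
  intro i v hv
  have hv' : v = ∑ k, b.repr ⟨v, hv⟩ k • (b k : EuclideanSpace ℂ n) := by
    have := congrArg Subtype.val (b.sum_repr ⟨v, hv⟩)
    simpa using this.symm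
  rw [hv', map_sum]
  exact N.sum_mem fun k _ => by
    rw [map_smul]
    exact N.smul_mem _ (hb k i)

/-- If the moment map vanishes then the orthogonal complement of an invariant subspace is
invariant. -/
theorem exists_invariant_compl_of_moment_eq_zero (Y : ι → Matrix n n ℂ) (hY : moment Y = 0)
    (N : Submodule ℂ (n → ℂ)) (hN : ∀ i, ∀ v ∈ N, Y i *ᵥ v ∈ N) :
    ∃ N' : Submodule ℂ (n → ℂ), IsCompl N N' ∧ ∀ i, ∀ v ∈ N', Y i *ᵥ v ∈ N' := by
  let e : EuclideanSpace ℂ n ≃ₗ[ℂ] (n → ℂ) := WithLp.linearEquiv 2 ℂ (n → ℂ)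
  let K : Submodule ℂ (EuclideanSpace ℂ n) := N.comap e.toLinearMap
  have hK : ∀ i, ∀ v ∈ K, Matrix.toEuclideanLin (Y i) v ∈ K := fun i v hv => hN i (e v) hv
  have hK' := conjTranspose_mulVec_mem_of_moment_eq_zero Y hY K hK
  refine ⟨Kᗮ.comap e.symm.toLinearMap, ?_, ?_⟩
  · have h1 : IsCompl K Kᗮ := K.isCompl_orthogonal
    constructor
    · rw [Submodule.disjoint_def]
      intro x hx hx'
      have h2 := Submodule.disjoint_def.1 h1.disjoint (e.symm x) (by simpa [K] using hx) hx'
      simpa using h2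
    · rw [codisjoint_iff, eq_top_iff]
      intro x _
      obtain ⟨a, ha, c, hc, hac⟩ := Submodule.mem_sup.1
        (show e.symm x ∈ K ⊔ Kᗮ by rw [h1.sup_eq_top]; trivial)
      refine Submodule.mem_sup.2 ⟨e a, ha, e c, by simpa using hc, ?_⟩
      rw [← map_add, hac, LinearEquiv.apply_symm_apply]
  · intro i v hv
    have h1 : e.symm v ∈ Kᗮ := hv
    change Matrix.toEuclideanLin (Y i) (e.symm v) ∈ Kᗮ
    rw [Submodule.mem_orthogonal] at h1 ⊢
    intro u hu
    have h2 := h1 _ (hK' i u hu)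
    rw [Matrix.toEuclideanLin_conjTranspose_eq_adjoint, LinearMap.adjoint_inner_left] at h2
    exact h2

end Moment
end SuperMF

namespace SuperMF

/-! ### Uniqueness for linear differential equations -/

section LinearODE

open Set

/-- Uniqueness of solutions of the linear differential equation `Ψ' = Ψ B` for matrices. -/
theorem eq_zero_of_linear_ode {n : Type*} [Fintype n] (Ψ B : ℝ → n → n → ℂ)
    (hB : ContinuousOn B (Icc 0 1))
    (hΨ : ∀ t ∈ Icc (0 : ℝ) 1, ∀ i j, HasDerivAt (fun t => Ψ t i j) (∑ k, Ψ t i k * B t k j) t)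
    (h0 : Ψ 0 = 0) : ∀ t ∈ Icc (0 : ℝ) 1, Ψ t = 0 := by
  obtain ⟨K, hK⟩ := isCompact_Icc.exists_bound_of_continuousOn hB
  have hd : ∀ t ∈ Icc (0 : ℝ) 1, HasDerivAt Ψ (fun i j => ∑ k, Ψ t i k * B t k j) t := by
    intro t ht
    rw [hasDerivAt_pi]
    intro i
    rw [hasDerivAt_pi]
    exact fun j => hΨ t ht i j
  refine eq_zero_of_abs_deriv_le_mul_abs_self_of_eq_zero_right (K := Fintype.card n * K)
    (fun t ht => (hd t ht).continuousAt.continuousWithinAt)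
    (fun t ht => (hd t ⟨ht.1, ht.2.le⟩).hasDerivWithinAt) h0 ?_
  intro t ht
  have hK0 : 0 ≤ K := (norm_nonneg _).trans (hK t ⟨ht.1, ht.2.le⟩)
  have h1 : 0 ≤ Fintype.card n * K * ‖Ψ t‖ := by positivity
  rw [pi_norm_le_iff_of_nonneg h1]
  intro i
  rw [pi_norm_le_iff_of_nonneg h1]
  intro j
  refine (norm_sum_le _ _).trans ?_
  refine (Finset.sum_le_card_nsmul _ _ (K * ‖Ψ t‖) fun k _ => ?_).trans (by
    rw [Finset.card_univ, nsmul_eq_mul, mul_assoc])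
  rw [norm_mul, mul_comm]
  have h2 : ‖B t k j‖ ≤ K := ((norm_le_pi_norm _ j).trans (norm_le_pi_norm _ k)).trans
    (hK t ⟨ht.1, ht.2.le⟩)
  have h3 : ‖Ψ t i k‖ ≤ ‖Ψ t‖ := (norm_le_pi_norm _ k).trans (norm_le_pi_norm _ i)
  exact mul_le_mul h2 h3 (norm_nonneg _) hK0

end LinearODE

/-! ### Stability under the group and under the differential -/

section Differential

open scoped Matrix Topology
open Set

variable {E : Type*} [NormedAddCommGroup E] [NormedSpace ℂ E]
  {G : Type*} [Group G] [TopologicalSpace G] [ChartedSpace E G]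

/-- The derivative at the identity of a function on a Lie group, in the chart at the identity. -/
noncomputable def derivOne (f : G → ℂ) : E →L[ℂ] ℂ :=
  fderiv ℂ (fun x => f ((chartAt E (1 : G)).symm x)) (chartAt E (1 : G) 1)

/-- A matrix representation with holomorphic entries. -/
def IsHolomorphicMat (E : Type*) [NormedAddCommGroup E] [NormedSpace ℂ E] [ChartedSpace E G]
    {n : Type*} [Fintype n] [DecidableEq n] (R : G →* Matrix n n ℂ) : Prop :=
  ∀ i j, ContMDiff 𝓘(ℂ, E) 𝓘(ℂ, ℂ) ω (fun g => R g i j)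

/-- The differential at the identity of a matrix representation. -/
noncomputable def matDeriv {n : Type*} [Fintype n] [DecidableEq n] (R : G →* Matrix n n ℂ)
    (ξ : E) : Matrix n n ℂ :=
  Matrix.of fun i j => derivOne (fun g => R g i j) ξ

section Calculus

variable [LieGroup 𝓘(ℂ, E) ω G]

theorem differentiableOn_chart_symm {f : G → ℂ} (hf : ContMDiff 𝓘(ℂ, E) 𝓘(ℂ, ℂ) ω f) :
    DifferentiableOn ℂ (fun x => f ((chartAt E (1 : G)).symm x)) (chartAt E (1 : G)).target := by
  have h1 : ContMDiffOn 𝓘(ℂ, E) 𝓘(ℂ, ℂ) ω (f ∘ (chartAt E (1 : G)).symm)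
      (chartAt E (1 : G)).target :=
    hf.comp_contMDiffOn (contMDiffOn_chart_symm (I := 𝓘(ℂ, E)))
  rw [contMDiffOn_iff_contDiffOn] at h1
  exact h1.differentiableOn (by simp)

theorem differentiableAt_chart_symm {f : G → ℂ} (hf : ContMDiff 𝓘(ℂ, E) 𝓘(ℂ, ℂ) ω f) :
    DifferentiableAt ℂ (fun x => f ((chartAt E (1 : G)).symm x)) (chartAt E (1 : G) 1) :=
  (differentiableOn_chart_symm hf).differentiableAt
    ((chartAt E (1 : G)).open_target.mem_nhds (mem_chart_target E (1 : G)))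

theorem derivOne_sum {ι : Type*} (s : Finset ι) {f : ι → G → ℂ}
    (hf : ∀ i, ContMDiff 𝓘(ℂ, E) 𝓘(ℂ, ℂ) ω (f i)) (ξ : E) :
    derivOne (fun g => ∑ i ∈ s, f i g) ξ = ∑ i ∈ s, derivOne (f i) ξ := by
  unfold derivOne
  rw [fderiv_fun_sum fun i _ => differentiableAt_chart_symm (hf i)]
  simp

theorem derivOne_const_mul {f : G → ℂ} (hf : ContMDiff 𝓘(ℂ, E) 𝓘(ℂ, ℂ) ω f) (c : ℂ) (ξ : E) :
    derivOne (fun g => c * f g) ξ = c * derivOne f ξ := by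
  unfold derivOne
  rw [fderiv_const_mul (differentiableAt_chart_symm hf)]
  simp

theorem derivOne_mul {f h : G → ℂ} (hf : ContMDiff 𝓘(ℂ, E) 𝓘(ℂ, ℂ) ω f)
    (hh : ContMDiff 𝓘(ℂ, E) 𝓘(ℂ, ℂ) ω h) (ξ : E) :
    derivOne (fun g => f g * h g) ξ = f 1 * derivOne h ξ + h 1 * derivOne f ξ := by
  unfold derivOne
  rw [fderiv_fun_mul (differentiableAt_chart_symm hf) (differentiableAt_chart_symm hh)]
  simp [(chartAt E (1 : G)).left_inv (mem_chart_source E (1 : G))]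

/-- The derivative of a holomorphic function along a curve through the identity. -/
theorem hasDerivAt_comp_curve {f : G → ℂ} (hf : ContMDiff 𝓘(ℂ, E) 𝓘(ℂ, ℂ) ω f) (c : ℂ → G)
    (z : ℂ) (hz : c z = 1) (hc : MDifferentiableAt 𝓘(ℂ, ℂ) 𝓘(ℂ, E) c z) :
    HasDerivAt (fun w => f (c w))
      (derivOne f (deriv (fun w => chartAt E (1 : G) (c w)) z)) z := by
  have h1 : DifferentiableAt ℂ (fun w => chartAt E (1 : G) (c w)) z := by
    rw [← mdifferentiableAt_iff_differentiableAt]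
    have h2 : MDifferentiableAt 𝓘(ℂ, E) 𝓘(ℂ, E) (chartAt E (1 : G)) (c z) := by
      rw [hz]
      exact mdifferentiableAt_atlas (chart_mem_atlas E (1 : G)) (mem_chart_source E (1 : G))
    exact h2.comp z hc
  have h3 : HasDerivAt (fun w => f ((chartAt E (1 : G)).symm (chartAt E (1 : G) (c w))))
      (derivOne f (deriv (fun w => chartAt E (1 : G) (c w)) z)) z := by
    have h4 := (differentiableAt_chart_symm hf).hasFDerivAt
    have h5 : chartAt E (1 : G) 1 = chartAt E (1 : G) (c z) := by rw [hz]
    unfold derivOne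
    rw [h5] at h4 ⊢
    exact h4.comp_hasDerivAt z h1.hasDerivAt
  refine h3.congr_of_eventuallyEq ?_
  have h5 : ∀ᶠ w in 𝓝 z, c w ∈ (chartAt E (1 : G)).source :=
    hc.continuousAt.eventually_mem ((chartAt E (1 : G)).open_source.mem_nhds (by
      rw [hz]; exact mem_chart_source E (1 : G)))
  filter_upwards [h5] with w hw
  rw [(chartAt E (1 : G)).left_inv hw]

variable {n : Type*} [Fintype n] [DecidableEq n]

/-- Along any holomorphic curve a matrix representation satisfies `u' = u · dR(ξ)`. -/
theorem exists_hasDerivAt_curve {R : G →* Matrix n n ℂ} (hR : IsHolomorphicMat E R) (c : ℂ → G)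
    (z : ℂ) (hc : MDifferentiableAt 𝓘(ℂ, ℂ) 𝓘(ℂ, E) c z) :
    ∃ ξ : E, ∀ i j, HasDerivAt (fun w => R (c w) i j) ((R (c z) * matDeriv R ξ) i j) z := by
  have hc' : MDifferentiableAt 𝓘(ℂ, ℂ) 𝓘(ℂ, E) (fun w => (c z)⁻¹ * c w) z := by
    have h1 : ContMDiff 𝓘(ℂ, E) 𝓘(ℂ, E) ω ((c z)⁻¹ * · : G → G) := contMDiff_mul_left
    exact (h1.mdifferentiable (by simp) (c z)).comp z hc
  refine ⟨deriv (fun w => chartAt E (1 : G) ((c z)⁻¹ * c w)) z, fun i j => ?_⟩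
  have h2 : ∀ w, R (c w) i j = ∑ k, R (c z) i k * R ((c z)⁻¹ * c w) k j := by
    intro w
    rw [← Matrix.mul_apply, ← map_mul, mul_inv_cancel_left]
  simp only [h2]
  rw [Matrix.mul_apply]
  refine HasDerivAt.fun_sum fun k _ => ?_
  exact (hasDerivAt_comp_curve (hR k j) _ z (by simp) hc').const_mul _

/-- A subspace stable under the differential of a matrix representation is stable under the group
elements near the identity. -/
theorem eventually_stable_of_matDeriv {R : G →* Matrix n n ℂ} (hR : IsHolomorphicMat E R)
    (N : Submodule ℂ (n → ℂ)) (hN : ∀ ξ : E, ∀ v ∈ N, matDeriv R ξ *ᵥ v ∈ N) :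
    ∀ᶠ g in 𝓝 (1 : G), ∀ v ∈ N, R g *ᵥ v ∈ N := by
  have := topologicalGroup_of_lieGroup (G := G) 𝓘(ℂ, E) ω
  set φ := chartAt E (1 : G) with hφ
  obtain ⟨r, hr, hball⟩ := Metric.isOpen_iff.1 φ.open_target (φ 1) (mem_chart_target E (1 : G))
  have hnear : ∀ᶠ g in 𝓝 (1 : G), g ∈ φ.source ∧ φ g ∈ Metric.ball (φ 1) r := by
    refine Filter.Eventually.and (φ.open_source.mem_nhds (mem_chart_source E (1 : G))) ?_
    exact (φ.continuousAt (mem_chart_source E (1 : G))).eventually_mem (Metric.ball_mem_nhds _ hr)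
  filter_upwards [hnear] with g hg
  set v := φ g - φ 1 with hv
  -- A straight segment in the chart from 1 to g, in a complex parameter so that holomorphy gives
  -- continuity of derivatives.
  let c : ℂ → G := fun z => φ.symm (φ 1 + z • v)
  let U : Set ℂ := (fun z : ℂ => φ 1 + z • v) ⁻¹' φ.target
  have hU : IsOpen U := φ.open_target.preimage (by fun_prop)
  have hUI : ∀ t ∈ Icc (0 : ℝ) 1, (t : ℂ) ∈ U := by
    intro t ht
    apply hball
    rw [mem_ball_iff_norm, add_sub_cancel_left, norm_smul, Complex.norm_real, Real.norm_eq_abs,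
      abs_of_nonneg ht.1]
    have h1 : ‖v‖ < r := mem_ball_iff_norm.1 hg.2
    nlinarith [norm_nonneg v, ht.2]
  have hcM : ∀ z ∈ U, MDifferentiableAt 𝓘(ℂ, ℂ) 𝓘(ℂ, E) c z := by
    intro z hz
    have h1 : MDifferentiableAt 𝓘(ℂ, E) 𝓘(ℂ, E) φ.symm (φ 1 + z • v) :=
      mdifferentiableAt_atlas_symm (chart_mem_atlas E (1 : G)) hz
    have h2 : MDifferentiableAt 𝓘(ℂ, ℂ) 𝓘(ℂ, E) (fun z : ℂ => φ 1 + z • v) z := by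
      rw [mdifferentiableAt_iff_differentiableAt]
      fun_prop
    exact h1.comp z h2
  have hex : ∀ z, ∃ ξ : E, z ∈ U →
      ∀ i j, HasDerivAt (fun w => R (c w) i j) ((R (c z) * matDeriv R ξ) i j) z := by
    intro z
    by_cases hz : z ∈ U
    · obtain ⟨ξ, hξ⟩ := exists_hasDerivAt_curve hR c z (hcM z hz)
      exact ⟨ξ, fun _ => hξ⟩
    · exact ⟨0, fun h => absurd h hz⟩
  choose ξ hξ using hex
  -- the coefficient matrix of the differential equation is continuous
  have hB : ∀ z ∈ U, ∀ i j, matDeriv R (ξ z) i j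
      = ∑ k, R (c z)⁻¹ i k * deriv (fun w => R (c w) k j) z := by
    intro z hz i j
    have h1 : ∀ k, deriv (fun w => R (c w) k j) z = (R (c z) * matDeriv R (ξ z)) k j :=
      fun k => (hξ z hz k j).deriv
    simp only [h1]
    rw [← Matrix.mul_apply, ← mul_assoc, ← map_mul, inv_mul_cancel, map_one, one_mul]
  have hBc : ContinuousOn (fun t : ℝ => fun i j => matDeriv R (ξ (t : ℂ)) i j) (Icc 0 1) := by
    have h1 : ContinuousOn (fun z : ℂ => fun i j => ∑ k, R (c z)⁻¹ i k *
        deriv (fun w => R (c w) k j) z) U := by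
      refine continuousOn_pi.2 fun i => continuousOn_pi.2 fun j => continuousOn_finsetSum _
        fun k _ => ContinuousOn.mul ?_ ?_
      · intro z hz
        have h2 : ContinuousAt c z := (hcM z hz).continuousAt
        exact ((hR i k).continuous.continuousAt.comp h2.inv).continuousWithinAt
      · have h3 : DifferentiableOn ℂ (fun w => R (c w) k j) U :=
          fun z hz => (hξ z hz k j).differentiableAt.differentiableWithinAt
        exact (h3.deriv hU).continuousOn
    have h4 : ContinuousOn (fun z : ℂ => fun i j => matDeriv R (ξ z) i j) U :=
      h1.congr fun z hz => by
        ext i j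
        exact hB z hz i j
    exact h4.comp Complex.continuous_ofReal.continuousOn hUI
  -- a projection matrix onto `N`
  obtain ⟨p, hp⟩ := N.subtype.exists_leftInverse_of_injective N.ker_subtype
  let P : Matrix n n ℂ := LinearMap.toMatrix' (N.subtype ∘ₗ p)
  have hPv : ∀ v, P *ᵥ v = N.subtype (p v) := fun v => by
    rw [LinearMap.toMatrix'_mulVec]
    rfl
  have hPN : ∀ v ∈ N, P *ᵥ v = v := fun v hv => by
    rw [hPv]
    exact congrArg Subtype.val (LinearMap.congr_fun hp ⟨v, hv⟩)
  have hPmem : ∀ v, P *ᵥ v ∈ N := fun v => by rw [hPv]; exact (p v).2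
  have hPA : ∀ η : E, P * matDeriv R η * P = matDeriv R η * P := by
    intro η
    apply Matrix.mulVec_injective
    ext1 w
    rw [← Matrix.mulVec_mulVec, ← Matrix.mulVec_mulVec, ← Matrix.mulVec_mulVec]
    exact hPN _ (hN η _ (hPmem w))
  -- Ψ(t) measures how far R(c(t)) moves N out of itself. Since P·dR·P = dR·P, the equation u' =
  -- u·dR(ξ) yields Ψ' = Ψ·(dR·P), and Ψ(0) = 0.
  let Ψ : ℝ → Matrix n n ℂ := fun t => (1 - P) * R (c t) * P
  have hΨ0 : ∀ t ∈ Icc (0 : ℝ) 1, Ψ t = 0 := by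
    refine eq_zero_of_linear_ode Ψ (fun t => matDeriv R (ξ (t : ℂ)) * P) ?_ ?_ ?_
    · refine continuousOn_pi.2 fun i => continuousOn_pi.2 fun j => ?_
      simp only [Matrix.mul_apply]
      refine continuousOn_finsetSum _ fun k _ => ContinuousOn.mul ?_ continuousOn_const
      exact continuousOn_pi.1 (continuousOn_pi.1 hBc i) k
    · intro t ht i j
      have h1 : (Ψ t * (matDeriv R (ξ (t : ℂ)) * P)) i j
          = ((1 - P) * (R (c t) * matDeriv R (ξ (t : ℂ))) * P) i j := by
        simp only [Ψ]
        rw [mul_assoc _ P, ← mul_assoc P, hPA, mul_assoc _ (R (c t)), mul_assoc _ (R (c t) * _),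
          mul_assoc (R (c t))]
      have h2 : HasDerivAt (fun s : ℝ => ((1 - P) * R (c s) * P) i j)
          (((1 - P) * (R (c t) * matDeriv R (ξ (t : ℂ))) * P) i j) t := by
        simp only [Matrix.mul_apply (M := (1 - P) * _), Matrix.mul_apply (M := 1 - P)]
        refine HasDerivAt.fun_sum fun k _ => HasDerivAt.mul_const (HasDerivAt.fun_sum fun l _ =>
          HasDerivAt.const_mul _ ?_) _
        exact (hξ t (hUI t ht) l k).comp_ofReal
      rw [← Matrix.mul_apply, h1]
      exact h2
    · have h1 : c 0 = 1 := by
        simp only [c, zero_smul, add_zero]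
        exact φ.left_inv (mem_chart_source E (1 : G))
      have h2 : P * P = P := by
        apply Matrix.mulVec_injective
        ext1 w
        rw [← Matrix.mulVec_mulVec]
        exact hPN _ (hPmem w)
      have h3 : Ψ 0 = 0 := by simp [Ψ, h1, sub_mul, h2]
      exact h3
  have hc1 : c 1 = g := by
    simp only [c, one_smul, hv, add_sub_cancel]
    exact φ.left_inv hg.1
  intro w hw
  have h1 := hΨ0 1 (by simp)
  simp only [Ψ, Complex.ofReal_one, hc1] at h1
  have h2 := congrArg (fun A : Matrix n n ℂ => A *ᵥ w) h1
  simp only [← Matrix.mulVec_mulVec, hPN w hw, Matrix.sub_mulVec, Matrix.one_mulVec,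
    Matrix.zero_mulVec, sub_eq_zero] at h2
  rw [h2]
  exact hPmem _

/-- The stabilizer of N contains a neighbourhood of 1, so it is an open, hence also closed,
subgroup; connectedness makes it all of G. -/
theorem stable_of_matDeriv [ConnectedSpace G] {R : G →* Matrix n n ℂ} (hR : IsHolomorphicMat E R)
    (N : Submodule ℂ (n → ℂ)) (hN : ∀ ξ : E, ∀ v ∈ N, matDeriv R ξ *ᵥ v ∈ N) :
    ∀ g, ∀ v ∈ N, R g *ᵥ v ∈ N := by
  have := topologicalGroup_of_lieGroup (G := G) 𝓘(ℂ, E) ω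
  -- Stability under the inverse is built in, to have a subgroup without a dimension count.
  let H : Subgroup G :=
    { carrier := {g | (∀ v ∈ N, R g *ᵥ v ∈ N) ∧ ∀ v ∈ N, R g⁻¹ *ᵥ v ∈ N}
      one_mem' := by simp
      mul_mem' := by
        rintro a b ⟨ha, ha'⟩ ⟨hb, hb'⟩
        constructor
        · intro v hv
          rw [map_mul, ← Matrix.mulVec_mulVec]
          exact ha _ (hb _ hv)
        · intro v hv
          rw [mul_inv_rev, map_mul, ← Matrix.mulVec_mulVec]
          exact hb' _ (ha' _ hv)
      inv_mem' := by
        rintro a ⟨ha, ha'⟩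
        exact ⟨ha', by rwa [inv_inv]⟩ }
  have h1 := eventually_stable_of_matDeriv hR N hN
  have h2 : ∀ᶠ g in 𝓝 (1 : G), ∀ v ∈ N, R g⁻¹ *ᵥ v ∈ N := by
    have h3 : Filter.Tendsto (fun g : G => g⁻¹) (𝓝 1) (𝓝 1) := by
      simpa using (continuous_inv (G := G)).tendsto 1
    exact h3.eventually h1
  have hopen : IsOpen (H : Set G) := H.isOpen_of_mem_nhds (g := 1) (h1.and h2)
  have huniv : (H : Set G) = univ :=
    IsClopen.eq_univ ⟨H.isClosed_of_isOpen hopen, hopen⟩ ⟨1, H.one_mem⟩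
  intro g
  have : g ∈ (H : Set G) := by rw [huniv]; trivial
  exact this.1

/-- If dR(ξ)v left N, a functional φ vanishing on N would detect it; but g ↦ φ(R(g)v) is identically
zero, and so is its derivative. -/
theorem matDeriv_stable {R : G →* Matrix n n ℂ} (hR : IsHolomorphicMat E R)
    (N : Submodule ℂ (n → ℂ)) (hN : ∀ g, ∀ v ∈ N, R g *ᵥ v ∈ N) (ξ : E) :
    ∀ v ∈ N, matDeriv R ξ *ᵥ v ∈ N := by
  intro v hv
  by_contra hnot
  obtain ⟨φ, hφ, hφN⟩ := Submodule.exists_le_ker_of_notMem hnot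
  have h1 : ∀ w, φ w = ∑ i, φ (Pi.single i 1) * w i := by
    intro w
    conv_lhs => rw [← Finset.univ_sum_single w]
    rw [map_sum]
    refine Finset.sum_congr rfl fun i _ => ?_
    have : Pi.single i (w i) = w i • (Pi.single i 1 : n → ℂ) := by
      rw [← Pi.single_smul, smul_eq_mul, mul_one]
    simp [this, mul_comm]
  have h2 : (fun g => ∑ i, ∑ j, (φ (Pi.single i 1) * v j) * R g i j) = fun _ : G => (0 : ℂ) := by
    ext g
    have h3 : φ (R g *ᵥ v) = 0 := hφN (hN g v hv)
    rw [← h3, h1]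
    refine Finset.sum_congr rfl fun i _ => ?_
    rw [Matrix.mulVec, dotProduct, Finset.mul_sum]
    exact Finset.sum_congr rfl fun j _ => by ring
  have h4 : derivOne (fun g => ∑ i, ∑ j, (φ (Pi.single i 1) * v j) * R g i j) ξ
      = φ (matDeriv R ξ *ᵥ v) := by
    have hsm : ∀ i j, ContMDiff 𝓘(ℂ, E) 𝓘(ℂ, ℂ) ω
        (fun g => (φ (Pi.single i 1) * v j) * R g i j) := fun i j =>
      contMDiff_const.mul (hR i j)
    rw [derivOne_sum _ (fun i => contMDiff_finsetSum fun j _ => hsm i j), h1]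
    refine Finset.sum_congr rfl fun i _ => ?_
    rw [derivOne_sum _ (hsm i), Matrix.mulVec, dotProduct, Finset.mul_sum]
    refine Finset.sum_congr rfl fun j _ => ?_
    rw [derivOne_const_mul (hR i j)]
    simp only [matDeriv, Matrix.of_apply]
    ring
  rw [h2] at h4
  apply hφ
  rw [← h4]
  simp [derivOne]

end Calculus
end Differential
end SuperMF

namespace SuperMF

/-! ### Matrix representations with vanishing moment map -/

section Balanced

open scoped Matrix Kronecker

variable {E : Type*} [NormedAddCommGroup E] [NormedSpace ℂ E] [FiniteDimensional ℂ E]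
  {G : Type*} [Group G] [TopologicalSpace G] [ChartedSpace E G] [LieGroup 𝓘(ℂ, E) ω G]
  {n n' : Type*} [Fintype n] [DecidableEq n] [Fintype n'] [DecidableEq n']

/-- A holomorphic matrix representation whose differential has vanishing moment map. -/
def IsBalanced (E : Type*) [NormedAddCommGroup E] [NormedSpace ℂ E] [FiniteDimensional ℂ E]
    [ChartedSpace E G]
    (R : G →* Matrix n n ℂ) : Prop :=
  IsHolomorphicMat E R ∧
    moment (fun i => matDeriv R (Module.finBasis ℂ E i)) = 0

theorem matDeriv_mulVec_eq_sum (R : G →* Matrix n n ℂ) (ξ : E) (v : n → ℂ) :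
    matDeriv R ξ *ᵥ v = ∑ i, (Module.finBasis ℂ E).repr ξ i •
      (matDeriv R (Module.finBasis ℂ E i) *ᵥ v) := by
  conv_lhs => rw [← (Module.finBasis ℂ E).sum_repr ξ]
  ext j
  simp only [matDeriv, Matrix.mulVec, dotProduct, Matrix.of_apply, map_sum, map_smul,
    Finset.sum_apply, Pi.smul_apply, smul_eq_mul, Finset.mul_sum, Finset.sum_mul]
  rw [Finset.sum_comm]
  exact Finset.sum_congr rfl fun _ _ => Finset.sum_congr rfl fun _ _ => by ring

theorem IsBalanced.exists_stable_compl [ConnectedSpace G] {R : G →* Matrix n n ℂ}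
    (hR : IsBalanced E R) (N : Submodule ℂ (n → ℂ)) (hN : ∀ g, ∀ v ∈ N, R g *ᵥ v ∈ N) :
    ∃ N' : Submodule ℂ (n → ℂ), IsCompl N N' ∧ ∀ g, ∀ v ∈ N', R g *ᵥ v ∈ N' := by
  obtain ⟨N', hc, hN'⟩ := exists_invariant_compl_of_moment_eq_zero _ hR.2 N
    (fun i => matDeriv_stable hR.1 N hN _)
  refine ⟨N', hc, stable_of_matDeriv hR.1 N' fun ξ v hv => ?_⟩
  rw [matDeriv_mulVec_eq_sum]
  exact N'.sum_mem fun i _ => N'.smul_mem _ (hN' i v hv)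

/-- The conjugate of a matrix representation by an invertible matrix. -/
def conjMat (t : (Matrix n n ℂ)ˣ) (R : G →* Matrix n n ℂ) : G →* Matrix n n ℂ where
  toFun g := t * R g * ((t⁻¹ : (Matrix n n ℂ)ˣ) : Matrix n n ℂ)
  map_one' := by simp
  map_mul' g h := by simp [mul_assoc]

theorem contMDiff_conjMat (t : (Matrix n n ℂ)ˣ) {R : G →* Matrix n n ℂ}
    (hR : IsHolomorphicMat E R) : IsHolomorphicMat E (conjMat t R) := by
  intro i j
  simp only [conjMat, MonoidHom.coe_mk, OneHom.coe_mk, Matrix.mul_apply]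
  exact contMDiff_finsetSum fun k _ => (contMDiff_finsetSum fun l _ =>
    contMDiff_const.mul (hR l k)).mul contMDiff_const

theorem matDeriv_conjMat (t : (Matrix n n ℂ)ˣ) {R : G →* Matrix n n ℂ}
    (hR : IsHolomorphicMat E R) (ξ : E) : matDeriv (conjMat t R) ξ
      = t * matDeriv R ξ * ((t⁻¹ : (Matrix n n ℂ)ˣ) : Matrix n n ℂ) := by
  ext i j
  simp only [matDeriv, Matrix.of_apply, conjMat, MonoidHom.coe_mk, OneHom.coe_mk, Matrix.mul_apply]
  have h1 : ∀ k l, ContMDiff 𝓘(ℂ, E) 𝓘(ℂ, ℂ) ω (fun g => (t : Matrix n n ℂ) i l * R g l k) :=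
    fun k l => contMDiff_const.mul (hR l k)
  have h2 : ∀ k, ContMDiff 𝓘(ℂ, E) 𝓘(ℂ, ℂ) ω (fun g => ∑ l, (t : Matrix n n ℂ) i l * R g l k) :=
    fun k => contMDiff_finsetSum fun l _ => h1 k l
  simp only [mul_comm _ (((t⁻¹ : (Matrix n n ℂ)ˣ) : Matrix n n ℂ) _ j)]
  have h3 : ∀ k, ContMDiff 𝓘(ℂ, E) 𝓘(ℂ, ℂ) ω (fun g =>
      ((t⁻¹ : (Matrix n n ℂ)ˣ) : Matrix n n ℂ) k j * ∑ l, (t : Matrix n n ℂ) i l * R g l k) :=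
    fun k => contMDiff_const.mul (h2 k)
  rw [derivOne_sum _ h3]
  refine Finset.sum_congr rfl fun k _ => ?_
  rw [derivOne_const_mul (h2 k), derivOne_sum _ (h1 k)]
  congr 1
  exact Finset.sum_congr rfl fun l _ => derivOne_const_mul (hR l k) _ _

/-- A subspace stable under the differential is stable under G, so irreducibility of R makes the
tuple of basis derivatives irreducible and the minimization applies to it. -/
theorem exists_isBalanced_conjMat [ConnectedSpace G] {R : G →* Matrix n n ℂ}
    (hR : IsHolomorphicMat E R)
    (hirr : ∀ N : Submodule ℂ (n → ℂ), (∀ g, ∀ v ∈ N, R g *ᵥ v ∈ N) → N = ⊥ ∨ N = ⊤) :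
    ∃ t : (Matrix n n ℂ)ˣ, IsBalanced E (conjMat t R) := by
  obtain ⟨t, ht⟩ := exists_conj_moment_eq_zero (fun i => matDeriv R (Module.finBasis ℂ E i)) (by
    intro N hN
    refine hirr N (stable_of_matDeriv hR N fun ξ v hv => ?_)
    rw [matDeriv_mulVec_eq_sum]
    exact N.sum_mem fun i _ => N.smul_mem _ (hN i v hv))
  refine ⟨t, contMDiff_conjMat t hR, ?_⟩
  simp only [matDeriv_conjMat t hR]
  exact ht

/-- The tensor product of two matrix representations. -/
def kroneckerMat (R : G →* Matrix n n ℂ) (R' : G →* Matrix n' n' ℂ) :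
    G →* Matrix (n × n') (n × n') ℂ where
  toFun g := R g ⊗ₖ R' g
  map_one' := by simp
  map_mul' g h := by simp [Matrix.mul_kronecker_mul]

/-- The differential of a tensor product is A ⊗ 1 + 1 ⊗ B. In its commutator with its adjoint the
mixed terms cancel, so the moment map is additive: μ ⊗ 1 + 1 ⊗ μ'. -/
theorem IsBalanced.kroneckerMat {R : G →* Matrix n n ℂ} {R' : G →* Matrix n' n' ℂ}
    (hR : IsBalanced E R) (hR' : IsBalanced E R') : IsBalanced E (kroneckerMat R R') := by
  refine ⟨fun i j => (hR.1 i.1 j.1).mul (hR'.1 i.2 j.2), ?_⟩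
  have h1 : ∀ ξ : E, matDeriv (SuperMF.kroneckerMat R R') ξ
      = matDeriv R ξ ⊗ₖ (1 : Matrix n' n' ℂ) + (1 : Matrix n n ℂ) ⊗ₖ matDeriv R' ξ := by
    intro ξ
    ext i j
    simp only [matDeriv, Matrix.of_apply, SuperMF.kroneckerMat, MonoidHom.coe_mk, OneHom.coe_mk,
      Matrix.kroneckerMap_apply, Matrix.add_apply]
    rw [derivOne_mul (hR.1 i.1 j.1) (hR'.1 i.2 j.2), map_one, map_one]
    ring
  simp only [h1]
  have h2 : ∀ (A : Matrix n n ℂ) (B : Matrix n' n' ℂ),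
      (A ⊗ₖ (1 : Matrix n' n' ℂ) + (1 : Matrix n n ℂ) ⊗ₖ B) *
        (A ⊗ₖ (1 : Matrix n' n' ℂ) + (1 : Matrix n n ℂ) ⊗ₖ B)ᴴ -
      (A ⊗ₖ (1 : Matrix n' n' ℂ) + (1 : Matrix n n ℂ) ⊗ₖ B)ᴴ *
        (A ⊗ₖ (1 : Matrix n' n' ℂ) + (1 : Matrix n n ℂ) ⊗ₖ B)
      = (A * Aᴴ - Aᴴ * A) ⊗ₖ (1 : Matrix n' n' ℂ) + (1 : Matrix n n ℂ) ⊗ₖ (B * Bᴴ - Bᴴ * B) := by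
    intro A B
    simp only [Matrix.conjTranspose_add, Matrix.conjTranspose_kronecker, Matrix.conjTranspose_one,
      mul_add, add_mul, ← Matrix.mul_kronecker_mul, mul_one, one_mul, sub_eq_add_neg,
      Matrix.add_kronecker, Matrix.kronecker_add]
    have h3 : (-(Aᴴ * A)) ⊗ₖ (1 : Matrix n' n' ℂ) = -((Aᴴ * A) ⊗ₖ (1 : Matrix n' n' ℂ)) := by
      ext; simp
    have h4 : (1 : Matrix n n ℂ) ⊗ₖ (-(Bᴴ * B)) = -((1 : Matrix n n ℂ) ⊗ₖ (Bᴴ * B)) := by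
      ext; simp
    rw [h3, h4]
    abel
  unfold moment
  simp only [h2]
  rw [Finset.sum_add_distrib]
  have h5 : ∀ s : Finset (Fin (Module.finrank ℂ E)), ∀ f : _ → Matrix n n ℂ,
      ∑ i ∈ s, (f i) ⊗ₖ (1 : Matrix n' n' ℂ) = (∑ i ∈ s, f i) ⊗ₖ (1 : Matrix n' n' ℂ) := by
    intro s f
    ext i j
    simp [Matrix.sum_apply, Finset.sum_mul]
  have h6 : ∀ s : Finset (Fin (Module.finrank ℂ E)), ∀ f : _ → Matrix n' n' ℂ,
      ∑ i ∈ s, (1 : Matrix n n ℂ) ⊗ₖ (f i) = (1 : Matrix n n ℂ) ⊗ₖ (∑ i ∈ s, f i) := by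
    intro s f
    ext i j
    simp [Matrix.sum_apply, Finset.mul_sum]
  have h7 := hR.2
  have h8 := hR'.2
  unfold moment at h7 h8
  rw [h5, h6, h7, h8]
  simp

theorem isBalanced_one : IsBalanced E (1 : G →* Matrix n n ℂ) := by
  refine ⟨fun i j => contMDiff_const, ?_⟩
  have : ∀ ξ : E, matDeriv (1 : G →* Matrix n n ℂ) ξ = 0 := by
    intro ξ
    ext i j
    simp [matDeriv, derivOne]
  simp [this, moment]

end Balanced

/-! ### Equivariant images of balanced representations -/

section BalancedQuotient

open scoped Matrix Kronecker

variable (E : Type*) [NormedAddCommGroup E] [NormedSpace ℂ E] [FiniteDimensional ℂ E]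
  {G : Type*} [Group G] [TopologicalSpace G] [ChartedSpace E G] [LieGroup 𝓘(ℂ, E) ω G]

/-- `N` is the image of an equivariant map from a balanced matrix representation. -/
def IsBalancedQuotient {Y : Type*} [AddCommGroup Y] [Module ℂ Y] (T : G → Y →ₗ[ℂ] Y)
    (N : Submodule ℂ Y) : Prop :=
  ∃ (n : Type) (_ : Fintype n) (_ : DecidableEq n) (R : G →* Matrix n n ℂ)
    (f : (n → ℂ) →ₗ[ℂ] Y), IsBalanced E R ∧ (∀ g v, f (R g *ᵥ v) = T g (f v)) ∧
      LinearMap.range f = N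

variable {E}

/-- Pull the stable submodule back to the balanced representation, take an invariant complement
there and push it forward. Because the preimage contains the kernel of f, the image of the
complement meets M trivially. -/
theorem IsBalancedQuotient.semisimpleOn [ConnectedSpace G] {Y : Type*} [AddCommGroup Y]
    [Module ℂ Y] {T : G → Y →ₗ[ℂ] Y} {N : Submodule ℂ Y} (h : IsBalancedQuotient E T N) :
    SemisimpleOn T N := by
  obtain ⟨n, _, _, R, f, hR, hf, rfl⟩ := h
  intro M hM hMs
  obtain ⟨K, hK, hKs⟩ := hR.exists_stable_compl (M.comap f) (by
    intro g v hv
    rw [Submodule.mem_comap, hf]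
    exact hMs g _ hv)
  refine ⟨K.map f, LinearMap.map_le_range, ?_, ?_, ?_⟩
  · rintro g _ ⟨v, hv, rfl⟩
    rw [← hf]
    exact ⟨_, hKs g v hv, rfl⟩
  · rw [eq_bot_iff]
    rintro _ ⟨hx, v, hv, rfl⟩
    have : v ∈ M.comap f ⊓ K := ⟨hx, hv⟩
    rw [hK.inf_eq_bot] at this
    rw [(Submodule.mem_bot ℂ).1 this, map_zero]
    exact Submodule.zero_mem _
  · refine le_antisymm (sup_le hM LinearMap.map_le_range) ?_
    rintro _ ⟨v, rfl⟩
    obtain ⟨a, ha, b, hb, rfl⟩ := Submodule.mem_sup.1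
      (show v ∈ M.comap f ⊔ K by rw [hK.sup_eq_top]; trivial)
    rw [map_add]
    exact Submodule.add_mem_sup ha ⟨b, hb, rfl⟩

theorem IsBalancedQuotient.map {Y Z : Type*} [AddCommGroup Y] [Module ℂ Y] [AddCommGroup Z]
    [Module ℂ Z] {T : G → Y →ₗ[ℂ] Y} {T' : G → Z →ₗ[ℂ] Z} {N : Submodule ℂ Y}
    (h : IsBalancedQuotient E T N) (L : Y →ₗ[ℂ] Z) (hL : ∀ g x, L (T g x) = T' g (L x)) :
    IsBalancedQuotient E T' (N.map L) := by
  obtain ⟨n, i1, i2, R, f, hR, hf, rfl⟩ := h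
  exact ⟨n, i1, i2, R, L ∘ₗ f, hR, fun g v => by simp [hf, hL], LinearMap.range_comp _ _⟩

/-- A bilinear equivariant pairing factors through the tensor product, which in coordinates is the
Kronecker product representation on functions on n × n'. -/
theorem IsBalancedQuotient.map₂ {X Y Z : Type*} [AddCommGroup X] [Module ℂ X]
    [AddCommGroup Y] [Module ℂ Y] [AddCommGroup Z] [Module ℂ Z]
    {S : G → X →ₗ[ℂ] X} {T : G → Y →ₗ[ℂ] Y} {U : G → Z →ₗ[ℂ] Z}
    {M : Submodule ℂ X} {N : Submodule ℂ Y}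
    (hM : IsBalancedQuotient E S M) (hN : IsBalancedQuotient E T N)
    (B : X →ₗ[ℂ] Y →ₗ[ℂ] Z) (hB : ∀ g x y, B (S g x) (T g y) = U g (B x y)) :
    IsBalancedQuotient E U (Submodule.map₂ B M N) := by
  obtain ⟨n, i1, i2, R, f, hR, hf, rfl⟩ := hM
  obtain ⟨n', i1', i2', R', f', hR', hf', rfl⟩ := hN
  let F : (n × n' → ℂ) →ₗ[ℂ] Z :=
    Fintype.linearCombination ℂ fun k => B (f (Pi.single k.1 1)) (f' (Pi.single k.2 1))
  have hF : ∀ (a : n → ℂ) (b : n' → ℂ), F (fun k => a k.1 * b k.2) = B (f a) (f' b) := by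
    intro a b
    have ha : f a = ∑ i, a i • f (Pi.single i 1) := by
      conv_lhs => rw [pi_eq_sum_univ' a, map_sum]
      exact Finset.sum_congr rfl fun i _ => by rw [map_smul]
    have hb : f' b = ∑ i, b i • f' (Pi.single i 1) := by
      conv_lhs => rw [pi_eq_sum_univ' b, map_sum]
      exact Finset.sum_congr rfl fun i _ => by rw [map_smul]
    rw [ha, hb]
    simp only [F, Fintype.linearCombination_apply, Fintype.sum_prod_type, map_sum, map_smul,
      LinearMap.sum_apply, LinearMap.smul_apply, Finset.smul_sum, smul_smul]
    rw [Finset.sum_comm]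
    exact Finset.sum_congr rfl fun _ _ => Finset.sum_congr rfl fun _ _ => by rw [mul_comm]
  refine ⟨n × n', inferInstance, inferInstance, kroneckerMat R R', F, hR.kroneckerMat hR', ?_, ?_⟩
  · intro g
    suffices h : F ∘ₗ (kroneckerMat R R' g).mulVecLin = U g ∘ₗ F from
      fun v => LinearMap.congr_fun h v
    refine LinearMap.pi_ext' fun k => LinearMap.ext_ring ?_
    have h1 : (Pi.single k 1 : n × n' → ℂ) = fun l =>
        (Pi.single k.1 1 : n → ℂ) l.1 * (Pi.single k.2 1 : n' → ℂ) l.2 := by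
      ext l
      simp only [Pi.single_apply, Prod.ext_iff]
      split_ifs <;> simp_all
    have h2 : (kroneckerMat R R' g) *ᵥ (Pi.single k 1) = fun l =>
        (R g *ᵥ Pi.single k.1 1) l.1 * (R' g *ᵥ Pi.single k.2 1) l.2 := by
      ext l
      simp [kroneckerMat]
    simp only [LinearMap.comp_apply, LinearMap.single_apply, Matrix.mulVecLin_apply]
    rw [h2, hF, hf, hf', hB, h1, hF]
  · apply le_antisymm
    · rintro _ ⟨w, rfl⟩
      rw [Fintype.linearCombination_apply]
      exact Submodule.sum_mem _ fun k _ => Submodule.smul_mem _ _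
        (Submodule.apply_mem_map₂ _ ⟨_, rfl⟩ ⟨_, rfl⟩)
    · rw [Submodule.map₂_le]
      rintro _ ⟨a, rfl⟩ _ ⟨b, rfl⟩
      exact ⟨_, hF a b⟩

section Algebra

variable {A : Type*} [Ring A] [Algebra ℂ A] {T : G → A →ₐ[ℂ] A}

theorem isBalancedQuotient_one : IsBalancedQuotient E (fun g => (T g).toLinearMap) 1 := by
  refine ⟨Unit, inferInstance, inferInstance, 1,
    LinearMap.toSpanSingleton ℂ A 1 ∘ₗ LinearMap.proj (), isBalanced_one, by simp, ?_⟩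
  rw [LinearMap.range_comp, LinearMap.range_eq_top.2 (LinearMap.proj_surjective _),
    Submodule.map_top, LinearMap.range_toSpanSingleton, Submodule.one_eq_span]

theorem IsBalancedQuotient.mul {M N : Submodule ℂ A}
    (hM : IsBalancedQuotient E (fun g => (T g).toLinearMap) M)
    (hN : IsBalancedQuotient E (fun g => (T g).toLinearMap) N) :
    IsBalancedQuotient E (fun g => (T g).toLinearMap) (M * N) := by
  rw [Submodule.mul_eq_map₂]
  exact hM.map₂ (U := fun g => (T g).toLinearMap) hN (LinearMap.mul ℂ A) fun g x y => (map_mul (T g) x y).symm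

theorem IsBalancedQuotient.pow {M : Submodule ℂ A}
    (hM : IsBalancedQuotient E (fun g => (T g).toLinearMap) M) (k : ℕ) :
    IsBalancedQuotient E (fun g => (T g).toLinearMap) (M ^ k) := by
  induction k with
  | zero => exact isBalancedQuotient_one
  | succ k ih => rw [pow_succ]; exact ih.mul hM

theorem isBalancedQuotient_list_prod (l : List (Submodule ℂ A))
    (hl : ∀ M ∈ l, IsBalancedQuotient E (fun g => (T g).toLinearMap) M) :
    IsBalancedQuotient E (fun g => (T g).toLinearMap) l.prod := by
  induction l with
  | nil => exact isBalancedQuotient_one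
  | cons a l ih =>
    rw [List.prod_cons]
    exact (hl a List.mem_cons_self).mul (ih fun M hM => hl M (List.mem_cons_of_mem _ hM))

end Algebra

theorem isBalancedQuotient_of_irreducible [ConnectedSpace G] {V : Type*} [AddCommGroup V]
    [Module ℂ V] [FiniteDimensional ℂ V] {ρ : Representation ℂ G V}
    (hρ : IsHolomorphicRep (E := E) ρ) (U : Subrepresentation ρ)
    (hU : U.toRepresentation.IsIrreducible) :
    IsBalancedQuotient E (fun g => ρ g) U.toSubmodule := by
  let β := Module.finBasis ℂ U.toSubmodule
  let R : G →* Matrix (Fin (Module.finrank ℂ U.toSubmodule)) (Fin (Module.finrank ℂ U.toSubmodule)) ℂ :=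
    { toFun := fun g => LinearMap.toMatrix β β (U.toRepresentation g)
      map_one' := by rw [map_one, LinearMap.toMatrix_one]
      map_mul' := fun g h => by rw [map_mul, LinearMap.toMatrix_mul] }
  obtain ⟨e, he⟩ : ∃ e, e = β.equivFun := ⟨_, rfl⟩
  have hRv : ∀ g v, β.equivFun.symm (R g *ᵥ v) = U.toRepresentation g (β.equivFun.symm v) := by
    intro g v
    apply β.equivFun.injective
    rw [LinearEquiv.apply_symm_apply]
    have h1 := LinearMap.toMatrix_mulVec_repr β β (U.toRepresentation g) (β.equivFun.symm v)
    have h2 : ⇑(β.repr (β.equivFun.symm v)) = v := β.equivFun.apply_symm_apply v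
    rw [h2] at h1
    exact h1
  rw [← he] at hRv
  have hhol : IsHolomorphicMat E R := by
    intro i j
    -- Extending the coordinate functional to V exhibits the matrix entry as a matrix coefficient of
    -- ρ.
    obtain ⟨φ, hφ⟩ := LinearMap.exists_extend (β.coord i)
    have h1 := hρ (β j : V) φ
    refine h1.congr fun g => ?_
    have h2 := LinearMap.congr_fun hφ (U.toRepresentation g (β j))
    simp only [R, MonoidHom.coe_mk, OneHom.coe_mk, LinearMap.toMatrix_apply]
    exact h2.symm
  obtain ⟨t, ht⟩ := exists_isBalanced_conjMat hhol (by
    intro N hN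
    rcases eq_bot_or_eq_top_of_irreducible hU (N.comap e.toLinearMap) (by
      intro g x hx
      have h1 := hN g _ hx
      have h2 := hRv g (e x)
      rw [LinearEquiv.symm_apply_apply] at h2
      simp only [Submodule.mem_comap, LinearEquiv.coe_coe] at h1 ⊢
      rw [← h2, LinearEquiv.apply_symm_apply]
      exact h1) with h | h
    · left
      rw [eq_bot_iff]
      intro v hv
      have : e.symm v ∈ N.comap e.toLinearMap := by simpa using hv
      rw [h] at this
      simpa using this
    · right
      rw [eq_top_iff]
      intro v _
      have : e.symm v ∈ N.comap e.toLinearMap := by rw [h]; trivial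
      simpa using this)
  set s := ((t⁻¹ : (Matrix (Fin (Module.finrank ℂ U.toSubmodule))
    (Fin (Module.finrank ℂ U.toSubmodule)) ℂ)ˣ) : Matrix (Fin (Module.finrank ℂ U.toSubmodule))
    (Fin (Module.finrank ℂ U.toSubmodule)) ℂ) with hs
  have hsurj : Function.Surjective s.mulVecLin := by
    intro v
    exact ⟨(t : Matrix _ _ ℂ) *ᵥ v, by simp [hs, Matrix.mulVec_mulVec]⟩
  refine ⟨_, inferInstance, inferInstance, conjMat t R,
    U.toSubmodule.subtype ∘ₗ e.symm.toLinearMap ∘ₗ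
      s.mulVecLin, ht, ?_, ?_⟩
  · intro g v
    simp only [LinearMap.comp_apply, Matrix.mulVecLin_apply, LinearEquiv.coe_coe, conjMat,
      MonoidHom.coe_mk, OneHom.coe_mk, Matrix.mulVec_mulVec, hs]
    rw [mul_assoc, Units.inv_mul_cancel_left, ← Matrix.mulVec_mulVec, hRv]
    rfl
  · rw [LinearMap.range_comp, LinearMap.range_comp, LinearMap.range_eq_top.2 hsurj,
      Submodule.map_top, LinearEquiv.range, Submodule.map_top, Submodule.range_subtype]

end BalancedQuotient

/-! ### Complete reducibility of the components of the super symmetric algebra -/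

section SuperSym

variable {G : Type*} [Group G]
  {V V₀ V₁ : Type*} [AddCommGroup V] [Module ℂ V]
  [AddCommGroup V₀] [Module ℂ V₀] [AddCommGroup V₁] [Module ℂ V₁]

/-- The algebra endomorphism of `S(V)` underlying `symRep ρ g`. -/
noncomputable def symHom (ρ : Representation ℂ G V) (g : G) :
    SymmetricAlgebra ℂ V →ₐ[ℂ] SymmetricAlgebra ℂ V :=
  SymmetricAlgebra.lift (SymmetricAlgebra.ι ℂ V ∘ₗ ρ g)

theorem symHom_ι (ρ : Representation ℂ G V) (g : G) (v : V) :
    symHom ρ g (SymmetricAlgebra.ι ℂ V v) = SymmetricAlgebra.ι ℂ V (ρ g v) := by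
  simp [symHom]

theorem extRep_apply (ρ : Representation ℂ G V) (g : G) :
    extRep ρ g = (ExteriorAlgebra.map (ρ g)).toLinearMap := rfl

theorem superSymRep_tmul (ρ₀ : Representation ℂ G V₀) (ρ₁ : Representation ℂ G V₁) (g : G)
    (a : SymmetricAlgebra ℂ V₀) (b : ExteriorAlgebra ℂ V₁) :
    superSymRep ρ₀ ρ₁ g (a ⊗ₜ b) = symRep ρ₀ g a ⊗ₜ extRep ρ₁ g b := rfl

/-- The components of the super symmetric algebra of a holomorphic representation of a connected
complex Lie group are completely reducible. -/
theorem semisimpleOn_component {E : Type*} [NormedAddCommGroup E] [NormedSpace ℂ E]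
    [FiniteDimensional ℂ E] [TopologicalSpace G] [ChartedSpace E G] [LieGroup 𝓘(ℂ, E) ω G]
    [ConnectedSpace G] [FiniteDimensional ℂ V₀] [FiniteDimensional ℂ V₁]
    {ρ₀ : Representation ℂ G V₀} {ρ₁ : Representation ℂ G V₁}
    (hρ₀ : IsHolomorphicRep (E := E) ρ₀) (hρ₁ : IsHolomorphicRep (E := E) ρ₁) {k l : ℕ}
    (D₀ : IrredDecomposition ρ₀ k) (D₁ : IrredDecomposition ρ₁ l) (i : Fin k → ℕ)
    (j : Fin l → ℕ) :
    SemisimpleOn (fun g => superSymRep ρ₀ ρ₁ g) (component D₀.U D₁.U i j).toSubmodule := by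
  apply IsBalancedQuotient.semisimpleOn (E := E)
  -- The group acts by algebra endomorphisms, so multiplication is an equivariant pairing, and the
  -- component is built by products from images of the irreducible summands.
  refine IsBalancedQuotient.map₂ (S := fun g => (symHom ρ₀ g).toLinearMap)
    (T := fun g => (ExteriorAlgebra.map (ρ₁ g)).toLinearMap) ?_ ?_ _ (fun g x y => rfl)
  · unfold symComponent
    rw [← Finset.prod_map_toList]
    refine isBalancedQuotient_list_prod _ fun M hM => ?_
    obtain ⟨p, -, rfl⟩ := List.mem_map.1 hM
    refine IsBalancedQuotient.pow ?_ _
    exact (isBalancedQuotient_of_irreducible hρ₀ (D₀.U p) (D₀.irreducible p)).map _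
      fun g x => (symHom_ι ρ₀ g x).symm
  · unfold extComponent
    refine isBalancedQuotient_list_prod _ fun M hM => ?_
    obtain ⟨q, rfl⟩ := List.mem_ofFn.1 hM
    refine IsBalancedQuotient.pow ?_ _
    exact (isBalancedQuotient_of_irreducible hρ₁ (D₁.U q) (D₁.irreducible q)).map _
      fun g x => by simp

end SuperSym
end SuperMF

namespace SuperMF

/-! ### The Weyl algebra: normal form and faithfulness on polynomials -/

section WeylAlgebra

open MvPolynomial

variable {I : Type*}

/-- Evaluation of a polynomial at a commuting family in a noncommutative algebra. -/
theorem exists_aeval_of_commute {W : Type*} [Ring W] [Algebra ℂ W] (q : I → W)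
    (hq : ∀ i j, q i * q j = q j * q i) :
    ∃ f : MvPolynomial I ℂ →ₐ[ℂ] W, ∀ i, f (X i) = q i := by
  let _ := Algebra.adjoinCommRingOfComm ℂ (s := Set.range q) (by
    rintro _ ⟨i, rfl⟩ _ ⟨j, rfl⟩
    exact hq i j)
  let q' : I → Algebra.adjoin ℂ (Set.range q) := fun i => ⟨q i, Algebra.subset_adjoin ⟨i, rfl⟩⟩
  let f : MvPolynomial I ℂ →ₐ[ℂ] Algebra.adjoin ℂ (Set.range q) := aeval q'
  exact ⟨(Algebra.adjoin ℂ (Set.range q)).val.comp f, fun i => by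
    rw [AlgHom.comp_apply, show f (X i) = q' i from aeval_X _ _]; rfl⟩

/-- Multiplication by a variable as an operator on polynomials. -/
noncomputable def opX (i : I) : Module.End ℂ (MvPolynomial I ℂ) := LinearMap.mulLeft ℂ (X i)

/-- A partial derivative as an operator on polynomials. -/
noncomputable def opD (i : I) : Module.End ℂ (MvPolynomial I ℂ) := (pderiv i).toLinearMap

@[simp] theorem opX_apply (i : I) (f : MvPolynomial I ℂ) : opX i f = X i * f := rfl

@[simp] theorem opD_apply (i : I) (f : MvPolynomial I ℂ) : opD i f = pderiv i f := rfl

theorem opD_mul_opX [DecidableEq I] (i j : I) : opD i * opX j = opX j * opD i + if i = j then 1 else 0 := by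
  refine LinearMap.ext fun f => ?_
  simp only [Module.End.mul_apply, opD_apply, opX_apply, LinearMap.add_apply, pderiv_mul, pderiv_X]
  split_ifs with h
  · subst h; simp [add_comm]
  · simp [Ne.symm h]

theorem opX_comm (i j : I) : opX i * opX j = opX j * opX i := by
  refine LinearMap.ext fun f => ?_
  simp only [Module.End.mul_apply, opX_apply]
  ring

theorem opD_comm (i j : I) : opD i * opD j = opD j * opD i := by
  classical
  refine LinearMap.ext fun f => ?_
  simp only [Module.End.mul_apply, opD_apply]
  have h : ⁅pderiv (R := ℂ) i, pderiv (R := ℂ) j⁆ = 0 := by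
    refine derivation_ext fun k => ?_
    simp [Derivation.commutator_apply, pderiv_X, Pi.single_apply, apply_ite]
  have := congrArg (fun D => D f) h
  simpa [Derivation.commutator_apply, sub_eq_zero] using this

/-- Constant coefficient differential operators. -/
noncomputable def constOp : MvPolynomial I ℂ →ₐ[ℂ] Module.End ℂ (MvPolynomial I ℂ) :=
  (exists_aeval_of_commute opD opD_comm).choose

@[simp] theorem constOp_X (i : I) : constOp (X i) = opD i :=
  (exists_aeval_of_commute opD opD_comm).choose_spec i

theorem pderiv_pow_monomial (i : I) (n : ℕ) (c : I →₀ ℕ) (r : ℂ) :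
    (opD i ^ n) (monomial c r)
      = monomial (c - Finsupp.single i n) (r * ((c i).descFactorial n : ℂ)) := by
  induction n with
  | zero => simp
  | succ n ih =>
    rw [pow_succ', Module.End.mul_apply, ih, opD_apply, pderiv_monomial, Nat.descFactorial_succ]
    refine congrArg₂ (fun a r => monomial a r) ?_ ?_
    · ext j
      by_cases h : j = i
      · subst h; simp; omega
      · simp [h]
    · simp; ring

/-- When b ≤ c fails, the truncated exponent c - b is meaningless, but the falling factorial in the
coefficient is then zero, so the formula needs no side condition. -/
theorem constOp_monomial (b c : I →₀ ℕ) (r : ℂ) :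
    constOp (monomial b 1) (monomial c r)
      = monomial (c - b) (r * (b.prod fun i n => ((c i).descFactorial n : ℂ))) := by
  classical
  induction b using Finsupp.induction with
  | zero => simp
  | single_add i n b hi hn ih =>
    rw [show (monomial (Finsupp.single i n + b) (1 : ℂ)) = X i ^ n * monomial b 1 by
      rw [X_pow_eq_monomial, monomial_mul, one_mul], map_mul, map_pow, constOp_X,
      Module.End.mul_apply, ih, pderiv_pow_monomial]
    have hbi : b i = 0 := Finsupp.notMem_support_iff.1 hi
    refine congrArg₂ (fun a r => monomial a r) ?_ ?_
    · rw [tsub_tsub, add_comm]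
    · rw [Finsupp.prod_add_index_of_disjoint, Finsupp.prod_single_index (by simp)]
      · simp [hbi]; ring
      · rw [Finset.disjoint_left]
        intro j hj hj'
        rw [Finset.mem_singleton.1 (Finsupp.support_single_subset hj)] at hj'
        exact hi hj'

theorem prod_descFactorial_eq_zero {b c : I →₀ ℕ} (h : ¬ b ≤ c) :
    (b.prod fun i n => ((c i).descFactorial n : ℂ)) = 0 := by
  rw [Finsupp.le_def] at h
  push Not at h
  obtain ⟨i, hi⟩ := h
  refine Finset.prod_eq_zero (i := i) (by simp; omega) ?_
  exact Nat.cast_eq_zero.2 (Nat.descFactorial_eq_zero_iff_lt.2 hi)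

theorem prod_descFactorial_self_ne_zero (b : I →₀ ℕ) :
    (b.prod fun i n => ((b i).descFactorial n : ℂ)) ≠ 0 := by
  refine Finset.prod_ne_zero_iff.2 fun i _ => ?_
  exact Nat.cast_ne_zero.2 (by rw [Nat.descFactorial_self]; exact Nat.factorial_ne_zero _)

/-- The operator `∑ b, P b * ∂ ^ b`. -/
noncomputable def normalOp :
    ((I →₀ ℕ) →₀ MvPolynomial I ℂ) →ₗ[ℂ] Module.End ℂ (MvPolynomial I ℂ) :=
  Finsupp.lsum ℂ fun b => LinearMap.mulRight ℂ (constOp (monomial b 1)) ∘ₗ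
    (LinearMap.mul ℂ (MvPolynomial I ℂ))

theorem normalOp_apply (P : (I →₀ ℕ) →₀ MvPolynomial I ℂ) (f : MvPolynomial I ℂ) :
    normalOp P f = P.sum fun b p => p * constOp (monomial b 1) f := by
  simp [normalOp, Finsupp.sum, LinearMap.sum_apply]

/-- A differential operator in normal form is determined by its values on monomials whose exponent
is minimal among those that occur in it. -/
theorem normalOp_monomial_of_minimal (P : (I →₀ ℕ) →₀ MvPolynomial I ℂ) (c : I →₀ ℕ)
    (hc : ∀ b ∈ P.support, b ≤ c → b = c) : normalOp P (monomial c 1)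
      = (c.prod fun i n => ((c i).descFactorial n : ℂ)) • P c := by
  rw [normalOp_apply, Finsupp.sum, Finset.sum_eq_single c]
  · rw [constOp_monomial, tsub_self, one_mul, mul_comm, ← C_apply, C_mul']
  · intro b hb hbc
    rw [constOp_monomial, prod_descFactorial_eq_zero (fun h => hbc (hc b hb h))]
    simp
  · intro h
    rw [Finsupp.notMem_support_iff.1 h, zero_mul]

/-- At a minimal exponent c of the support, the operator sends x^c to c! times the coefficient P c,
since every other term kills x^c. -/
theorem normalOp_injective : Function.Injective (normalOp (I := I)) := by
  rw [← LinearMap.ker_eq_bot, LinearMap.ker_eq_bot']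
  intro P hP
  by_contra hne
  obtain ⟨c, hc⟩ := P.support.exists_minimal (Finsupp.support_nonempty_iff.2 hne)
  have h := normalOp_monomial_of_minimal P c fun b hb hbc => le_antisymm hbc (hc.2 hb hbc)
  rw [hP, LinearMap.zero_apply] at h
  exact (Finsupp.mem_support_iff.1 hc.1)
    ((smul_eq_zero.1 h.symm).resolve_left (prod_descFactorial_self_ne_zero c))

/-- The representation of the Weyl algebra on polynomials is faithful. -/
theorem eq_zero_of_weyl [DecidableEq I] {W : Type*} [Ring W] [Algebra ℂ W] (q p : I → W)
    (hq : ∀ i j, q i * q j = q j * q i) (hp : ∀ i j, p i * p j = p j * p i)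
    (hpq : ∀ i j, p i * q j = q j * p i + if i = j then 1 else 0)
    (α : W →ₐ[ℂ] Module.End ℂ (MvPolynomial I ℂ)) (hαq : ∀ i, α (q i) = opX i)
    (hαp : ∀ i, α (p i) = opD i) (w : W)
    (hw : w ∈ Algebra.adjoin ℂ (Set.range q ∪ Set.range p)) (h0 : α w = 0) : w = 0 := by
  obtain ⟨fq, hfq⟩ := exists_aeval_of_commute q hq
  obtain ⟨fp, hfp⟩ := exists_aeval_of_commute p hp
  -- Λ(P) is the normally ordered element ∑ P_b(q) p^b of W.
  let Λ : ((I →₀ ℕ) →₀ MvPolynomial I ℂ) →ₗ[ℂ] W :=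
    Finsupp.lsum ℂ fun b => LinearMap.mulRight ℂ (fp (monomial b 1)) ∘ₗ fq.toLinearMap
  have hΛs : ∀ b P, Λ (Finsupp.single b P) = fq P * fp (monomial b 1) := by
    intro b P; simp [Λ]
  have hcomm : ∀ i P, p i * fq P = fq P * p i + fq (pderiv i P) := by
    intro i P
    induction P using MvPolynomial.induction_on with
    | C a =>
      rw [← algebraMap_eq, AlgHom.commutes, Derivation.map_algebraMap, map_zero, add_zero]
      exact (Algebra.commutes a (p i)).symm
    | add P Q hP hQ => rw [map_add, mul_add, hP, hQ, map_add, map_add, add_mul]; abel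
    | mul_X P j hP =>
      rw [map_mul, ← mul_assoc, hP, hfq, add_mul, mul_assoc (fq P), hpq, pderiv_mul, pderiv_X,
        map_add, map_mul, map_mul, hfq, mul_add, mul_assoc]
      by_cases h : i = j
      · subst h; simp; abel
      · simp [h]
  -- The commutation relations make the normally ordered elements stable under left multiplication
  -- by the generators; applied to 1, this puts the whole generated subalgebra in normal form. There
  -- α becomes the injective map `normalOp`.
  have hrange : ∀ w ∈ Algebra.adjoin ℂ (Set.range q ∪ Set.range p),
      ∀ x ∈ LinearMap.range Λ, w * x ∈ LinearMap.range Λ := by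
    intro w hw
    have hgen : ∀ w : W, (∀ b P, w * (fq P * fp (monomial b 1)) ∈ LinearMap.range Λ) →
        ∀ x ∈ LinearMap.range Λ, w * x ∈ LinearMap.range Λ := by
      rintro w h _ ⟨P, rfl⟩
      induction P using Finsupp.induction_linear with
      | zero => simp
      | add P Q hP hQ => rw [map_add, mul_add]; exact Submodule.add_mem _ hP hQ
      | single b P => rw [hΛs]; exact h b P
    induction hw using Algebra.adjoin_induction with
    | mem w hw =>
      refine hgen w fun b P => ?_
      rcases hw with ⟨i, rfl⟩ | ⟨i, rfl⟩
      · exact ⟨Finsupp.single b (X i * P), by rw [hΛs, map_mul, hfq, mul_assoc]⟩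
      · refine ⟨Finsupp.single (Finsupp.single i 1 + b) P + Finsupp.single b (pderiv i P), ?_⟩
        have h1 : (monomial (Finsupp.single i 1 + b) (1 : ℂ)) = X i * monomial b 1 := by
          rw [X, monomial_mul, one_mul]
        rw [map_add, hΛs, hΛs, ← mul_assoc, hcomm, add_mul, h1, map_mul, hfp, mul_assoc]
    | algebraMap r =>
      intro x hx
      rw [← Algebra.smul_def]
      exact Submodule.smul_mem _ _ hx
    | add a b _ _ ha hb =>
      intro x hx
      rw [add_mul]
      exact Submodule.add_mem _ (ha x hx) (hb x hx)
    | mul a b _ _ ha hb =>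
      intro x hx
      rw [mul_assoc]
      exact ha _ (hb x hx)
  obtain ⟨P, hP⟩ := hrange w hw 1 ⟨Finsupp.single 0 1, by rw [hΛs]; simp⟩
  rw [mul_one] at hP
  have hαfp : α.comp fp = constOp := by
    ext i : 1
    simp [hfp, hαp]
  have hαfq : α.comp fq = Algebra.lmul ℂ (MvPolynomial I ℂ) := by
    ext i : 1
    simp [hfq, hαq]; rfl
  have h2 : ∀ P, α (Λ P) = normalOp P := by
    intro P
    induction P using Finsupp.induction_linear with
    | zero => simp
    | add P Q hP hQ => rw [map_add, map_add, hP, hQ, map_add]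
    | single b P =>
      rw [hΛs, map_mul, ← AlgHom.comp_apply, ← AlgHom.comp_apply, hαfp, hαfq]
      simp [normalOp]
  have h3 : P = 0 := normalOp_injective (by rw [← h2, hP, h0, map_zero])
  rw [← hP, h3, map_zero]

end WeylAlgebra
end SuperMF

namespace SuperMF

/-! ### Linear substitutions acting on differential operators -/

section LinearSubstitution

open MvPolynomial

variable {I : Type*} [Fintype I] [DecidableEq I]

/-- The algebra endomorphism `X i ↦ ∑ k, A k i • X k`. -/
noncomputable def linSubst (A : Matrix I I ℂ) : MvPolynomial I ℂ →ₐ[ℂ] MvPolynomial I ℂ :=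
  aeval fun i => ∑ k, A k i • X k

theorem linSubst_X (A : Matrix I I ℂ) (i : I) : linSubst A (X i) = ∑ k, A k i • X k := by
  simp [linSubst]

theorem linSubst_one : linSubst (1 : Matrix I I ℂ) = AlgHom.id ℂ _ := by
  ext i : 1
  simp [linSubst_X, Matrix.one_apply]

theorem linSubst_mul (A B : Matrix I I ℂ) : linSubst (A * B) = (linSubst A).comp (linSubst B) := by
  ext i : 1
  simp only [AlgHom.comp_apply, linSubst_X, map_sum, map_smul, Matrix.mul_apply, Finset.sum_smul,
    Finset.smul_sum, smul_smul]
  rw [Finset.sum_comm]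
  exact Finset.sum_congr rfl fun _ _ => Finset.sum_congr rfl fun _ _ => by rw [mul_comm]

theorem linSubst_comp_opX (A : Matrix I I ℂ) (i : I) :
    (linSubst A).toLinearMap * opX i = (∑ k, A k i • opX k) * (linSubst A).toLinearMap := by
  refine LinearMap.ext fun f => ?_
  simp [linSubst_X, Finset.sum_mul, LinearMap.sum_apply]

/-- This is the chain rule; both sides are compared by induction on products with a variable. -/
theorem opD_comp_linSubst (A : Matrix I I ℂ) (k : I) :
    opD k * (linSubst A).toLinearMap = (linSubst A).toLinearMap * ∑ i, A k i • opD i := by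
  refine LinearMap.ext fun f => ?_
  simp only [Module.End.mul_apply, AlgHom.toLinearMap_apply, opD_apply, LinearMap.sum_apply,
    LinearMap.smul_apply]
  induction f using MvPolynomial.induction_on with
  | C a =>
    rw [← algebraMap_eq, AlgHom.commutes]
    simp
  | add P Q hP hQ => simp only [map_add, hP, hQ, smul_add, Finset.sum_add_distrib]
  | mul_X P j hP =>
    have h1 : pderiv k (linSubst A (X j)) = C (A k j) := by
      rw [linSubst_X, map_sum, Finset.sum_eq_single k]
      · rw [Derivation.map_smul, pderiv_X_self, smul_eq_C_mul, mul_one]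
      · intro i _ hi
        rw [Derivation.map_smul, pderiv_X_of_ne hi, smul_zero]
      · simp
    have h2 : ∑ d, A k d • pderiv d (P * X j)
        = (∑ d, A k d • pderiv d P) * X j + C (A k j) * P := by
      simp only [pderiv_mul, smul_add, Finset.sum_add_distrib, Finset.sum_mul, smul_mul_assoc]
      congr 1
      rw [Finset.sum_eq_single j]
      · rw [pderiv_X_self, mul_one, smul_eq_C_mul]
      · intro i _ hi
        rw [pderiv_X_of_ne (Ne.symm hi), mul_zero, smul_zero]
      · simp
    have h3 : linSubst A (C (A k j)) = C (A k j) := (linSubst A).commutes _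
    rw [map_mul, pderiv_mul, hP, h1, h2, map_add, map_mul, map_mul, h3, mul_comm (C _)]

theorem linSubst_comp_opD {A B : Matrix I I ℂ} (h : B * A = 1) (i : I) :
    (linSubst A).toLinearMap * opD i = (∑ k, B i k • opD k) * (linSubst A).toLinearMap := by
  simp only [Finset.sum_mul, smul_mul_assoc, opD_comp_linSubst, Finset.mul_sum, mul_smul_comm,
    Finset.smul_sum, smul_smul]
  rw [Finset.sum_comm]
  simp only [← Finset.sum_smul, ← Matrix.mul_apply, h, Matrix.one_apply]
  simp

/-- Derivatives transform contragrediently to variables, so the symbol Q is substituted by the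
transposed inverse matrix. -/
theorem linSubst_comp_constOp {A B : Matrix I I ℂ} (h : B * A = 1) (Q : MvPolynomial I ℂ) :
    (linSubst A).toLinearMap * constOp Q
      = constOp (linSubst B.transpose Q) * (linSubst A).toLinearMap := by
  induction Q using MvPolynomial.induction_on with
  | C a =>
    rw [← algebraMap_eq, AlgHom.commutes, AlgHom.commutes, AlgHom.commutes]
    exact (Algebra.commutes a _).symm
  | add P Q hP hQ => simp only [map_add, mul_add, add_mul, hP, hQ]
  | mul_X P j hP =>
    rw [map_mul, ← mul_assoc, hP, mul_assoc, constOp_X, linSubst_comp_opD h, map_mul, map_mul,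
      mul_assoc, linSubst_X]
    simp

theorem linSubst_comp_mulLeft (A : Matrix I I ℂ) (P : MvPolynomial I ℂ) :
    (linSubst A).toLinearMap * LinearMap.mulLeft ℂ P
      = LinearMap.mulLeft ℂ (linSubst A P) * (linSubst A).toLinearMap := by
  refine LinearMap.ext fun f => ?_
  simp

end LinearSubstitution

/-! ### Multidegrees, Euler operators and homogeneous differential operators -/

section Weights

open MvPolynomial

variable {I K : Type*} [Fintype I] [DecidableEq K]

/-- The multidegree on `MvPolynomial I ℂ` for which the variable `X i` has degree `π i`. -/
def blockWeight (π : I → K) (i : I) : K → ℕ := Pi.single (π i) 1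

/-- The polynomials that are homogeneous of multidegree `d`. -/
noncomputable def blockHomogeneous (π : I → K) (d : K → ℕ) : Submodule ℂ (MvPolynomial I ℂ) :=
  weightedHomogeneousSubmodule ℂ (blockWeight π) d

/-- The Euler operator of a block of variables. -/
noncomputable def euler (π : I → K) (p : K) : Module.End ℂ (MvPolynomial I ℂ) :=
  ∑ i with π i = p, opX i * opD i

theorem weight_blockWeight_apply (π : I → K) (c : I →₀ ℕ) (p : K) :
    Finsupp.weight (blockWeight π) c p = ∑ i with π i = p, c i := by
  rw [Finsupp.weight_eq_sum, Finset.sum_apply, Finset.sum_filter]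
  refine Finset.sum_congr rfl fun i _ => ?_
  simp [blockWeight, Pi.single_apply, eq_comm]

theorem euler_monomial (π : I → K) (p : K) (c : I →₀ ℕ) (r : ℂ) :
    euler π p (monomial c r) = (Finsupp.weight (blockWeight π) c p : ℂ) • monomial c r := by
  classical
  rw [weight_blockWeight_apply, euler, LinearMap.sum_apply, Nat.cast_sum, Finset.sum_smul]
  refine Finset.sum_congr rfl fun i _ => ?_
  rw [Module.End.mul_apply, opD_apply, opX_apply, pderiv_monomial, X, monomial_mul, smul_monomial]
  by_cases h : c i = 0
  · simp [h]
  · refine congrArg₂ (fun a r => monomial a r) ?_ (by simp [mul_comm])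
    rw [add_comm, tsub_add_cancel_of_le]
    simpa using Nat.one_le_iff_ne_zero.2 h

theorem coeff_euler (π : I → K) (p : K) (f : MvPolynomial I ℂ) (c : I →₀ ℕ) :
    coeff c (euler π p f) = (Finsupp.weight (blockWeight π) c p : ℂ) * coeff c f := by
  classical
  induction f using MvPolynomial.induction_on' with
  | monomial u a =>
    rw [euler_monomial, coeff_smul, coeff_monomial]
    split_ifs with h
    · subst h; simp
    · simp
  | add P Q hP hQ => rw [map_add, coeff_add, coeff_add, hP, hQ, mul_add]

/-- The Euler operators act on a monomial by its block degrees, so multihomogeneous polynomials are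
their joint eigenvectors. Preserving multidegrees thereby becomes a commutation relation, which can
be carried through the Fourier transform. -/
theorem mem_blockHomogeneous {π : I → K} {d : K → ℕ} {f : MvPolynomial I ℂ} :
    f ∈ blockHomogeneous π d ↔ ∀ p, euler π p f = (d p : ℂ) • f := by
  rw [blockHomogeneous, mem_weightedHomogeneousSubmodule]
  constructor
  · intro h p
    ext c
    rw [coeff_euler, coeff_smul, smul_eq_mul]
    by_cases hc : coeff c f = 0
    · simp [hc]
    · rw [h hc]
  · intro h c hc
    funext p
    have := congrArg (coeff c) (h p)
    rw [coeff_euler, coeff_smul, smul_eq_mul] at this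
    exact_mod_cast mul_right_cancel₀ hc this

theorem monomial_mem_blockHomogeneous {π : I → K} {d : K → ℕ} {c : I →₀ ℕ}
    (hc : Finsupp.weight (blockWeight π) c = d) (r : ℂ) :
    monomial c r ∈ blockHomogeneous π d :=
  isWeightedHomogeneous_monomial _ _ _ hc

theorem euler_mul (π : I → K) (p : K) (f h : MvPolynomial I ℂ) :
    euler π p (f * h) = euler π p f * h + f * euler π p h := by
  simp only [euler, LinearMap.sum_apply, Module.End.mul_apply, opD_apply, opX_apply, pderiv_mul,
    Finset.sum_mul, Finset.mul_sum, ← Finset.sum_add_distrib]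
  exact Finset.sum_congr rfl fun _ _ => by ring

/-- Distinct exponents of the same multidegree are incomparable. Hence in an operator of fixed
multidegree every occurring exponent is minimal and its coefficient can be read off. -/
theorem eq_of_le_of_weight_eq {π : I → K} {b c : I →₀ ℕ} (h : b ≤ c)
    (hw : Finsupp.weight (blockWeight π) b = Finsupp.weight (blockWeight π) c) : b = c := by
  ext i
  have h1 := congrFun hw (π i)
  rw [weight_blockWeight_apply, weight_blockWeight_apply] at h1
  exact (Finset.sum_eq_sum_iff_of_le fun i _ => h i).1 h1 i (by simp)

theorem finite_setOf_weight_eq (π : I → K) (d : K → ℕ) :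
    {b : I →₀ ℕ | Finsupp.weight (blockWeight π) b = d}.Finite := by
  classical
  refine (Set.finite_Iic (Finsupp.equivFunOnFinite.symm fun i => d (π i))).subset ?_
  rintro b rfl i
  simp only [Finsupp.equivFunOnFinite_symm_apply_apply, weight_blockWeight_apply]
  exact Finset.single_le_sum (f := fun j => b j) (fun _ _ => Nat.zero_le _) (by simp)

variable [DecidableEq I]

theorem euler_comp_linSubst {π : I → K} {A : Matrix I I ℂ} (hA : ∀ i j, π i ≠ π j → A i j = 0)
    (p : K) : euler π p * (linSubst A).toLinearMap = (linSubst A).toLinearMap * euler π p := by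
  have h1 : ∀ k, opX k * opD k * (linSubst A).toLinearMap
      = ∑ i, A k i • (opX k * ((linSubst A).toLinearMap * opD i)) := by
    intro k
    rw [mul_assoc, opD_comp_linSubst, Finset.mul_sum, Finset.mul_sum]
    simp only [mul_smul_comm]
  have h2 : ∀ i, (linSubst A).toLinearMap * (opX i * opD i)
      = ∑ k, A k i • (opX k * ((linSubst A).toLinearMap * opD i)) := by
    intro i
    rw [← mul_assoc, linSubst_comp_opX, mul_assoc, Finset.sum_mul]
    simp only [smul_mul_assoc]
  rw [euler, Finset.sum_mul, Finset.mul_sum, Finset.sum_congr rfl fun k _ => h1 k,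
    Finset.sum_congr rfl fun i _ => h2 i, Finset.sum_filter, Finset.sum_filter]
  have h3 : ∀ k, (if π k = p then ∑ i, A k i • (opX k * ((linSubst A).toLinearMap * opD i)) else 0)
      = ∑ i, if π i = p then A k i • (opX k * ((linSubst A).toLinearMap * opD i)) else 0 := by
    intro k
    split_ifs with hk
    · refine Finset.sum_congr rfl fun i _ => ?_
      split_ifs with hi
      · rfl
      · rw [hA k i (by rw [hk]; exact Ne.symm hi), zero_smul]
    · refine (Finset.sum_eq_zero fun i _ => ?_).symm
      split_ifs with hi
      · rw [hA k i (by rw [hi]; exact hk), zero_smul]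
      · rfl
  rw [Finset.sum_congr rfl fun k _ => h3 k, Finset.sum_comm]
  refine Finset.sum_congr rfl fun i _ => ?_
  split_ifs <;> simp

theorem linSubst_mem_blockHomogeneous {π : I → K} {A : Matrix I I ℂ}
    (hA : ∀ i j, π i ≠ π j → A i j = 0) {d : K → ℕ} {f : MvPolynomial I ℂ}
    (hf : f ∈ blockHomogeneous π d) : linSubst A f ∈ blockHomogeneous π d := by
  rw [mem_blockHomogeneous] at hf ⊢
  intro p
  have := LinearMap.congr_fun (euler_comp_linSubst hA p) f
  simp only [Module.End.mul_apply, AlgHom.toLinearMap_apply] at this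
  rw [this, hf, map_smul]

/-- The differential operators `∑ b, P b * ∂ ^ b` where `b` runs over the exponents of
multidegree `d`. -/
noncomputable def homogeneousOps (π : I → K) (d : K → ℕ) :
    Submodule ℂ (Module.End ℂ (MvPolynomial I ℂ)) :=
  (Finsupp.supported (MvPolynomial I ℂ) ℂ
    {b : I →₀ ℕ | Finsupp.weight (blockWeight π) b = d}).map normalOp

/-- Applying the operator to x^c returns c! P_c for each c in the support, so polynomials of
multidegree d already detect it. Identities between such operators can therefore be checked on a
single component. -/
theorem homogeneousOps_eq_zero {π : I → K} {d : K → ℕ} {F : Module.End ℂ (MvPolynomial I ℂ)}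
    (hF : F ∈ homogeneousOps π d) (h : ∀ f ∈ blockHomogeneous π d, F f = 0) : F = 0 := by
  obtain ⟨P, hP, rfl⟩ := hF
  have : P = 0 := by
    by_contra hne
    obtain ⟨c, hc⟩ := Finsupp.support_nonempty_iff.2 hne
    have hcd := hP hc
    have h1 := normalOp_monomial_of_minimal P c fun b hb hbc =>
      eq_of_le_of_weight_eq hbc ((hP hb).trans hcd.symm)
    rw [h _ (monomial_mem_blockHomogeneous hcd 1)] at h1
    exact (Finsupp.mem_support_iff.1 hc)
      ((smul_eq_zero.1 h1.symm).resolve_left (prod_descFactorial_self_ne_zero c))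
  rw [this, map_zero]

theorem monomial_eq_smul (b : I →₀ ℕ) (r : ℂ) :
    monomial b r = r • (monomial b 1 : MvPolynomial I ℂ) := by
  rw [smul_monomial, smul_eq_mul, mul_one]

theorem mulLeft_mul_constOp_mem {π : I → K} {d : K → ℕ} (P : MvPolynomial I ℂ)
    {Q : MvPolynomial I ℂ} (hQ : Q ∈ blockHomogeneous π d) :
    LinearMap.mulLeft ℂ P * constOp Q ∈ homogeneousOps π d := by
  rw [Q.as_sum, map_sum, Finset.mul_sum]
  refine Submodule.sum_mem _ fun b hb => ?_
  rw [monomial_eq_smul b, map_smul, mul_smul_comm]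
  refine Submodule.smul_mem _ _ ⟨Finsupp.single b P, ?_, ?_⟩
  · exact Finsupp.single_mem_supported _ _ (hQ (mem_support_iff.1 hb))
  · simp [normalOp]
    rfl

/-- The products P · Q(∂) with Q of multidegree d span these operators; allowing arbitrary such Q,
rather than monomials, is what makes the span visibly stable under substitutions. -/
theorem homogeneousOps_induction {π : I → K} {d : K → ℕ}
    {N : Submodule ℂ (Module.End ℂ (MvPolynomial I ℂ))}
    (h : ∀ P, ∀ Q ∈ blockHomogeneous π d, LinearMap.mulLeft ℂ P * constOp Q ∈ N) :
    homogeneousOps π d ≤ N := by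
  rintro _ ⟨P, hP, rfl⟩
  rw [show normalOp P = P.sum fun b p => LinearMap.mulLeft ℂ p * constOp (monomial b 1) from
    LinearMap.ext fun f => by
      rw [normalOp_apply]; simp [Finsupp.sum, LinearMap.sum_apply]]
  exact Submodule.sum_mem _ fun b hb => h _ _ (monomial_mem_blockHomogeneous (hP hb) 1)

/-- Take F = ∑ (1/b!) φ(x^b) ∂^b over the finitely many b of multidegree d; on x^c of that
multidegree only b = c contributes. With `homogeneousOps_eq_zero` the extension is unique. -/
theorem exists_homogeneousOps_eqOn (π : I → K) (d : K → ℕ)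
    (φ : MvPolynomial I ℂ →ₗ[ℂ] MvPolynomial I ℂ) :
    ∃ F ∈ homogeneousOps π d, ∀ f ∈ blockHomogeneous π d, F f = φ f := by
  let s := (finite_setOf_weight_eq π d).toFinset
  have hs : ∀ b, b ∈ s ↔ Finsupp.weight (blockWeight π) b = d := fun b => by simp [s]
  refine ⟨∑ b ∈ s, (b.prod fun i n => ((b i).descFactorial n : ℂ))⁻¹ •
    (LinearMap.mulLeft ℂ (φ (monomial b 1)) * constOp (monomial b 1)), ?_, ?_⟩
  · exact Submodule.sum_mem _ fun b hb => Submodule.smul_mem _ _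
      (mulLeft_mul_constOp_mem _ (monomial_mem_blockHomogeneous ((hs b).1 hb) 1))
  · intro f hf
    rw [f.as_sum, map_sum, map_sum]
    refine Finset.sum_congr rfl fun c hc => ?_
    have hcd := hf (mem_support_iff.1 hc)
    rw [LinearMap.sum_apply, Finset.sum_eq_single c]
    · rw [LinearMap.smul_apply, Module.End.mul_apply, constOp_monomial, tsub_self,
        LinearMap.mulLeft_apply, mul_comm, ← C_apply, C_mul', smul_smul, mul_comm (coeff c f),
        inv_mul_cancel_left₀ (prod_descFactorial_self_ne_zero c), ← map_smul, smul_monomial,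
        smul_eq_mul, mul_one]
    · intro b hb hbc
      rw [LinearMap.smul_apply, Module.End.mul_apply, constOp_monomial,
        prod_descFactorial_eq_zero
          fun h => hbc (eq_of_le_of_weight_eq h (((hs b).1 hb).trans hcd.symm))]
      simp
    · intro h
      exact absurd ((hs c).2 hcd) h

/-- Membership in the algebra generated by variables and derivatives is what allows the Fourier
transform to be applied. -/
theorem homogeneousOps_le_adjoin (π : I → K) (d : K → ℕ) :
    homogeneousOps π d ≤ Subalgebra.toSubmodule
      (Algebra.adjoin ℂ (Set.range (opX (I := I)) ∪ Set.range opD)) := by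
  refine homogeneousOps_induction fun P Q hQ => ?_
  clear hQ
  rw [Subalgebra.mem_toSubmodule]
  refine mul_mem ?_ ?_
  · induction P using MvPolynomial.induction_on with
    | C a =>
      have : LinearMap.mulLeft ℂ (C a : MvPolynomial I ℂ)
          = algebraMap ℂ (Module.End ℂ (MvPolynomial I ℂ)) a := by
        refine LinearMap.ext fun f => ?_
        rw [LinearMap.mulLeft_apply, C_mul', Module.algebraMap_end_apply]
      rw [this]
      exact Subalgebra.algebraMap_mem _ _
    | add P Q hP hQ =>
      rw [show LinearMap.mulLeft ℂ (P + Q) = LinearMap.mulLeft ℂ P + LinearMap.mulLeft ℂ Q from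
        LinearMap.ext fun f => by simp [add_mul]]
      exact add_mem hP hQ
    | mul_X P j hP =>
      rw [show LinearMap.mulLeft ℂ (P * X j) = LinearMap.mulLeft ℂ P * opX j from
        LinearMap.ext fun f => by simp [mul_assoc]]
      exact mul_mem hP (Algebra.subset_adjoin (Or.inl ⟨j, rfl⟩))
  · induction Q using MvPolynomial.induction_on with
    | C a =>
      rw [← algebraMap_eq, AlgHom.commutes]
      exact Subalgebra.algebraMap_mem _ _
    | add P Q hP hQ => rw [map_add]; exact add_mem hP hQ
    | mul_X P j hP =>
      rw [map_mul, constOp_X]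
      exact mul_mem hP (Algebra.subset_adjoin (Or.inr ⟨j, rfl⟩))

/-- Conjugation transforms P and the symbol Q separately, and a block diagonal substitution keeps
the multidegree of Q. -/
theorem exists_homogeneousOps_conj {π : I → K} {d : K → ℕ} {A B : Matrix I I ℂ} (h : B * A = 1)
    (hB : ∀ i j, π i ≠ π j → B i j = 0) {F : Module.End ℂ (MvPolynomial I ℂ)}
    (hF : F ∈ homogeneousOps π d) : ∃ F' ∈ homogeneousOps π d,
      (linSubst A).toLinearMap * F = F' * (linSubst A).toLinearMap := by
  have key : homogeneousOps π d ≤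
      ((homogeneousOps π d).map (LinearMap.mulRight ℂ (linSubst A).toLinearMap)).comap
        (LinearMap.mulLeft ℂ (linSubst A).toLinearMap) := by
    refine homogeneousOps_induction fun P Q hQ => ?_
    refine ⟨_, mulLeft_mul_constOp_mem (linSubst A P)
      (linSubst_mem_blockHomogeneous (A := B.transpose) (fun i j hij => hB j i hij.symm) hQ), ?_⟩
    rw [LinearMap.mulRight_apply, LinearMap.mulLeft_apply, ← mul_assoc, linSubst_comp_mulLeft,
      mul_assoc, mul_assoc, linSubst_comp_constOp h]
  obtain ⟨F', hF', h2⟩ := key hF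
  exact ⟨F', hF', h2.symm⟩

/-- A constant coefficient operator of multidegree d lowers the degree in block p by d p; this is
tested on monomials, where the case b ≰ c gives zero on both sides. -/
theorem euler_mul_constOp {π : I → K} {d : K → ℕ} (p : K) {Q : MvPolynomial I ℂ}
    (hQ : Q ∈ blockHomogeneous π d) :
    euler π p * constOp Q = constOp Q * euler π p - (d p : ℂ) • constOp Q := by
  have key : blockHomogeneous π d ≤ LinearMap.ker
      (LinearMap.mulLeft ℂ (euler π p) ∘ₗ constOp.toLinearMap
        - LinearMap.mulRight ℂ (euler π p) ∘ₗ constOp.toLinearMap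
        + (d p : ℂ) • constOp.toLinearMap) := by
    intro Q hQ
    rw [Q.as_sum]
    refine Submodule.sum_mem _ fun b hb => ?_
    have hbd := hQ (mem_support_iff.1 hb)
    rw [monomial_eq_smul b]
    refine Submodule.smul_mem _ _ ?_
    rw [LinearMap.mem_ker]
    refine MvPolynomial.linearMap_ext fun c => LinearMap.ext_ring ?_
    simp only [LinearMap.add_apply, LinearMap.sub_apply, LinearMap.comp_apply,
      LinearMap.mulLeft_apply, LinearMap.mulRight_apply, LinearMap.smul_apply,
      AlgHom.toLinearMap_apply, Module.End.mul_apply, euler_monomial, map_smul, constOp_monomial,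
      LinearMap.zero_apply]
    by_cases hbc : b ≤ c
    · obtain ⟨e, rfl⟩ := exists_add_of_le hbc
      rw [add_tsub_cancel_left, map_add, hbd, ← sub_smul, ← add_smul]
      simp
    · rw [prod_descFactorial_eq_zero hbc]
      simp
  have h := key hQ
  rw [LinearMap.mem_ker] at h
  simp only [LinearMap.add_apply, LinearMap.sub_apply, LinearMap.comp_apply,
      LinearMap.mulLeft_apply, LinearMap.mulRight_apply, LinearMap.smul_apply,
      AlgHom.toLinearMap_apply] at h
  rw [← sub_eq_zero, ← h]
  abel

/-- A homogeneous differential operator that preserves `blockHomogeneous π d` commutes with the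
Euler operators. -/
theorem euler_comm_of_homogeneousOps {π : I → K} {d : K → ℕ}
    {F : Module.End ℂ (MvPolynomial I ℂ)} (hF : F ∈ homogeneousOps π d)
    (h : ∀ f ∈ blockHomogeneous π d, F f ∈ blockHomogeneous π d) (p : K) :
    euler π p * F = F * euler π p := by
  rw [← sub_eq_zero]
  -- The commutator is again an operator of multidegree d, and it vanishes on that component because
  -- the Euler operator is the scalar d p before and after F.
  refine homogeneousOps_eq_zero (π := π) (d := d) ?_ ?_
  · have key : homogeneousOps π d ≤ (homogeneousOps π d).comap
        (LinearMap.mulLeft ℂ (euler π p) - LinearMap.mulRight ℂ (euler π p)) := by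
      refine homogeneousOps_induction fun P Q hQ => ?_
      rw [Submodule.mem_comap, LinearMap.sub_apply, LinearMap.mulLeft_apply,
        LinearMap.mulRight_apply]
      have h1 : euler π p * LinearMap.mulLeft ℂ P
          = LinearMap.mulLeft ℂ (euler π p P) + LinearMap.mulLeft ℂ P * euler π p :=
        LinearMap.ext fun f => by simp [euler_mul]
      have h2 : euler π p * (LinearMap.mulLeft ℂ P * constOp Q)
          - LinearMap.mulLeft ℂ P * constOp Q * euler π p
          = LinearMap.mulLeft ℂ (euler π p P) * constOp Q
            - (d p : ℂ) • (LinearMap.mulLeft ℂ P * constOp Q) := by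
        rw [← mul_assoc, h1, add_mul, mul_assoc (LinearMap.mulLeft ℂ P), euler_mul_constOp p hQ,
          mul_sub, mul_smul_comm, mul_assoc]
        abel
      rw [h2]
      exact Submodule.sub_mem _ (mulLeft_mul_constOp_mem _ hQ)
        (Submodule.smul_mem _ _ (mulLeft_mul_constOp_mem _ hQ))
    exact key hF
  · intro f hf
    rw [LinearMap.sub_apply, Module.End.mul_apply, Module.End.mul_apply,
      mem_blockHomogeneous.1 hf p, mem_blockHomogeneous.1 (h f hf) p, map_smul, sub_self]

end Weights
end SuperMF

namespace SuperMF

/-! ### The partial Fourier transform as a subalgebra of pairs of operators -/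

section WeylPairs

open MvPolynomial

variable {I : Type*}

/-- Multiplication by `X i` paired with its image under the partial Fourier transform. -/
noncomputable def pairX (J : I → Prop) [DecidablePred J] (i : I) :
    Module.End ℂ (MvPolynomial I ℂ) × Module.End ℂ (MvPolynomial I ℂ) :=
  (opX i, if J i then opD i else opX i)

/-- The derivative along `X i` paired with its image under the partial Fourier transform. -/
noncomputable def pairD (J : I → Prop) [DecidablePred J] (i : I) :
    Module.End ℂ (MvPolynomial I ℂ) × Module.End ℂ (MvPolynomial I ℂ) :=
  (opD i, if J i then (-1 : ℂ) • opX i else opD i)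

/-- The graph of the partial Fourier transform of the Weyl algebra. -/
noncomputable def weylPairs (J : I → Prop) [DecidablePred J] :
    Subalgebra ℂ (Module.End ℂ (MvPolynomial I ℂ) × Module.End ℂ (MvPolynomial I ℂ)) :=
  Algebra.adjoin ℂ (Set.range (pairX J) ∪ Set.range (pairD J))

variable (J : I → Prop) [DecidablePred J]

theorem pairX_mem (i : I) : pairX J i ∈ weylPairs J := Algebra.subset_adjoin (Or.inl ⟨i, rfl⟩)

theorem pairD_mem (i : I) : pairD J i ∈ weylPairs J := Algebra.subset_adjoin (Or.inr ⟨i, rfl⟩)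

theorem pairX_comm [DecidableEq I] (i j : I) : pairX J i * pairX J j = pairX J j * pairX J i := by
  refine Prod.ext (opX_comm i j) ?_
  by_cases h : i = j
  · subst h; rfl
  have h1 := opD_mul_opX i j
  have h2 := opD_mul_opX j i
  simp only [h, Ne.symm h, if_false, add_zero] at h1 h2
  simp only [pairX, Prod.snd_mul]
  split_ifs
  exacts [opD_comm i j, h1, h2.symm, opX_comm i j]

theorem pairD_comm [DecidableEq I] (i j : I) : pairD J i * pairD J j = pairD J j * pairD J i := by
  refine Prod.ext (opD_comm i j) ?_
  by_cases h : i = j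
  · subst h; rfl
  have h1 := opD_mul_opX i j
  have h2 := opD_mul_opX j i
  simp only [h, Ne.symm h, if_false, add_zero] at h1 h2
  simp only [pairD, Prod.snd_mul]
  split_ifs
  · rw [smul_mul_smul_comm, smul_mul_smul_comm, opX_comm]
  · rw [smul_mul_assoc, mul_smul_comm, h2]
  · rw [smul_mul_assoc, mul_smul_comm, h1]
  · exact opD_comm i j

/-- The sign in x ↦ ∂, ∂ ↦ -x gives [-x, ∂] = 1, so the canonical commutation relations hold in both
components. -/
theorem pairD_mul_pairX [DecidableEq I] (i j : I) :
    pairD J i * pairX J j = pairX J j * pairD J i + if i = j then 1 else 0 := by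
  refine Prod.ext ?_ ?_
  · have := opD_mul_opX i j
    split_ifs at this ⊢ <;> exact this
  · have h1 := opD_mul_opX i j
    have h2 := opD_mul_opX j i
    simp only [pairX, pairD, Prod.snd_mul, Prod.snd_add]
    by_cases h : i = j
    · subst h
      simp only [if_true] at h1 ⊢
      split_ifs
      · rw [smul_mul_assoc, mul_smul_comm, h1, smul_add, add_assoc, Prod.snd_one]
        refine (add_zero _).symm.trans (congrArg _ ?_)
        module
      · exact h1
    · simp only [h, Ne.symm h, if_false, add_zero, Prod.snd_zero] at h1 h2 ⊢
      split_ifs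
      · rw [smul_mul_assoc, mul_smul_comm, h2]
      · rw [smul_mul_assoc, mul_smul_comm, opX_comm]
      · exact opD_comm i j
      · exact h1

variable {J}

/-- The pairs satisfy the Weyl relations and the first projection is the standard representation,
which is faithful. Together with injectivity of the second projection, this makes `weylPairs` the
graph of a bijection, so the transform need not be constructed as a map. -/
theorem weylPairs_eq_zero_of_fst
    {w : Module.End ℂ (MvPolynomial I ℂ) × Module.End ℂ (MvPolynomial I ℂ)}
    (hw : w ∈ weylPairs J) (h : w.1 = 0) : w = 0 := by
  classical
  exact eq_zero_of_weyl (pairX J) (pairD J) (pairX_comm J) (pairD_comm J) (pairD_mul_pairX J)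
    (AlgHom.fst ℂ _ _) (fun _ => rfl) (fun _ => rfl) w hw h

/-- Renaming the generators on J, with -`pairD` as position and `pairX` as momentum, makes the
second projection the standard representation. -/
theorem weylPairs_eq_zero_of_snd
    {w : Module.End ℂ (MvPolynomial I ℂ) × Module.End ℂ (MvPolynomial I ℂ)}
    (hw : w ∈ weylPairs J) (h : w.2 = 0) : w = 0 := by
  classical
  refine eq_zero_of_weyl (fun i => if J i then (-1 : ℂ) • pairD J i else pairX J i)
    (fun i => if J i then pairX J i else pairD J i) ?_ ?_ ?_ (AlgHom.snd ℂ _ _) ?_ ?_ w ?_ h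
  · intro i j
    have h1 := pairX_comm J i j
    have h2 := pairD_comm J i j
    have h3 := pairD_mul_pairX J i j
    have h4 := pairD_mul_pairX J j i
    by_cases h : i = j
    · subst h; rfl
    simp only [h, Ne.symm h, if_false, add_zero] at h3 h4
    split_ifs
    · rw [smul_mul_smul_comm, smul_mul_smul_comm, h2]
    · rw [smul_mul_assoc, mul_smul_comm, h3]
    · rw [smul_mul_assoc, mul_smul_comm, h4]
    · exact h1
  · intro i j
    have h1 := pairX_comm J i j
    have h2 := pairD_comm J i j
    have h3 := pairD_mul_pairX J i j
    have h4 := pairD_mul_pairX J j i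
    by_cases h : i = j
    · subst h; rfl
    simp only [h, Ne.symm h, if_false, add_zero] at h3 h4
    split_ifs
    exacts [h1, h4.symm, h3, h2]
  · intro i j
    have h1 := pairX_comm J i j
    have h2 := pairD_comm J i j
    have h3 := pairD_mul_pairX J i j
    have h4 := pairD_mul_pairX J j i
    by_cases h : i = j
    · subst h
      simp only [if_true] at h3 ⊢
      split_ifs
      · rw [smul_mul_assoc, mul_smul_comm, h3, smul_add, add_assoc]
        refine (add_zero _).symm.trans (congrArg _ ?_)
        module
      · exact h3
    · simp only [h, Ne.symm h, if_false, add_zero] at h3 h4 ⊢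
      split_ifs
      · rw [smul_mul_assoc, mul_smul_comm, h4]
      · exact h1
      · rw [smul_mul_assoc, mul_smul_comm, h2]
      · exact h3
  · intro i
    simp only [AlgHom.snd_apply]
    split_ifs with hi <;> simp [pairX, pairD, hi, smul_smul]
  · intro i
    simp only [AlgHom.snd_apply]
    split_ifs with hi <;> simp [pairX, pairD, hi]
  · refine Algebra.adjoin_le ?_ hw
    rintro _ (⟨i, rfl⟩ | ⟨i, rfl⟩)
    · by_cases hi : J i
      · exact Algebra.subset_adjoin (Or.inr ⟨i, by simp [hi]⟩)
      · exact Algebra.subset_adjoin (Or.inl ⟨i, by simp [hi]⟩)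
    · by_cases hi : J i
      · rw [show pairD J i = (-1 : ℂ) • ((-1 : ℂ) • pairD J i) by rw [smul_smul]; norm_num]
        refine Subalgebra.smul_mem (Algebra.adjoin ℂ _) ?_ _
        exact Algebra.subset_adjoin (Or.inl ⟨i, by simp [hi]⟩)
      · exact Algebra.subset_adjoin (Or.inr ⟨i, by simp [hi]⟩)

variable (J)

theorem exists_weylPairs_snd {F : Module.End ℂ (MvPolynomial I ℂ)}
    (hF : F ∈ Algebra.adjoin ℂ (Set.range (opX (I := I)) ∪ Set.range opD)) :
    ∃ w ∈ weylPairs J, w.2 = F := by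
  suffices h : Algebra.adjoin ℂ (Set.range (opX (I := I)) ∪ Set.range opD)
      ≤ (weylPairs J).map (AlgHom.snd ℂ _ _) from h hF
  refine Algebra.adjoin_le ?_
  rintro _ (⟨i, rfl⟩ | ⟨i, rfl⟩)
  · by_cases hi : J i
    · exact ⟨(-1 : ℂ) • pairD J i, Subalgebra.smul_mem _ (pairD_mem J i) _, by simp [pairD, hi, smul_smul]⟩
    · exact ⟨pairX J i, pairX_mem J i, by simp [pairX, hi]⟩
  · by_cases hi : J i
    · exact ⟨pairX J i, pairX_mem J i, by simp [pairX, hi]⟩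
    · exact ⟨pairD J i, pairD_mem J i, by simp [pairD, hi]⟩

variable {J} [Fintype I] [DecidableEq I]

/-- A pair of linear substitutions, contragredient to each other on the variables in `J`,
normalizes the graph of the partial Fourier transform. -/
theorem exists_weylPairs_conj {A B A' B' : Matrix I I ℂ} (hBA : B * A = 1) (hBA' : B' * A' = 1)
    (hA : ∀ i j, A i j ≠ 0 → (J i ↔ J j)) (hB : ∀ i j, B i j ≠ 0 → (J i ↔ J j))
    (hA' : ∀ i j, A' i j = if J j then B j i else A i j)
    (hB' : ∀ i j, B' i j = if J j then A j i else B i j)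
    {w : Module.End ℂ (MvPolynomial I ℂ) × Module.End ℂ (MvPolynomial I ℂ)}
    (hw : w ∈ weylPairs J) : ∃ w' ∈ weylPairs J,
      ((linSubst A).toLinearMap, (linSubst A').toLinearMap) * w
        = w' * ((linSubst A).toLinearMap, (linSubst A').toLinearMap) := by
  induction hw using Algebra.adjoin_induction with
  | mem w hw =>
    rcases hw with ⟨i, rfl⟩ | ⟨i, rfl⟩
    · refine ⟨∑ k, A k i • pairX J k,
        sum_mem fun k _ => Subalgebra.smul_mem _ (pairX_mem J k) _, ?_⟩
      refine Prod.ext ?_ ?_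
      · simp only [Prod.fst_mul, Prod.fst_sum, Prod.smul_fst]
        exact linSubst_comp_opX A i
      · simp only [Prod.snd_mul, Prod.snd_sum, Prod.smul_snd]
        -- On flipped indices the second component is a derivative. Under the contragredient
        -- substitution it transforms with the same coefficients A k i as the variable in the first
        -- component, so one linear combination of pairs serves for both.
        by_cases hi : J i
        · simp only [pairX, hi, if_true]
          rw [linSubst_comp_opD hBA']
          congr 1
          refine Finset.sum_congr rfl fun k _ => ?_
          rw [hB']
          by_cases hk : J k
          · simp [hk]
          · have h1 : A k i = 0 := by by_contra h; exact hk ((hA k i h).2 hi)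
            have h2 : B i k = 0 := by by_contra h; exact hk ((hB i k h).1 hi)
            simp [h1, h2]
        · simp only [pairX, hi, if_false]
          rw [linSubst_comp_opX]
          congr 1
          refine Finset.sum_congr rfl fun k _ => ?_
          rw [hA']
          by_cases hk : J k
          · have h1 : A k i = 0 := by by_contra h; exact hi ((hA k i h).1 hk)
            simp [h1, hi]
          · simp [hk, hi]
    · refine ⟨∑ k, B i k • pairD J k,
        sum_mem fun k _ => Subalgebra.smul_mem _ (pairD_mem J k) _, ?_⟩
      refine Prod.ext ?_ ?_
      · simp only [Prod.fst_mul, Prod.fst_sum, Prod.smul_fst]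
        exact linSubst_comp_opD hBA i
      · simp only [Prod.snd_mul, Prod.snd_sum, Prod.smul_snd]
        by_cases hi : J i
        · simp only [pairD, hi, if_true]
          rw [mul_smul_comm, linSubst_comp_opX, ← smul_mul_assoc, Finset.smul_sum]
          congr 1
          refine Finset.sum_congr rfl fun k _ => ?_
          rw [hA']
          by_cases hk : J k
          · simp only [hk, hi, if_true, smul_comm (-1 : ℂ)]
          · have h2 : B i k = 0 := by by_contra h; exact hk ((hB i k h).1 hi)
            simp [h2, hi]
        · simp only [pairD, hi, if_false]
          rw [linSubst_comp_opD hBA']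
          congr 1
          refine Finset.sum_congr rfl fun k _ => ?_
          rw [hB']
          by_cases hk : J k
          · have h1 : A k i = 0 := by by_contra h; exact hi ((hA k i h).1 hk)
            have h2 : B i k = 0 := by by_contra h; exact hi ((hB i k h).2 hk)
            simp [h1, h2]
          · simp [hk]
  | algebraMap r => exact ⟨_, Subalgebra.algebraMap_mem _ r, (Algebra.commutes r _).symm⟩
  | add a b _ _ ha hb =>
    obtain ⟨a', ha', h1⟩ := ha
    obtain ⟨b', hb', h2⟩ := hb
    exact ⟨a' + b', add_mem ha' hb', by rw [mul_add, h1, h2, add_mul]⟩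
  | mul a b _ _ ha hb =>
    obtain ⟨a', ha', h1⟩ := ha
    obtain ⟨b', hb', h2⟩ := hb
    exact ⟨a' * b', mul_mem ha' hb', by rw [← mul_assoc, h1, mul_assoc, h2, mul_assoc]⟩

/-- The Euler operators commute with the first component of an element of the graph of the partial
Fourier transform if they commute with its second component. -/
theorem euler_comm_fst {K : Type*} [DecidableEq K] (JK : K → Prop) [DecidablePred JK] (π : I → K)
    {w : Module.End ℂ (MvPolynomial I ℂ) × Module.End ℂ (MvPolynomial I ℂ)}
    (hw : w ∈ weylPairs fun i => JK (π i)) (p : K)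
    (h : euler π p * w.2 = w.2 * euler π p) : euler π p * w.1 = w.1 * euler π p := by
  set J : I → Prop := fun i => JK (π i)
  -- The pair whose first component is the Euler operator of block p.
  let ε := ∑ i with π i = p, pairX J i * pairD J i
  have hε : ε ∈ weylPairs J := sum_mem fun i _ => mul_mem (pairX_mem J i) (pairD_mem J i)
  have h1 : ε.1 = euler π p := by
    simp only [ε, Prod.fst_sum]
    rfl
  have h2 : ε.2 * w.2 = w.2 * ε.2 := by
    -- On a flipped block x∂ becomes -∂x = -(x∂ + 1): up to sign, the Euler operator shifted by the
    -- number of variables. The shift is scalar and does not affect commutation.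
    by_cases hp : JK p
    · have : ε.2 = (-1 : ℂ) • (euler π p + ∑ i with π i = p, 1) := by
        simp only [ε, Prod.snd_sum, euler, Prod.snd_mul, ← Finset.sum_add_distrib,
          Finset.smul_sum]
        refine Finset.sum_congr rfl fun i hi => ?_
        have hi' : J i := by
          simp only [Finset.mem_filter] at hi
          simp only [J, hi.2, hp]
        have h3 := opD_mul_opX i i
        rw [if_pos rfl] at h3
        simp only [pairX, pairD, hi', if_true, mul_smul_comm, h3]
      rw [this, smul_mul_assoc, mul_smul_comm, add_mul, mul_add, h, Finset.sum_const, nsmul_eq_mul, mul_one,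
        Nat.cast_comm]
    · have : ε.2 = euler π p := by
        simp only [ε, Prod.snd_sum, euler, Prod.snd_mul]
        refine Finset.sum_congr rfl fun i hi => ?_
        have hi' : ¬ J i := by
          simp only [Finset.mem_filter] at hi
          simp only [J, hi.2, hp, not_false_eq_true]
        simp only [pairX, pairD, hi', if_false]
      rw [this, h]
  have h3 : ε * w - w * ε = 0 := weylPairs_eq_zero_of_snd
    (sub_mem (mul_mem hε hw) (mul_mem hw hε)) (by
      rw [Prod.snd_sub, Prod.snd_mul, Prod.snd_mul, h2, sub_self])
  have h4 := congrArg Prod.fst h3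
  rw [Prod.fst_sub, Prod.fst_mul, Prod.fst_mul, h1, Prod.fst_zero, sub_eq_zero] at h4
  exact h4

end WeylPairs

/-! ### Matrices of operators acting on vector valued functions -/

section MatrixOperators

variable {m : Type*} [Fintype m] {S : Type*} [AddCommGroup S] [Module ℂ S]

/-- The operator on column vectors given by a matrix of operators. -/
noncomputable def opMat (F : Matrix m m (Module.End ℂ S)) : (m → S) →ₗ[ℂ] (m → S) :=
  LinearMap.pi fun α => ∑ β, F α β ∘ₗ LinearMap.proj β

theorem opMat_apply (F : Matrix m m (Module.End ℂ S)) (v : m → S) (α : m) :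
    opMat F v α = ∑ β, F α β (v β) := by
  simp [opMat, LinearMap.sum_apply]

theorem opMat_mul (F H : Matrix m m (Module.End ℂ S)) : opMat (F * H) = opMat F ∘ₗ opMat H := by
  refine LinearMap.ext fun v => funext fun α => ?_
  simp only [LinearMap.comp_apply, opMat_apply, Matrix.mul_apply, LinearMap.sum_apply,
    Module.End.mul_apply, map_sum]
  exact Finset.sum_comm

theorem opMat_single [DecidableEq m] (F : Matrix m m (Module.End ℂ S)) (γ : m) (x : S) (α : m) :
    opMat F (Pi.single γ x) α = F α γ x := by
  rw [opMat_apply, Finset.sum_eq_single γ]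
  · rw [Pi.single_eq_same]
  · intro β _ h
    rw [Pi.single_eq_of_ne h, map_zero]
  · simp

theorem opMat_injective : Function.Injective (opMat (m := m) (S := S)) := by
  classical
  intro F H h
  refine Matrix.ext fun α β => LinearMap.ext fun x => ?_
  rw [← opMat_single F, ← opMat_single H, h]

/-- The operator matrix `a ⊗ s`. -/
def scaleMat (a : Matrix m m ℂ) {W : Type*} [SMul ℂ W] (s : W) : Matrix m m W :=
  Matrix.of fun α β => a α β • s

/-- The operator `a ⊗ s` on column vectors. -/
noncomputable def tensorAct (a : Matrix m m ℂ) (s : Module.End ℂ S) : (m → S) →ₗ[ℂ] (m → S) :=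
  opMat (scaleMat a s)

theorem tensorAct_apply (a : Matrix m m ℂ) (s : Module.End ℂ S) (v : m → S) (α : m) :
    tensorAct a s v α = ∑ β, a α β • s (v β) := by
  simp [tensorAct, opMat_apply, scaleMat]

end MatrixOperators

/-! ### Even part: transferring commutativity by the partial Fourier transform -/

section PartialFourier

open MvPolynomial

variable {I K m : Type*} [Fintype I] [DecidableEq I] [DecidableEq K] [Fintype m] [DecidableEq m]

theorem exists_homogeneousOps_matrix (π : I → K) (d : K → ℕ)
    (f : (m → MvPolynomial I ℂ) →ₗ[ℂ] (m → MvPolynomial I ℂ)) :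
    ∃ F : Matrix m m (Module.End ℂ (MvPolynomial I ℂ)), (∀ α β, F α β ∈ homogeneousOps π d) ∧
      ∀ v ∈ Submodule.pi Set.univ (fun _ : m => blockHomogeneous π d), opMat F v = f v := by
  choose F hF hF' using fun α β : m => exists_homogeneousOps_eqOn π d
    (LinearMap.proj α ∘ₗ f ∘ₗ LinearMap.single ℂ (fun _ : m => MvPolynomial I ℂ) β)
  refine ⟨Matrix.of F, hF, fun v hv => funext fun α => ?_⟩
  conv_rhs => rw [← Finset.univ_sum_single v, map_sum, Finset.sum_apply]
  rw [opMat_apply]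
  exact Finset.sum_congr rfl fun β _ => hF' α β _ (hv β trivial)

/-- If the equivariant endomorphisms of the homogeneous vector valued polynomials commute for a
block diagonal action on the variables, then the same holds for the action that is
obtained by passing to the contragredient action on some of the blocks. -/
theorem commOn_of_contragredient {G : Type*} [Group G] (π : I → K) (JK : K → Prop)
    [DecidablePred JK] (R R' : G →* Matrix I I ℂ) (a : G → Matrix m m ℂ)
    (hR : ∀ g i j, π i ≠ π j → R g i j = 0)
    (hR' : ∀ g i j, R' g i j = if JK (π j) then R g⁻¹ j i else R g i j)
    (h : ∀ d, CommOn (fun g => tensorAct (a g) (linSubst (R g)).toLinearMap)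
      (Submodule.pi Set.univ (fun _ : m => blockHomogeneous π d))) (d : K → ℕ) :
    CommOn (fun g => tensorAct (a g) (linSubst (R' g)).toLinearMap)
      (Submodule.pi Set.univ (fun _ : m => blockHomogeneous π d)) := by
  have hRinv : ∀ g, R g⁻¹ * R g = 1 := fun g => by rw [← map_mul, inv_mul_cancel, map_one]
  have hRinv' : ∀ g, R' g⁻¹ * R' g = 1 := fun g => by rw [← map_mul, inv_mul_cancel, map_one]
  have hR'b : ∀ g i j, π i ≠ π j → R' g i j = 0 := by
    intro g i j hij
    rw [hR', hR g i j hij, hR g⁻¹ j i hij.symm, ite_self]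
  have hblock : ∀ g i j, R g i j ≠ 0 → (JK (π i) ↔ JK (π j)) := by
    intro g i j hij
    by_cases hp : π i = π j
    · rw [hp]
    · exact absurd (hR g i j hp) hij
  have hsurj : ∀ g (f : MvPolynomial I ℂ), linSubst (R' g) (linSubst (R' g⁻¹) f) = f := by
    intro g f
    rw [← AlgHom.comp_apply, ← linSubst_mul, ← map_mul, mul_inv_cancel, map_one, linSubst_one]
    rfl
  have hsurj₁ : ∀ g (f : MvPolynomial I ℂ), linSubst (R g) (linSubst (R g⁻¹) f) = f := by
    intro g f
    rw [← AlgHom.comp_apply, ← linSubst_mul, ← map_mul, mul_inv_cancel, map_one, linSubst_one]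
    rfl
  let c : G → Module.End ℂ (MvPolynomial I ℂ) × Module.End ℂ (MvPolynomial I ℂ) := fun g =>
    ((linSubst (R g)).toLinearMap, (linSubst (R' g)).toLinearMap)
  have hconj : ∀ g, ∀ w ∈ weylPairs (fun i => JK (π i)),
      ∃ w' ∈ weylPairs (fun i => JK (π i)), c g * w = w' * c g := fun g w hw =>
    exists_weylPairs_conj (hRinv g) (hRinv' g) (hblock g) (hblock g⁻¹) (hR' g)
      (fun i j => by rw [hR', inv_inv]) hw
  -- An endomorphism on the R'-side in the single multidegree d is transformed into an R-equivariant
  -- operator that acts on, and preserves, all multidegrees.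
  have key : ∀ f : (m → MvPolynomial I ℂ) →ₗ[ℂ] (m → MvPolynomial I ℂ),
      (∀ v ∈ Submodule.pi Set.univ (fun _ : m => blockHomogeneous π d),
        f v ∈ Submodule.pi Set.univ (fun _ : m => blockHomogeneous π d)) →
      (∀ g, ∀ v ∈ Submodule.pi Set.univ (fun _ : m => blockHomogeneous π d),
        f (tensorAct (a g) (linSubst (R' g)).toLinearMap v)
          = tensorAct (a g) (linSubst (R' g)).toLinearMap (f v)) →
      ∃ w : Matrix m m (Module.End ℂ (MvPolynomial I ℂ) × Module.End ℂ (MvPolynomial I ℂ)),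
        (∀ α β, w α β ∈ weylPairs (fun i => JK (π i))) ∧
        (∀ v ∈ Submodule.pi Set.univ (fun _ : m => blockHomogeneous π d),
          opMat (w.map Prod.snd) v = f v) ∧
        (∀ e, ∀ v ∈ Submodule.pi Set.univ (fun _ : m => blockHomogeneous π e),
          opMat (w.map Prod.fst) v ∈ Submodule.pi Set.univ (fun _ : m => blockHomogeneous π e)) ∧
        (∀ g v, opMat (w.map Prod.fst) (tensorAct (a g) (linSubst (R g)).toLinearMap v)
          = tensorAct (a g) (linSubst (R g)).toLinearMap (opMat (w.map Prod.fst) v)) := by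
    intro f hf hfe
    obtain ⟨F, hF, hFf⟩ := exists_homogeneousOps_matrix π d f
    choose w hw hwF using fun α β => exists_weylPairs_snd (fun i => JK (π i))
      (homogeneousOps_le_adjoin π d (hF α β))
    have hsingle : ∀ β, ∀ x ∈ blockHomogeneous π d,
        (Pi.single β x : m → MvPolynomial I ℂ) ∈
          Submodule.pi Set.univ (fun _ : m => blockHomogeneous π d) := by
      intro β x hx γ _
      by_cases hγ : γ = β
      · subst hγ; rw [Pi.single_eq_same]; exact hx
      · rw [Pi.single_eq_of_ne hγ]; exact Submodule.zero_mem _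
    have hFpres : ∀ α β, ∀ x ∈ blockHomogeneous π d, F α β x ∈ blockHomogeneous π d := by
      intro α β x hx
      rw [← opMat_single F, hFf _ (hsingle β x hx)]
      exact hf _ (hsingle β x hx) α trivial
    refine ⟨Matrix.of w, hw, ?_, ?_, ?_⟩
    · intro v hv
      rw [← hFf v hv]
      congr 2
      exact Matrix.ext fun α β => hwF α β
    · intro e v hv α _
      rw [opMat_apply]
      refine Submodule.sum_mem _ fun β _ => ?_
      rw [mem_blockHomogeneous]
      intro p
      -- F preserves multidegree d, so it commutes with the Euler operators; the transform keeps
      -- this, and w.1 preserves every multidegree.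
      have h1 := euler_comm_fst JK π (hw α β) p (by
        rw [hwF]
        exact euler_comm_of_homogeneousOps (hF α β) (hFpres α β) p)
      have h2 := LinearMap.congr_fun h1 (v β)
      rw [Module.End.mul_apply, Module.End.mul_apply, mem_blockHomogeneous.1 (hv β trivial) p,
        map_smul] at h2
      exact h2
    · intro g v
      -- Equivariance is an identity in the algebra of pairs. Its second component involves
      -- operators of multidegree d and is checked on that component; faithfulness of the second
      -- projection then gives the whole identity, whose first component is the equivariance under
      -- R.
      have hcomm : ∀ α γ, ∑ β, a g β γ • w α β * c g = ∑ β, a g α β • (c g * w β γ) := by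
        intro α γ
        choose w' hw' hww' using fun β => hconj g (w β γ) (hw β γ)
        choose F' hF' hFF' using fun β => exists_homogeneousOps_conj (hRinv' g)
          (fun i j => hR'b g⁻¹ i j) (hF β γ)
        have h1 : ∀ β, (w' β).2 = F' β := by
          intro β
          have h2 := congrArg Prod.snd (hww' β)
          rw [Prod.snd_mul, Prod.snd_mul, hwF] at h2
          have h3 := h2.symm.trans (hFF' β)
          refine LinearMap.ext fun x => ?_
          have h4 := LinearMap.congr_fun h3 (linSubst (R' g⁻¹) x)
          simpa only [Module.End.mul_apply, c, AlgHom.toLinearMap_apply, hsurj] using h4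
        have h5 : ∑ β, a g β γ • F α β - ∑ β, a g α β • F' β = 0 := by
          refine homogeneousOps_eq_zero (π := π) (d := d) (Submodule.sub_mem _
            (Submodule.sum_mem _ fun β _ => Submodule.smul_mem _ _ (hF α β))
            (Submodule.sum_mem _ fun β _ => Submodule.smul_mem _ _ (hF' β))) fun x hx => ?_
          have hy : linSubst (R' g⁻¹) x ∈ blockHomogeneous π d :=
            linSubst_mem_blockHomogeneous (hR'b g⁻¹) hx
          have h6 := congrFun (hfe g _ (hsingle γ _ hy)) α
          rw [← hFf _ (hsingle γ _ hy), ← hFf] at h6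
          · rw [tensorAct_apply] at h6
            simp only [opMat_single] at h6
            rw [opMat_apply] at h6
            simp only [tensorAct, opMat_single, scaleMat, Matrix.of_apply, LinearMap.smul_apply,
              AlgHom.toLinearMap_apply, hsurj, map_smul] at h6
            simp only [LinearMap.sub_apply, LinearMap.sum_apply, LinearMap.smul_apply]
            rw [h6, sub_eq_zero]
            refine Finset.sum_congr rfl fun β _ => ?_
            have h7 := LinearMap.congr_fun (hFF' β) (linSubst (R' g⁻¹) x)
            simp only [Module.End.mul_apply, AlgHom.toLinearMap_apply, hsurj] at h7
            rw [h7]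
          · intro β _
            rw [tensorAct, opMat_single]
            simp only [scaleMat, Matrix.of_apply, LinearMap.smul_apply,
              AlgHom.toLinearMap_apply, hsurj]
            exact Submodule.smul_mem _ _ hx
        have h8 : ∑ β, a g β γ • w α β - ∑ β, a g α β • w' β = 0 := by
          refine weylPairs_eq_zero_of_snd (J := fun i => JK (π i)) (sub_mem
            (sum_mem fun β _ => Subalgebra.smul_mem _ (hw α β) _)
            (sum_mem fun β _ => Subalgebra.smul_mem _ (hw' β) _)) ?_
          rw [← h5]
          simp only [Prod.snd_sub, Prod.snd_sum, Prod.smul_snd, hwF, h1]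
        rw [sub_eq_zero] at h8
        rw [← Finset.sum_mul, h8, Finset.sum_mul]
        refine Finset.sum_congr rfl fun β _ => ?_
        rw [hww', smul_mul_assoc]
      have hmat : (Matrix.of w).map Prod.fst * scaleMat (a g) (linSubst (R g)).toLinearMap
          = scaleMat (a g) (linSubst (R g)).toLinearMap * (Matrix.of w).map Prod.fst := by
        refine Matrix.ext fun α γ => ?_
        have := congrArg Prod.fst (hcomm α γ)
        simp only [Prod.fst_sum, Prod.smul_fst, Prod.fst_mul, c] at this
        simp only [Matrix.mul_apply, scaleMat, Matrix.map_apply, Matrix.of_apply,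
          smul_mul_assoc, mul_smul_comm]
        simpa only [smul_mul_assoc] using this
      rw [tensorAct, ← LinearMap.comp_apply, ← opMat_mul, hmat, opMat_mul, LinearMap.comp_apply]
  intro f k hf hk hfe hke v hv
  obtain ⟨w, hw, hwf, hwp, hwe⟩ := key f hf hfe
  obtain ⟨u, hu, huk, hup, hue⟩ := key k hk hke
  -- The hypothesis is used in every multidegree, not only d: each monomial lies in some component,
  -- and the transformed operators commute there.
  have h1 : (w * u - u * w).map Prod.fst = 0 := by
    have h2 : ∀ s t : Matrix m m (Module.End ℂ (MvPolynomial I ℂ) × Module.End ℂ (MvPolynomial I ℂ)),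
        (s * t).map Prod.fst = s.map Prod.fst * t.map Prod.fst := by
      intro s t
      exact Matrix.map_mul (f := RingHom.fst _ _)
    rw [Matrix.map_sub _ (fun _ _ => rfl), h2, h2, sub_eq_zero]
    refine opMat_injective (LinearMap.pi_ext' fun β => MvPolynomial.linearMap_ext fun c =>
      LinearMap.ext_ring ?_)
    simp only [LinearMap.comp_apply, opMat_mul]
    refine h (Finsupp.weight (blockWeight π) c) _ _ (hwp _) (hup _) (fun g v _ => hwe g v)
      (fun g v _ => hue g v) _ ?_
    intro γ _
    by_cases hγ : γ = β
    · subst hγ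
      simp only [LinearMap.coe_single, Pi.single_eq_same]
      exact monomial_mem_blockHomogeneous rfl 1
    · simp only [LinearMap.coe_single, Pi.single_eq_of_ne hγ]
      exact Submodule.zero_mem _
  -- Faithfulness of the first projection lifts the commutation to pairs, and the second projection
  -- brings it back to f and k.
  have h3 : w * u - u * w = 0 := by
    refine Matrix.ext fun α β => ?_
    refine weylPairs_eq_zero_of_fst (J := fun i => JK (π i)) ?_ (congrFun (congrFun h1 α) β)
    rw [Matrix.sub_apply, Matrix.mul_apply, Matrix.mul_apply]
    exact sub_mem (sum_mem fun _ _ => mul_mem (hw _ _) (hu _ _))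
      (sum_mem fun _ _ => mul_mem (hu _ _) (hw _ _))
  have h4 : w.map Prod.snd * u.map Prod.snd = u.map Prod.snd * w.map Prod.snd := by
    have h2 : ∀ s t : Matrix m m (Module.End ℂ (MvPolynomial I ℂ) × Module.End ℂ (MvPolynomial I ℂ)),
        (s * t).map Prod.snd = s.map Prod.snd * t.map Prod.snd := by
      intro s t
      exact Matrix.map_mul (f := RingHom.snd _ _)
    rw [← h2, ← h2, sub_eq_zero.1 h3]
  rw [← huk v hv, ← hwf v hv, ← hwf _ (huk v hv ▸ hk v hv), ← huk _ (hwf v hv ▸ hf v hv),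
    ← LinearMap.comp_apply, ← opMat_mul, h4, opMat_mul, LinearMap.comp_apply]

end PartialFourier
end SuperMF

namespace SuperMF

/-! ### The partial Hodge star operator -/

section Star

open ExteriorAlgebra CliffordAlgebra

variable {I X X' : Type*} [AddCommGroup X] [Module ℂ X] [AddCommGroup X'] [Module ℂ X']

theorem contractLeft_ι_mul_ext (φ : Module.Dual ℂ X) (v : X) (x : ExteriorAlgebra ℂ X) :
    contractLeft φ (ExteriorAlgebra.ι ℂ v * x)
      = φ v • x - ExteriorAlgebra.ι ℂ v * contractLeft φ x :=
  contractLeft_ι_mul (Q := (0 : QuadraticForm ℂ X)) φ v x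

theorem ι_mul_ι_mul_swap (v w : X) (x : ExteriorAlgebra ℂ X) :
    ExteriorAlgebra.ι ℂ v * (ExteriorAlgebra.ι ℂ w * x)
      = -(ExteriorAlgebra.ι ℂ w * (ExteriorAlgebra.ι ℂ v * x)) := by
  rw [← mul_assoc, ← mul_assoc, ← neg_mul, eq_neg_of_add_eq_zero_left
    (ExteriorAlgebra.ι_add_mul_swap v w)]

/-- Exterior multiplication by a basis vector outside `J`, contraction with a dual basis vector
inside `J`. -/
noncomputable def starGen (b : Module.Basis I ℂ X) (J : I → Prop) [DecidablePred J] (i : I) :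
    ExteriorAlgebra ℂ X →ₗ[ℂ] ExteriorAlgebra ℂ X :=
  if J i then contractLeft (b.coord i) else LinearMap.mulLeft ℂ (ExteriorAlgebra.ι ℂ (b i))

variable (b : Module.Basis I ℂ X) (b' : Module.Basis I ℂ X') (J : I → Prop) [DecidablePred J]

theorem starGen_of_mem {i : I} (h : J i) (x : ExteriorAlgebra ℂ X) :
    starGen b J i x = contractLeft (b.coord i) x := by
  simp [starGen, h]

theorem starGen_of_notMem {i : I} (h : ¬ J i) (x : ExteriorAlgebra ℂ X) :
    starGen b J i x = ExteriorAlgebra.ι ℂ (b i) * x := by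
  simp [starGen, h]

/-- Exterior multiplications anticommute, contractions anticommute, and b_i ∧ anticommutes with
contraction by b_j* for i ≠ j. The dual pair b_i ∧ and b_i* never occurs together, since each index
is used in one way only. -/
theorem starGen_anticomm (i j : I) (x : ExteriorAlgebra ℂ X) :
    starGen b J i (starGen b J j x) + starGen b J j (starGen b J i x) = 0 := by
  classical
  by_cases hi : J i <;> by_cases hj : J j
  · rw [starGen_of_mem b J hi, starGen_of_mem b J hj, starGen_of_mem b J hj,
      starGen_of_mem b J hi, contractLeft_comm, neg_add_cancel]
  · rw [starGen_of_mem b J hi, starGen_of_notMem b J hj, starGen_of_notMem b J hj,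
      starGen_of_mem b J hi, contractLeft_ι_mul_ext, Module.Basis.coord_apply,
      Module.Basis.repr_self, Finsupp.single_eq_of_ne (by rintro rfl; exact hj hi), zero_smul,
      zero_sub, neg_add_cancel]
  · rw [starGen_of_notMem b J hi, starGen_of_mem b J hj, starGen_of_mem b J hj,
      starGen_of_notMem b J hi, contractLeft_ι_mul_ext, Module.Basis.coord_apply,
      Module.Basis.repr_self, Finsupp.single_eq_of_ne (by rintro rfl; exact hi hj), zero_smul,
      zero_sub, add_neg_cancel]
  · rw [starGen_of_notMem b J hi, starGen_of_notMem b J hj, starGen_of_notMem b J hj,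
      starGen_of_notMem b J hi, ι_mul_ι_mul_swap, neg_add_cancel]

/-- The Clifford action of `X'` on `⋀(X)` behind the partial Hodge star operator. -/
noncomputable def starAct : X' →ₗ[ℂ] ExteriorAlgebra ℂ X →ₗ[ℂ] ExteriorAlgebra ℂ X :=
  b'.constr ℂ (starGen b J)

theorem starAct_basis (i : I) : starAct b b' J (b' i) = starGen b J i :=
  Module.Basis.constr_basis _ _ _ _

theorem starAct_anticomm (v w : X') (x : ExteriorAlgebra ℂ X) :
    starAct b b' J v (starAct b b' J w x) + starAct b b' J w (starAct b b' J v x) = 0 := by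
  have h : ∀ x, (LinearMap.compr₂ (LinearMap.mk₂ ℂ (fun v w : X' => (starAct b b' J v) ∘ₗ
      (starAct b b' J w) + (starAct b b' J w) ∘ₗ (starAct b b' J v))
      (fun v v' w => by simp only [map_add, LinearMap.add_comp, LinearMap.comp_add]; abel)
      (fun r v w => by
        simp only [map_smul, LinearMap.smul_comp, LinearMap.comp_smul, smul_add])
      (fun v w w' => by simp only [map_add, LinearMap.add_comp, LinearMap.comp_add]; abel)
      (fun r v w => by
        simp only [map_smul, LinearMap.smul_comp, LinearMap.comp_smul, smul_add]))
      (LinearMap.applyₗ x)) = 0 := fun x => b'.ext fun i => b'.ext fun j => by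
    simpa [starAct_basis] using starGen_anticomm b J i j x
  simpa using LinearMap.congr_fun₂ (h x) v w

/-- Anticommutativity with v = w makes the square zero. This is the Clifford relation for the zero
form, so the action extends to the exterior algebra of X'. -/
theorem starAct_starAct (v : X') (x : ExteriorAlgebra ℂ X) :
    starAct b b' J v (starAct b b' J v x) = (0 : QuadraticForm ℂ X') v • x := by
  have h := starAct_anticomm b b' J v v x
  rw [← two_smul ℂ, smul_eq_zero] at h
  simpa using h

/-- The partial Hodge star operator with a given value at `1`. -/
noncomputable def star (y : ExteriorAlgebra ℂ X) : ExteriorAlgebra ℂ X' →ₗ[ℂ] ExteriorAlgebra ℂ X :=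
  foldr _ (starAct b b' J) (starAct_starAct b b' J) y

theorem star_algebraMap (y : ExteriorAlgebra ℂ X) (r : ℂ) :
    star b b' J y (algebraMap ℂ _ r) = r • y :=
  foldr_algebraMap _ _ _ _ _

theorem star_ι_mul (y : ExteriorAlgebra ℂ X) (v : X') (x : ExteriorAlgebra ℂ X') :
    star b b' J y (ExteriorAlgebra.ι ℂ v * x) = starAct b b' J v (star b b' J y x) := by
  unfold star
  rw [show ExteriorAlgebra.ι ℂ v = CliffordAlgebra.ι 0 v from rfl, foldr_mul, foldr_ι]

theorem star_basis_mul (y : ExteriorAlgebra ℂ X) (i : I) (x : ExteriorAlgebra ℂ X') :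
    star b b' J y (ExteriorAlgebra.ι ℂ (b' i) * x) = starGen b J i (star b b' J y x) := by
  rw [star_ι_mul, starAct_basis]

/-- Induction on left multiplication by basis vectors. -/
theorem exteriorAlgebra_induction {P : ExteriorAlgebra ℂ X → Prop}
    (scalar : ∀ r : ℂ, P (algebraMap _ _ r)) (add : ∀ x y, P x → P y → P (x + y))
    (smul : ∀ (r : ℂ) x, P x → P (r • x))
    (mul : ∀ i x, P x → P (ExteriorAlgebra.ι ℂ (b i) * x)) (x : ExteriorAlgebra ℂ X) : P x := by
  induction x using CliffordAlgebra.left_induction with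
  | algebraMap r => exact scalar r
  | add x y hx hy => exact add x y hx hy
  | ι_mul x m hx =>
    have h := b.mem_span m
    change P (ExteriorAlgebra.ι ℂ m * x)
    induction h using Submodule.span_induction with
    | mem m hm => obtain ⟨i, rfl⟩ := hm; exact mul i x hx
    | zero => rw [map_zero, zero_mul, ← map_zero (algebraMap ℂ _)]; exact scalar 0
    | add m m' _ _ h h' => rw [map_add, add_mul]; exact add _ _ h h'
    | smul r m _ h => rw [map_smul, smul_mul_assoc]; exact smul _ _ h

/-- The wedge product of the basis vectors in a list. -/
noncomputable def listWedge (l : List I) : ExteriorAlgebra ℂ X :=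
  (l.map fun i => ExteriorAlgebra.ι ℂ (b i)).prod

theorem listWedge_cons (i : I) (l : List I) :
    listWedge b (i :: l) = ExteriorAlgebra.ι ℂ (b i) * listWedge b l := by
  simp [listWedge]

theorem listWedge_concat (l : List I) (i : I) :
    listWedge b (l ++ [i]) = listWedge b l * ExteriorAlgebra.ι ℂ (b i) := by
  simp [listWedge]

theorem ι_mul_listWedge {i : I} {l : List I} (h : i ∈ l) :
    ExteriorAlgebra.ι ℂ (b i) * listWedge b l = 0 := by
  induction l with
  | nil => simp at h
  | cons j l ih =>
    rw [listWedge_cons]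
    by_cases hij : i = j
    · subst hij
      rw [← mul_assoc, ExteriorAlgebra.ι_sq_zero, zero_mul]
    · rw [ι_mul_ι_mul_swap, ih ((List.mem_cons.1 h).resolve_left hij), mul_zero, neg_zero]

theorem contractLeft_listWedge {i : I} {l : List I} (h : i ∉ l) :
    contractLeft (b.coord i) (listWedge b l) = 0 := by
  classical
  induction l with
  | nil => simp [listWedge]
  | cons j l ih =>
    rw [List.mem_cons, not_or] at h
    rw [listWedge_cons, contractLeft_ι_mul_ext, ih h.2, Module.Basis.coord_apply,
      Module.Basis.repr_self, Finsupp.single_eq_of_ne h.1, zero_smul, mul_zero, sub_zero]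

/-- The star operator takes exterior multiplications to contractions and conversely on `J`. -/
theorem star_contractLeft {l : List I} (hl : ∀ i, i ∈ l ↔ J i) (i : I) (y : ExteriorAlgebra ℂ X') :
    star b b' J (listWedge b l) (contractLeft (b'.coord i) y)
      = if J i then ExteriorAlgebra.ι ℂ (b i) * star b b' J (listWedge b l) y
        else contractLeft (b.coord i) (star b b' J (listWedge b l) y) := by
  classical
  induction y using exteriorAlgebra_induction b' with
  | scalar r =>
    rw [contractLeft_algebraMap, map_zero, star_algebraMap]
    split_ifs with hi
    · rw [mul_smul_comm, ι_mul_listWedge b ((hl i).2 hi), smul_zero]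
    · rw [map_smul, contractLeft_listWedge b (fun h => hi ((hl i).1 h)), smul_zero]
  | add x y hx hy =>
    rw [map_add, map_add, map_add, hx, hy]
    split_ifs
    · rw [mul_add]
    · rw [map_add]
  | smul r x hx =>
    rw [map_smul, map_smul, map_smul, hx]
    split_ifs
    · rw [mul_smul_comm]
    · rw [map_smul]
  | mul j x hx =>
    rw [contractLeft_ι_mul_ext, map_sub, map_smul, star_basis_mul, star_basis_mul, hx,
      Module.Basis.coord_apply, Module.Basis.repr_self]
    by_cases hi : J i <;> by_cases hj : J j <;>
      simp only [hi, hj, if_true, if_false, starGen_of_mem b J, starGen_of_notMem b J,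
        not_true_eq_false, not_false_eq_true, contractLeft_ι_mul_ext, Module.Basis.coord_apply,
        Module.Basis.repr_self]
    · rw [Finsupp.single_apply, Finsupp.single_apply]
      simp only [eq_comm]
      abel
    · rw [Finsupp.single_eq_of_ne (by rintro rfl; exact hj hi), zero_smul, zero_sub,
        ι_mul_ι_mul_swap]
      simp
    · rw [Finsupp.single_eq_of_ne (by rintro rfl; exact hi hj), zero_smul, zero_sub,
        contractLeft_comm]
      simp

theorem star_ι_mul_basis_symm {l : List I} (hl : ∀ i, i ∈ l ↔ J i) (i : I)
    (y : ExteriorAlgebra ℂ X) :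
    star b' b J (listWedge b' l) (starGen b J i y)
      = ExteriorAlgebra.ι ℂ (b' i) * star b' b J (listWedge b' l) y := by
  by_cases hi : J i
  · rw [starGen_of_mem b J hi, star_contractLeft b' b J hl, if_pos hi]
  · rw [starGen_of_notMem b J hi, star_basis_mul, starGen_of_notMem b' J hi]

/-- The factors act from the right, so in the reversed list the head of l contracts first and the
volume element is stripped down to 1 without signs. -/
theorem star_listWedge_reverse {l : List I} (hl : l.Nodup) (hlJ : ∀ i ∈ l, J i) :
    star b b' J (listWedge b l) (listWedge b' l.reverse) = 1 := by
  induction l with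
  | nil =>
    rw [listWedge, List.map_nil, List.prod_nil, listWedge, List.reverse_nil, List.map_nil,
      List.prod_nil, ← map_one (algebraMap ℂ (ExteriorAlgebra ℂ X')), star_algebraMap, one_smul]
  | cons i l ih =>
    have hi : i ∉ l := (List.nodup_cons.1 hl).1
    have h1 : starAct b b' J (b' i) (listWedge b (i :: l)) = listWedge b l := by
      rw [starAct_basis, starGen_of_mem b J (hlJ i List.mem_cons_self), listWedge_cons,
        contractLeft_ι_mul_ext, contractLeft_listWedge b hi, mul_zero, sub_zero,
        Module.Basis.coord_apply, Module.Basis.repr_self, Finsupp.single_eq_same, one_smul]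
    rw [List.reverse_cons, listWedge_concat, ← ih (List.nodup_cons.1 hl).2
      fun j hj => hlJ j (List.mem_cons_of_mem _ hj)]
    conv_rhs => rw [← h1]
    unfold star
    rw [foldr_mul]
    congr 2
    exact foldr_ι _ _ _ _ _

/-- The composite commutes with exterior multiplication by basis vectors, so it is determined by its
value at 1. Choosing the reversed volume element for the inverse star makes that value 1. -/
theorem star_star {l : List I} (hl : l.Nodup) (hlJ : ∀ i, i ∈ l ↔ J i) (x : ExteriorAlgebra ℂ X') :
    star b' b J (listWedge b' l.reverse) (star b b' J (listWedge b l) x) = x := by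
  have hl' : ∀ i, i ∈ l.reverse ↔ J i := fun i => by rw [List.mem_reverse, hlJ]
  induction x using exteriorAlgebra_induction b' with
  | scalar r =>
    have h := star_listWedge_reverse b' b J (List.nodup_reverse.2 hl) fun i hi => (hl' i).1 hi
    rw [List.reverse_reverse] at h
    rw [star_algebraMap, map_smul, h, Algebra.algebraMap_eq_smul_one]
  | add x y hx hy => rw [map_add, map_add, hx, hy]
  | smul r x hx => rw [map_smul, map_smul, hx]
  | mul i x hx => rw [star_basis_mul, star_ι_mul_basis_symm b b' J hl', hx]

theorem contractLeft_map (T : X →ₗ[ℂ] X) (φ : Module.Dual ℂ X) (x : ExteriorAlgebra ℂ X) :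
    contractLeft φ (ExteriorAlgebra.map T x)
      = ExteriorAlgebra.map T (contractLeft (φ ∘ₗ T) x) := by
  induction x using CliffordAlgebra.left_induction with
  | algebraMap r => simp
  | add x y hx hy => simp only [map_add, hx, hy]
  | ι_mul x m hx =>
    change contractLeft φ (ExteriorAlgebra.map T (ExteriorAlgebra.ι ℂ m * x))
      = ExteriorAlgebra.map T (contractLeft (φ ∘ₗ T) (ExteriorAlgebra.ι ℂ m * x))
    rw [map_mul, ExteriorAlgebra.map_apply_ι, contractLeft_ι_mul_ext, contractLeft_ι_mul_ext, hx,
      map_sub, map_smul, map_mul, ExteriorAlgebra.map_apply_ι, LinearMap.comp_apply]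

/-- On flipped indices T' is contragredient to T, and contraction by b_i* is natural under the
inverse transpose; on the others both act alike. The only discrepancy is the value at 1, where T
scales the volume element by c. -/
theorem star_map [Fintype I] [DecidableEq I] {l : List I} {A A' B : Matrix I I ℂ} (hBA : B * A = 1)
    (hA : ∀ i j, A i j ≠ 0 → (J i ↔ J j)) (hB : ∀ i j, B i j ≠ 0 → (J i ↔ J j))
    (hA' : ∀ i j, A' i j = if J j then B j i else A i j)
    {T : X →ₗ[ℂ] X} {T' : X' →ₗ[ℂ] X'} (hT : ∀ i, T (b i) = ∑ k, A k i • b k)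
    (hT' : ∀ i, T' (b' i) = ∑ k, A' k i • b' k) {c : ℂ}
    (hc : ExteriorAlgebra.map T (listWedge b l) = c • listWedge b l) (x : ExteriorAlgebra ℂ X') :
    c • star b b' J (listWedge b l) (ExteriorAlgebra.map T' x)
      = ExteriorAlgebra.map T (star b b' J (listWedge b l) x) := by
  induction x using exteriorAlgebra_induction b' with
  | scalar r =>
    rw [AlgHom.commutes, star_algebraMap, map_smul, hc, smul_comm]
  | add x y hx hy => rw [map_add, map_add, map_add, map_add, smul_add, hx, hy]
  | smul r x hx => rw [map_smul, map_smul, map_smul, map_smul, smul_comm, hx]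
  | mul i x hx =>
    rw [map_mul, ExteriorAlgebra.map_apply_ι, star_ι_mul, ← map_smul, hx, hT', star_basis_mul,
      map_sum, LinearMap.sum_apply]
    simp only [map_smul, LinearMap.smul_apply, starAct_basis]
    by_cases hi : J i
    -- B is inverse to A, so the dual basis vector is the pullback along T of a combination with
    -- coefficients from B.
    · have h1 : b.coord i = (∑ k, B i k • b.coord k) ∘ₗ T := by
        refine b.ext fun j => ?_
        rw [LinearMap.comp_apply, hT, LinearMap.sum_apply]
        simp only [map_sum, map_smul, LinearMap.smul_apply, Module.Basis.coord_apply,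
          Module.Basis.repr_self, smul_eq_mul, Finsupp.single_apply, mul_ite, mul_one, mul_zero,
          Finset.sum_ite_eq', Finset.mem_univ, if_true]
        have h2 := congrFun (congrFun hBA i) j
        rw [Matrix.mul_apply, Matrix.one_apply] at h2
        simp only [mul_comm (A _ _), h2, eq_comm]
      rw [starGen_of_mem b J hi]
      conv_rhs => rw [h1]
      rw [← contractLeft_map, map_sum, LinearMap.sum_apply]
      refine Finset.sum_congr rfl fun k _ => ?_
      rw [hA', if_pos hi, map_smul, LinearMap.smul_apply]
      by_cases hk : J k
      · rw [starGen_of_mem b J hk]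
      · have : B i k = 0 := by by_contra h; exact hk ((hB i k h).1 hi)
        rw [this, zero_smul, zero_smul]
    · rw [starGen_of_notMem b J hi, map_mul, ExteriorAlgebra.map_apply_ι, hT, map_sum,
        Finset.sum_mul]
      refine Finset.sum_congr rfl fun k _ => ?_
      rw [hA', if_neg hi, map_smul, smul_mul_assoc]
      by_cases hk : J k
      · have : A k i = 0 := by by_contra h; exact hi ((hA k i h).1 hk)
        rw [this, zero_smul, zero_smul]
      · rw [starGen_of_notMem b J hk]

theorem listWedge_ne_zero {l : List I} (hl : l.Nodup) : listWedge b l ≠ 0 := by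
  classical
  intro h
  have h1 := star_listWedge_reverse b b (fun i => i ∈ l) hl fun i hi => hi
  have h2 := star_listWedge_reverse b b (fun i => i ∈ l) (l := l.reverse) (List.nodup_reverse.2 hl)
    fun i hi => List.mem_reverse.1 hi
  rw [List.reverse_reverse, h, map_zero] at h2
  exact zero_ne_one h2

/-- T preserves the span of the listed vectors and acts on its top exterior power by a determinant,
nonzero because T has a left inverse. -/
theorem exists_map_listWedge {l : List I} (hl : l.Nodup) {T S : X →ₗ[ℂ] X} (hST : S ∘ₗ T = .id)
    (hT : ∀ i ∈ l, T (b i) ∈ Submodule.span ℂ (b '' {j | j ∈ l})) :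
    ∃ c : ℂ, c ≠ 0 ∧ ExteriorAlgebra.map T (listWedge b l) = c • listWedge b l := by
  have hinj : Function.Injective l.get := List.nodup_iff_injective_get.1 hl
  have hr : Set.range (fun k => b (l.get k)) = b '' {j | j ∈ l} := by
    ext x
    simp only [Set.mem_range, Set.mem_image, Set.mem_ofPred_eq]
    constructor
    · rintro ⟨k, rfl⟩; exact ⟨_, l.get_mem k, rfl⟩
    · rintro ⟨i, hi, rfl⟩
      obtain ⟨k, rfl⟩ := List.get_of_mem hi
      exact ⟨k, rfl⟩
  let β := Module.Basis.span (b.linearIndependent.comp _ hinj)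
  have hvol : listWedge b l = ExteriorAlgebra.ιMulti ℂ l.length (fun k => b (l.get k)) := by
    rw [ExteriorAlgebra.ιMulti_apply, listWedge]
    congr 1
    exact List.ext_get (by simp) (by simp)
  let f := (ExteriorAlgebra.ιMulti ℂ l.length).compLinearMap
    (Submodule.span ℂ (Set.range (b ∘ l.get))).subtype
  have hβ : ∀ k, (β k : X) = b (l.get k) := fun k =>
    congrArg Subtype.val (Module.Basis.span_apply (b.linearIndependent.comp _ hinj) k)
  -- Top-degree alternating maps on this span are determined by their value on the basis.
  have hf : ∀ v, f v = β.det v • listWedge b l := by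
    intro v
    let h : (Submodule.span ℂ (Set.range (b ∘ l.get))) [⋀^Fin l.length]→ₗ[ℂ] ExteriorAlgebra ℂ X :=
      (LinearMap.toSpanSingleton ℂ _ (listWedge b l)).compAlternatingMap β.det
    suffices f = h by rw [this]; rfl
    refine β.ext_alternating fun i hi => ?_
    let σ : Equiv.Perm (Fin l.length) := Equiv.ofBijective i (Finite.injective_iff_bijective.1 hi)
    change f (β ∘ σ) = h (β ∘ σ)
    rw [AlternatingMap.map_perm, AlternatingMap.map_perm]
    congr 1
    simp only [f, h, AlternatingMap.compLinearMap_apply, LinearMap.compAlternatingMap_apply,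
      Module.Basis.det_self, LinearMap.toSpanSingleton_apply, one_smul, hvol]
    congr 1
    exact funext fun k => hβ k
  have hmem : ∀ k, T (b (l.get k)) ∈ Submodule.span ℂ (Set.range (b ∘ l.get)) := by
    intro k
    have := hT _ (l.get_mem k)
    rw [← hr] at this
    exact this
  have hTv : ExteriorAlgebra.map T (listWedge b l) = f fun k => ⟨T (b (l.get k)), hmem k⟩ := by
    rw [hvol, ExteriorAlgebra.map_apply_ιMulti]
    rfl
  refine ⟨_, ?_, hTv.trans (hf _)⟩
  intro h0
  have h1 : ExteriorAlgebra.map T (listWedge b l) = 0 := by rw [hTv, hf, h0, zero_smul]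
  have h2 : ExteriorAlgebra.map S (ExteriorAlgebra.map T (listWedge b l)) = listWedge b l := by
    rw [← AlgHom.comp_apply, ExteriorAlgebra.map_comp_map, hST, ExteriorAlgebra.map_id]
    rfl
  rw [h1, map_zero] at h2
  exact listWedge_ne_zero b hl h2.symm

end Star
end SuperMF

namespace SuperMF

/-! ### Odd part: the star operator on components of the exterior algebra -/

section ExtComponent

open ExteriorAlgebra CliffordAlgebra

variable {X : Type*} [AddCommGroup X] [Module ℂ X] {s : ℕ}

/-- Vectors anticommute, and subspaces ignore signs. So the order of the factors in a component is
immaterial, and a new factor can be inserted in its block. -/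
theorem map_ι_mul_comm (M N : Submodule ℂ X) :
    M.map (ExteriorAlgebra.ι ℂ) * N.map (ExteriorAlgebra.ι ℂ)
      = N.map (ExteriorAlgebra.ι ℂ) * M.map (ExteriorAlgebra.ι ℂ) := by
  have h : ∀ M N : Submodule ℂ X, M.map (ExteriorAlgebra.ι ℂ) * N.map (ExteriorAlgebra.ι ℂ)
      ≤ N.map (ExteriorAlgebra.ι ℂ) * M.map (ExteriorAlgebra.ι ℂ) := by
    intro M N
    rw [Submodule.mul_le]
    rintro _ ⟨v, hv, rfl⟩ _ ⟨w, hw, rfl⟩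
    rw [eq_neg_of_add_eq_zero_left (ExteriorAlgebra.ι_add_mul_swap v w)]
    exact Submodule.neg_mem _ (Submodule.mul_mem_mul ⟨w, hw, rfl⟩ ⟨v, hv, rfl⟩)
  exact le_antisymm (h M N) (h N M)

theorem mul_list_map_pow {A : Type*} [Monoid A] {ι : Type*} [DecidableEq ι] (a : ι → A)
    (ha : ∀ p q, a p * a q = a q * a p) (d : ι → ℕ) (p : ι) (L : List ι) (hL : L.Nodup)
    (hp : p ∈ L) : a p * (L.map fun q => a q ^ d q).prod
      = (L.map fun q => a q ^ (d + Pi.single p 1 : ι → ℕ) q).prod := by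
  induction L with
  | nil => simp at hp
  | cons q L ih =>
    rw [List.nodup_cons] at hL
    rw [List.map_cons, List.map_cons, List.prod_cons, List.prod_cons, ← mul_assoc]
    by_cases h : p = q
    · subst h
      rw [← pow_succ', Pi.add_apply, Pi.single_eq_same]
      congr 2
      refine List.map_congr_left fun r hr => ?_
      rw [Pi.add_apply, Pi.single_eq_of_ne (by rintro rfl; exact hL.1 hr), add_zero]
    · rw [((show Commute (a p) (a q) from ha p q).pow_right _).eq, mul_assoc,
        ih hL.2 ((List.mem_cons.1 hp).resolve_left h), Pi.add_apply,
        Pi.single_eq_of_ne (Ne.symm h), add_zero]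

theorem map_ι_mul_extComponent (U : Fin s → Submodule ℂ X) (d : Fin s → ℕ) (p : Fin s) :
    (U p).map (ExteriorAlgebra.ι ℂ) * extComponent U d = extComponent U (d + Pi.single p 1) := by
  unfold extComponent
  rw [List.ofFn_eq_map, List.ofFn_eq_map]
  exact mul_list_map_pow (fun q => (U q).map (ExteriorAlgebra.ι ℂ))
    (fun _ _ => map_ι_mul_comm _ _) d p _ (List.nodup_finRange s) (List.mem_finRange p)

theorem extComponent_zero (U : Fin s → Submodule ℂ X) : extComponent U 0 = 1 := by
  simp [extComponent]

/-- Induction on multi-indices. -/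
theorem multiIndex_induction {P : (Fin s → ℕ) → Prop} (zero : P 0)
    (add : ∀ d p, P d → P (d + Pi.single p 1)) (d : Fin s → ℕ) : P d := by
  induction h : ∑ q, d q generalizing d with
  | zero =>
    have : d = 0 := funext fun q => by
      simpa using (Finset.sum_eq_zero_iff.1 h) q (Finset.mem_univ q)
    rw [this]; exact zero
  | succ n ih =>
    obtain ⟨p, hp⟩ : ∃ p, d p ≠ 0 := by
      by_contra hne
      push Not at hne
      simp [hne] at h
    have h1 : d - Pi.single p 1 + Pi.single p 1 = d := by
      refine tsub_add_cancel_of_le fun q => ?_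
      by_cases hq : q = p
      · subst hq; rw [Pi.single_eq_same]; exact Nat.one_le_iff_ne_zero.2 hp
      · rw [Pi.single_eq_of_ne hq]; exact Nat.zero_le _
    rw [← h1]
    refine add _ _ (ih _ ?_)
    have h2 : ∑ q, (d - Pi.single p 1 + Pi.single p 1 : Fin s → ℕ) q = n + 1 := by rw [h1, h]
    simp only [Pi.add_apply, Finset.sum_add_distrib, Finset.sum_pi_single', Finset.mem_univ,
      if_true] at h2
    exact Nat.succ.inj h2

/-- The components of the exterior algebra with integral multi-indices. -/
noncomputable def extComponentInt (U : Fin s → Submodule ℂ X) (d : Fin s → ℤ) :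
    Submodule ℂ (ExteriorAlgebra ℂ X) :=
  open Classical in if ∀ q, 0 ≤ d q then extComponent U fun q => (d q).toNat else ⊥

theorem extComponentInt_natCast (U : Fin s → Submodule ℂ X) (d : Fin s → ℕ) :
    extComponentInt U (fun q => (d q : ℤ)) = extComponent U d := by
  rw [extComponentInt, if_pos fun q => Int.natCast_nonneg _]
  simp

theorem extComponentInt_of_nonneg (U : Fin s → Submodule ℂ X) {d : Fin s → ℤ}
    (h : ∀ q, 0 ≤ d q) : extComponentInt U d = extComponent U fun q => (d q).toNat := by
  rw [extComponentInt, if_pos h]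

theorem extComponentInt_of_neg (U : Fin s → Submodule ℂ X) {d : Fin s → ℤ}
    (h : ¬ ∀ q, 0 ≤ d q) : extComponentInt U d = ⊥ := by
  rw [extComponentInt, if_neg h]

theorem ι_mul_mem_extComponentInt (U : Fin s → Submodule ℂ X) {d : Fin s → ℤ} {p : Fin s} {v : X}
    (hv : v ∈ U p) {x : ExteriorAlgebra ℂ X} (hx : x ∈ extComponentInt U d) :
    ExteriorAlgebra.ι ℂ v * x ∈ extComponentInt U (d + Pi.single p 1) := by
  by_cases h : ∀ q, 0 ≤ d q
  · lift d to Fin s → ℕ using h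
    rw [extComponentInt_natCast] at hx
    have : (fun q => ((d q : ℕ) : ℤ)) + Pi.single p 1
        = fun q => (((d + Pi.single p 1 : Fin s → ℕ) q : ℕ) : ℤ) := by
      ext q
      by_cases hq : q = p
      · subst hq; simp
      · simp [Pi.single_eq_of_ne hq]
    rw [this, extComponentInt_natCast, ← map_ι_mul_extComponent]
    exact Submodule.mul_mem_mul ⟨v, hv, rfl⟩ hx
  · rw [extComponentInt_of_neg U h, Submodule.mem_bot] at hx
    rw [hx, mul_zero]
    exact Submodule.zero_mem _

/-- A functional supported on block q removes one factor from that block. Integral indices, with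
zero at negative ones, let the Leibniz induction run without separating the case of an empty block.
-/
theorem contractLeft_mem_extComponentInt (U : Fin s → Submodule ℂ X) {q : Fin s}
    {φ : Module.Dual ℂ X} (hφ : ∀ p ≠ q, ∀ v ∈ U p, φ v = 0) {d : Fin s → ℤ}
    {x : ExteriorAlgebra ℂ X} (hx : x ∈ extComponentInt U d) :
    contractLeft φ x ∈ extComponentInt U (d - Pi.single q 1) := by
  by_cases h : ∀ q, 0 ≤ d q
  · lift d to Fin s → ℕ using h
    rw [extComponentInt_natCast] at hx
    induction d using multiIndex_induction generalizing x with
    | zero =>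
      rw [extComponent_zero] at hx
      obtain ⟨r, rfl⟩ := Submodule.mem_one.1 hx
      rw [contractLeft_algebraMap]
      exact Submodule.zero_mem _
    | add d p ih =>
      rw [← map_ι_mul_extComponent] at hx
      have hd : (fun r => (((d + Pi.single p 1 : Fin s → ℕ) r : ℕ) : ℤ))
          = (fun r => ((d r : ℕ) : ℤ)) + Pi.single p 1 := by
        ext r
        by_cases hr : r = p
        · subst hr; simp
        · simp [Pi.single_eq_of_ne hr]
      refine Submodule.mul_induction_on hx (fun a ha y hy => ?_) fun x y hx hy => ?_
      · obtain ⟨v, hv, rfl⟩ := ha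
        rw [contractLeft_ι_mul_ext, hd]
        refine Submodule.sub_mem _ ?_ ?_
        · by_cases hpq : p = q
          · subst hpq
            rw [add_sub_cancel_right, extComponentInt_natCast]
            exact Submodule.smul_mem _ _ hy
          · rw [hφ p hpq v hv, zero_smul]
            exact Submodule.zero_mem _
        · rw [add_sub_right_comm]
          exact ι_mul_mem_extComponentInt U hv (ih hy)
      · rw [map_add]; exact Submodule.add_mem _ hx hy
  · rw [extComponentInt_of_neg U h, Submodule.mem_bot] at hx
    rw [hx, map_zero]
    exact Submodule.zero_mem _

variable {I X' : Type*} [AddCommGroup X'] [Module ℂ X']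

theorem listWedge_mem_extComponent [DecidableEq I] (b : Module.Basis I ℂ X) (π : I → Fin s)
    {U : Fin s → Submodule ℂ X} (hU : ∀ i, b i ∈ U (π i)) (l : List I) :
    listWedge b l ∈ extComponent U fun q => l.countP fun i => π i = q := by
  induction l with
  | nil =>
    have : (fun q => List.countP (fun i => decide (π i = q)) []) = (0 : Fin s → ℕ) := by
      ext; simp
    rw [this, extComponent_zero, listWedge, List.map_nil, List.prod_nil]
    exact Submodule.one_le.1 le_rfl
  | cons i l ih =>
    have : (fun q => List.countP (fun j => decide (π j = q)) (i :: l))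
        = (fun q => List.countP (fun j => decide (π j = q)) l) + Pi.single (π i) 1 := by
      ext q
      rw [List.countP_cons, Pi.add_apply, Pi.single_apply]
      simp [eq_comm]
    rw [this, ← map_ι_mul_extComponent, listWedge_cons]
    exact Submodule.mul_mem_mul ⟨_, hU i, rfl⟩ ih

/-- The value at 1 has full degree in every flipped block; each further factor there contracts, and
elsewhere it multiplies. The count in the index is the dimension of block q. -/
theorem star_mem_extComponentInt [DecidableEq I] (b : Module.Basis I ℂ X)
    (b' : Module.Basis I ℂ X') (π : I → Fin s)
    (JQ : Fin s → Prop) [DecidablePred JQ] {U : Fin s → Submodule ℂ X} {U' : Fin s → Submodule ℂ X'}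
    (hU : ∀ q, U q = Submodule.span ℂ (b '' {i | π i = q}))
    (hU' : ∀ q, U' q = Submodule.span ℂ (b' '' {i | π i = q})) {l : List I}
    (hl : ∀ i, i ∈ l ↔ JQ (π i)) (d : Fin s → ℕ) {x : ExteriorAlgebra ℂ X'}
    (hx : x ∈ extComponent U' d) :
    star b b' (fun i => JQ (π i)) (listWedge b l) x ∈ extComponentInt U fun q =>
      if JQ q then (l.countP fun i => π i = q : ℤ) - d q else d q := by
  have hbU : ∀ i, b i ∈ U (π i) := fun i => by
    rw [hU]; exact Submodule.subset_span ⟨i, rfl, rfl⟩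
  induction d using multiIndex_induction generalizing x with
  | zero =>
    rw [extComponent_zero] at hx
    obtain ⟨r, rfl⟩ := Submodule.mem_one.1 hx
    rw [star_algebraMap]
    refine Submodule.smul_mem _ _ ?_
    have h1 := listWedge_mem_extComponent b π hbU l
    rw [← extComponentInt_natCast] at h1
    convert h1 using 2
    ext q
    simp only [Pi.zero_apply, Nat.cast_zero, sub_zero]
    split_ifs with hq
    · rfl
    · symm
      rw [Int.natCast_eq_zero, List.countP_eq_zero]
      intro i hi h
      rw [decide_eq_true_eq] at h
      exact hq (h ▸ (hl i).1 hi)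
  | add d p ih =>
    rw [← map_ι_mul_extComponent] at hx
    refine Submodule.mul_induction_on hx (fun a ha y hy => ?_) fun x y hx hy => ?_
    · obtain ⟨v, hv, rfl⟩ := ha
      rw [SetLike.mem_coe, hU'] at hv
      induction hv using Submodule.span_induction with
      | zero => rw [map_zero, zero_mul, map_zero]; exact Submodule.zero_mem _
      | add v w _ _ hv hw => rw [map_add, add_mul, map_add]; exact Submodule.add_mem _ hv hw
      | smul r v _ hv =>
        rw [map_smul, smul_mul_assoc, map_smul]; exact Submodule.smul_mem _ _ hv
      | mem v hv =>
        obtain ⟨i, rfl, rfl⟩ := hv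
        rw [star_basis_mul]
        by_cases hi : JQ (π i)
        · rw [starGen_of_mem b (fun i => JQ (π i)) hi]
          have h1 := contractLeft_mem_extComponentInt U (q := π i) (φ := b.coord i) (by
            intro p hp v hv
            rw [hU] at hv
            have : Submodule.span ℂ (b '' {i | π i = p}) ≤ LinearMap.ker (b.coord i) := by
              rw [Submodule.span_le]
              rintro _ ⟨j, hj, rfl⟩
              rw [SetLike.mem_coe, LinearMap.mem_ker, Module.Basis.coord_apply,
                Module.Basis.repr_self, Finsupp.single_eq_of_ne]
              rintro rfl
              exact hp hj.symm
            exact this hv) (ih hy)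
          convert h1 using 2
          ext q
          rw [Pi.sub_apply]
          by_cases hq : q = π i
          · subst hq
            simp only [hi, if_true, Pi.add_apply, Pi.single_eq_same]
            push_cast
            ring
          · simp only [Pi.add_apply, Pi.single_eq_of_ne hq, add_zero, sub_zero]
        · rw [starGen_of_notMem b (fun i => JQ (π i)) hi]
          have h1 := ι_mul_mem_extComponentInt U (hbU i) (ih hy)
          convert h1 using 2
          ext q
          rw [Pi.add_apply]
          by_cases hq : q = π i
          · subst hq
            simp only [hi, if_false, Pi.add_apply, Pi.single_eq_same]
            push_cast
            ring
          · simp only [Pi.add_apply, Pi.single_eq_of_ne hq, add_zero]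
    · rw [map_add]; exact Submodule.add_mem _ hx hy

/-- Passing to the contragredient action on some blocks of a block diagonal representation
permutes the components of the exterior algebra, up to a character. -/
theorem exists_star {G : Type*} [Group G] [Fintype I] [DecidableEq I] (b : Module.Basis I ℂ X)
    (b' : Module.Basis I ℂ X') (π : I → Fin s) (JQ : Fin s → Prop) [DecidablePred JQ]
    {U : Fin s → Submodule ℂ X} {U' : Fin s → Submodule ℂ X'}
    (hU : ∀ q, U q = Submodule.span ℂ (b '' {i | π i = q}))
    (hU' : ∀ q, U' q = Submodule.span ℂ (b' '' {i | π i = q}))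
    (T : Representation ℂ G X) (T' : Representation ℂ G X') (R R' : G →* Matrix I I ℂ)
    (hR : ∀ g i j, π i ≠ π j → R g i j = 0)
    (hR' : ∀ g i j, R' g i j = if JQ (π j) then R g⁻¹ j i else R g i j)
    (hT : ∀ g i, T g (b i) = ∑ k, R g k i • b k)
    (hT' : ∀ g i, T' g (b' i) = ∑ k, R' g k i • b' k) :
    ∃ L : ExteriorAlgebra ℂ X' →ₗ[ℂ] ExteriorAlgebra ℂ X, Function.Injective L ∧
      (∀ g, ∃ c : ℂ, c ≠ 0 ∧ ∀ x, L (extRep T' g x) = c • extRep T g (L x)) ∧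
      ∀ j, extComponent U' j = ⊥ ∨ ∃ j', (extComponent U' j).map L = extComponent U j' := by
  let l := (Finset.univ.filter fun i => JQ (π i)).toList
  have hl : ∀ i, i ∈ l ↔ JQ (π i) := fun i => by simp [l]
  have hnd : l.Nodup := Finset.nodup_toList _
  have hss := star_star b b' (fun i => JQ (π i)) hnd hl
  have hss' := star_star b' b (fun i => JQ (π i)) (List.nodup_reverse.2 hnd)
    (fun i => by rw [List.mem_reverse, hl])
  rw [List.reverse_reverse] at hss'
  have hinj : Function.Injective (star b b' (fun i => JQ (π i)) (listWedge b l)) :=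
    Function.LeftInverse.injective hss
  have hblock : ∀ g i j, R g i j ≠ 0 → (JQ (π i) ↔ JQ (π j)) := by
    intro g i j hij
    by_cases hp : π i = π j
    · rw [hp]
    · exact absurd (hR g i j hp) hij
  refine ⟨star b b' (fun i => JQ (π i)) (listWedge b l), hinj, ?_, ?_⟩
  · intro g
    obtain ⟨c, hc, hcl⟩ := exists_map_listWedge b hnd (T := T g) (S := T g⁻¹) (by
      rw [← Module.End.mul_eq_comp, ← map_mul, inv_mul_cancel, map_one]; rfl) (by
      intro i hi
      rw [hT]
      refine Submodule.sum_mem _ fun k _ => ?_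
      by_cases hk : R g k i = 0
      · rw [hk, zero_smul]; exact Submodule.zero_mem _
      · refine Submodule.smul_mem _ _ (Submodule.subset_span ⟨k, ?_, rfl⟩)
        exact (hl k).2 ((hblock g k i hk).2 ((hl i).1 hi)))
    refine ⟨c⁻¹, inv_ne_zero hc, fun x => ?_⟩
    have h1 := star_map b b' (fun i => JQ (π i)) (l := l) (A := R g) (A' := R' g) (B := R g⁻¹)
      (by rw [← map_mul, inv_mul_cancel, map_one]) (hblock g) (hblock g⁻¹) (hR' g) (hT g) (hT' g)
      hcl x
    rw [extRep_apply, extRep_apply, AlgHom.toLinearMap_apply, AlgHom.toLinearMap_apply, ← h1,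
      inv_smul_smul₀ hc]
  · intro j
    have h1 := fun x hx => star_mem_extComponentInt b b' π JQ hU hU' hl j (x := x) hx
    -- If some j q exceeds the dimension of a flipped block, the target index is negative, and
    -- injectivity of the star makes the source component zero.
    by_cases hj : ∀ q, 0 ≤ if JQ q then (l.countP fun i => π i = q : ℤ) - j q else (j q : ℤ)
    · right
      simp only [extComponentInt_of_nonneg U hj] at h1
      refine ⟨_, le_antisymm (Submodule.map_le_iff_le_comap.2 h1) fun y hy => ?_⟩
      have h2 := star_mem_extComponentInt b' b π JQ hU' hU (l := l.reverse)
        (fun i => by rw [List.mem_reverse, hl]) _ hy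
      refine ⟨_, ?_, hss' y⟩
      rw [SetLike.mem_coe, ← extComponentInt_natCast]
      convert h2 using 2
      ext q
      have h3 := hj q
      rw [Int.toNat_of_nonneg h3]
      split_ifs with hq
      · rw [List.countP_reverse]; ring
      · rfl
    · left
      rw [eq_bot_iff]
      intro x hx
      have h2 := h1 x hx
      rw [extComponentInt_of_neg U hj, Submodule.mem_bot] at h2
      exact (Submodule.mem_bot ℂ).2 (hinj (h2.trans (map_zero _).symm))

end ExtComponent
end SuperMF

namespace SuperMF

/-! ### Even part: from polynomials to the symmetric algebra -/

section EvenTransfer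

open MvPolynomial

theorem CommOn.of_equiv_symm {G Y Z : Type*} [AddCommGroup Y] [Module ℂ Y]
    [AddCommGroup Z] [Module ℂ Z] {T : G → Y →ₗ[ℂ] Y} {T' : G → Z →ₗ[ℂ] Z}
    {N : Submodule ℂ Y} {N' : Submodule ℂ Z} (h : CommOn T N) (hN : Stable T N)
    (L : Y →ₗ[ℂ] Z) (hinj : ∀ x ∈ N, L x = 0 → x = 0) (hmap : N.map L = N')
    (hL : ∀ g, ∃ c : ℂ, c ≠ 0 ∧ ∀ x ∈ N, L (T g x) = c • T' g (L x)) : CommOn T' N' := by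
  obtain ⟨L', hL'⟩ := exists_linearMap_leftInverse_on L N hinj
  subst hmap
  have hT' : ∀ g, ∃ c : ℂ, c ≠ 0 ∧ ∀ x ∈ N, T' g (L x) = c • L (T g x) := by
    intro g
    obtain ⟨c, hc, hcL⟩ := hL g
    exact ⟨c⁻¹, inv_ne_zero hc, fun x hx => by rw [hcL x hx, inv_smul_smul₀ hc]⟩
  refine h.of_equiv ?_ L' ?_ ?_ ?_
  · rintro g _ ⟨x, hx, rfl⟩
    obtain ⟨c, hc, hcL⟩ := hT' g
    rw [hcL x hx]
    exact Submodule.smul_mem _ _ ⟨_, hN g x hx, rfl⟩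
  · rintro _ ⟨x, hx, rfl⟩ h0
    rw [hL' x hx] at h0
    rw [h0, map_zero]
  · ext x
    constructor
    · rintro ⟨_, ⟨y, hy, rfl⟩, rfl⟩
      rw [hL' y hy]; exact hy
    · exact fun hx => ⟨L x, ⟨x, hx, rfl⟩, hL' x hx⟩
  · intro g
    obtain ⟨c, hc, hcL⟩ := hT' g
    refine ⟨c, hc, ?_⟩
    rintro _ ⟨x, hx, rfl⟩
    rw [hcL x hx, map_smul, hL' _ (hN g x hx), hL' x hx]

variable {I X : Type*} [AddCommGroup X] [Module ℂ X] {s : ℕ}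

theorem symComponent_add (U : Fin s → Submodule ℂ X) (d e : Fin s → ℕ) :
    symComponent U (d + e) = symComponent U d * symComponent U e := by
  simp only [symComponent, Pi.add_apply, pow_add, Finset.prod_mul_distrib]

theorem symComponent_zero (U : Fin s → Submodule ℂ X) : symComponent U 0 = 1 := by
  simp [symComponent]

theorem symComponent_single (U : Fin s → Submodule ℂ X) (p : Fin s) :
    symComponent U (Pi.single p 1) = (U p).map (SymmetricAlgebra.ι ℂ X) := by
  rw [symComponent, Finset.prod_eq_single p]
  · rw [Pi.single_eq_same, pow_one]
  · intro q _ hq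
    rw [Pi.single_eq_of_ne hq, pow_zero]
  · simp

/-- The polynomial model of the symmetric algebra that belongs to a basis. -/
noncomputable def polyEquiv (b : Module.Basis I ℂ X) :
    MvPolynomial I ℂ ≃ₐ[ℂ] SymmetricAlgebra ℂ X :=
  (SymmetricAlgebra.equivMvPolynomial b).symm

theorem polyEquiv_X (b : Module.Basis I ℂ X) (i : I) :
    polyEquiv b (MvPolynomial.X i) = SymmetricAlgebra.ι ℂ X (b i) := by
  simp [polyEquiv]

variable [Fintype I]

theorem blockHomogeneous_mul {π : I → Fin s} {d e : Fin s → ℕ} {f h : MvPolynomial I ℂ}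
    (hf : f ∈ blockHomogeneous π d) (hh : h ∈ blockHomogeneous π e) :
    f * h ∈ blockHomogeneous π (d + e) := by
  rw [mem_blockHomogeneous] at *
  intro p
  rw [euler_mul, hf, hh, smul_mul_assoc, mul_smul_comm, ← add_smul]
  simp

theorem X_mem_blockHomogeneous (π : I → Fin s) (i : I) :
    (MvPolynomial.X i : MvPolynomial I ℂ) ∈ blockHomogeneous π (Pi.single (π i) 1) :=
  monomial_mem_blockHomogeneous (by simp [Finsupp.weight_single, blockWeight]) 1

/-- In a basis adapted to the summands, the span of products of i_p vectors from each U_p is spanned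
by the monomials of multidegree i. -/
theorem map_polyEquiv_blockHomogeneous (b : Module.Basis I ℂ X) (π : I → Fin s)
    {U : Fin s → Submodule ℂ X} (hU : ∀ q, U q = Submodule.span ℂ (b '' {i | π i = q}))
    (d : Fin s → ℕ) :
    (blockHomogeneous π d).map (polyEquiv b).toLinearMap = symComponent U d := by
  classical
  apply le_antisymm
  · have key : ∀ c : I →₀ ℕ, polyEquiv b (monomial c 1)
        ∈ symComponent U (Finsupp.weight (blockWeight π) c) := by
      intro c
      induction c using Finsupp.induction_linear with
      | zero =>
        rw [map_zero, symComponent_zero, ← C_apply, map_one, map_one]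
        exact Submodule.one_le.1 le_rfl
      | add c c' hc hc' =>
        rw [map_add, symComponent_add, ← one_mul (1 : ℂ), ← monomial_mul, map_mul]
        exact Submodule.mul_mem_mul hc hc'
      | single i n =>
        induction n with
        | zero =>
          rw [Finsupp.single_zero, map_zero, symComponent_zero, ← C_apply, map_one, map_one]
          exact Submodule.one_le.1 le_rfl
        | succ n ih =>
          rw [Finsupp.single_add, map_add, symComponent_add, ← one_mul (1 : ℂ), ← monomial_mul,
            map_mul]
          refine Submodule.mul_mem_mul ih ?_
          rw [Finsupp.weight_single, one_smul, blockWeight, symComponent_single,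
            show monomial (Finsupp.single i 1) (1 : ℂ) = MvPolynomial.X i from rfl, polyEquiv_X]
          exact ⟨b i, by rw [SetLike.mem_coe, hU]; exact Submodule.subset_span ⟨i, rfl, rfl⟩, rfl⟩
    rintro _ ⟨f, hf, rfl⟩
    rw [AlgEquiv.toLinearMap_apply, f.as_sum, map_sum]
    refine Submodule.sum_mem _ fun c hc => ?_
    rw [monomial_eq_smul c, map_smul, ← hf (mem_support_iff.1 hc)]
    exact Submodule.smul_mem _ _ (key c)
  · induction d using multiIndex_induction with
    | zero =>
      rw [symComponent_zero, Submodule.one_le]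
      refine ⟨1, ?_, map_one (polyEquiv b)⟩
      exact monomial_mem_blockHomogeneous (map_zero _) 1
    | add d p ih =>
      rw [symComponent_add, symComponent_single, Submodule.mul_le]
      rintro x hx _ ⟨v, hv, rfl⟩
      obtain ⟨f, hf, rfl⟩ := ih hx
      rw [SetLike.mem_coe, hU] at hv
      induction hv using Submodule.span_induction with
      | zero => rw [map_zero, mul_zero]; exact Submodule.zero_mem _
      | add v w _ _ hv hw => rw [map_add, mul_add]; exact Submodule.add_mem _ hv hw
      | smul r v _ hv => rw [map_smul, mul_smul_comm]; exact Submodule.smul_mem _ _ hv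
      | mem v hv =>
        obtain ⟨i, rfl, rfl⟩ := hv
        refine ⟨f * MvPolynomial.X i, blockHomogeneous_mul hf (X_mem_blockHomogeneous π i), ?_⟩
        rw [AlgEquiv.toLinearMap_apply, AlgEquiv.toLinearMap_apply, map_mul, polyEquiv_X]

variable [DecidableEq I] {G : Type*} [Group G]

theorem polyEquiv_linSubst (b : Module.Basis I ℂ X) (T : Representation ℂ G X)
    (R : G → Matrix I I ℂ) (hT : ∀ g i, T g (b i) = ∑ k, R g k i • b k) (g : G)
    (f : MvPolynomial I ℂ) : polyEquiv b (linSubst (R g) f) = symRep T g (polyEquiv b f) := by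
  have h : (polyEquiv b : MvPolynomial I ℂ →ₐ[ℂ] SymmetricAlgebra ℂ X).comp (linSubst (R g))
      = (symHom T g).comp (polyEquiv b : MvPolynomial I ℂ →ₐ[ℂ] SymmetricAlgebra ℂ X) := by
    ext i : 1
    simp [linSubst_X, polyEquiv_X, symHom_ι, hT]
  exact DFunLike.congr_fun h f

variable {m Z : Type*} [Fintype m] [DecidableEq m] [AddCommGroup Z] [Module ℂ Z]

/-- Vector valued polynomials as a model of a tensor product with a symmetric algebra. -/
noncomputable def vectorPoly (b : Module.Basis I ℂ X) (c : m → Z) :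
    (m → MvPolynomial I ℂ) →ₗ[ℂ] SymmetricAlgebra ℂ X ⊗[ℂ] Z :=
  ∑ α, (TensorProduct.mk ℂ _ _).flip (c α) ∘ₗ (polyEquiv b).toLinearMap ∘ₗ LinearMap.proj α

theorem vectorPoly_apply (b : Module.Basis I ℂ X) (c : m → Z) (v : m → MvPolynomial I ℂ) :
    vectorPoly b c v = ∑ α, polyEquiv b (v α) ⊗ₜ[ℂ] c α := by
  simp [vectorPoly, LinearMap.sum_apply]

theorem vectorPoly_injective (b : Module.Basis I ℂ X) {c : m → Z} (hc : LinearIndependent ℂ c) :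
    Function.Injective (vectorPoly b c) := by
  obtain ⟨f, hf⟩ : ∃ f : Z →ₗ[ℂ] (m → ℂ), ∀ α, f (c α) = Pi.single α 1 := by
    obtain ⟨f, hf⟩ := LinearMap.exists_extend ((Module.Basis.span hc).constr ℂ
      fun α => (Pi.single α 1 : m → ℂ))
    refine ⟨f, fun α => ?_⟩
    have := LinearMap.congr_fun hf (Module.Basis.span hc α)
    rw [Module.Basis.constr_basis] at this
    rw [← this, LinearMap.comp_apply, Submodule.subtype_apply, Module.Basis.span_apply]
  rw [← LinearMap.ker_eq_bot, LinearMap.ker_eq_bot']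
  intro v hv
  funext β
  have h1 := congrArg ((TensorProduct.rid ℂ _) ∘ TensorProduct.map LinearMap.id
    (LinearMap.proj β ∘ₗ f)) hv
  rw [vectorPoly_apply] at h1
  simp only [Function.comp_apply, map_sum, TensorProduct.map_tmul, LinearMap.id_apply,
    LinearMap.comp_apply, hf, LinearMap.proj_apply, TensorProduct.rid_tmul, Pi.single_apply,
    ite_smul, one_smul, zero_smul, Finset.sum_ite_eq, Finset.mem_univ, if_true, map_zero] at h1
  exact (polyEquiv b).injective (h1.trans (map_zero _).symm)

/-- With c a basis of a component of the exterior algebra, vector valued polynomials of fixed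
multidegree model the whole component of the super symmetric algebra. -/
theorem map_vectorPoly (b : Module.Basis I ℂ X) (π : I → Fin s)
    {U : Fin s → Submodule ℂ X} (hU : ∀ q, U q = Submodule.span ℂ (b '' {i | π i = q}))
    (d : Fin s → ℕ) (c : m → Z) :
    (Submodule.pi Set.univ fun _ : m => blockHomogeneous π d).map (vectorPoly b c)
      = Submodule.map₂ (TensorProduct.mk ℂ _ _) (symComponent U d)
        (Submodule.span ℂ (Set.range c)) := by
  rw [← map_polyEquiv_blockHomogeneous b π hU]
  apply le_antisymm
  · rintro _ ⟨v, hv, rfl⟩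
    rw [vectorPoly_apply]
    exact Submodule.sum_mem _ fun α _ => Submodule.apply_mem_map₂ _ ⟨v α, hv α trivial, rfl⟩
      (Submodule.subset_span ⟨α, rfl⟩)
  · rw [Submodule.map₂_le]
    rintro _ ⟨f, hf, rfl⟩ z hz
    induction hz using Submodule.span_induction with
    | zero => rw [map_zero]; exact Submodule.zero_mem _
    | add v w _ _ hv hw => rw [map_add]; exact Submodule.add_mem _ hv hw
    | smul r v _ hv => rw [map_smul]; exact Submodule.smul_mem _ _ hv
    | mem z hz =>
      obtain ⟨α, rfl⟩ := hz
      refine ⟨Pi.single α f, ?_, ?_⟩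
      · intro β _
        by_cases h : β = α
        · subst h; rw [Pi.single_eq_same]; exact hf
        · rw [Pi.single_eq_of_ne h]; exact Submodule.zero_mem _
      · rw [vectorPoly_apply, Finset.sum_eq_single α]
        · rw [Pi.single_eq_same]; rfl
        · intro β _ h
          rw [Pi.single_eq_of_ne h, map_zero, TensorProduct.zero_tmul]
        · simp

theorem vectorPoly_tensorAct (b : Module.Basis I ℂ X) (T : Representation ℂ G X)
    (R : G → Matrix I I ℂ) (hT : ∀ g i, T g (b i) = ∑ k, R g k i • b k) (c : m → Z)
    (τ : Representation ℂ G Z) (a : G → Matrix m m ℂ) (hc : ∀ g β, τ g (c β) = ∑ α, a g α β • c α)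
    (g : G) (v : m → MvPolynomial I ℂ) :
    vectorPoly b c (tensorAct (a g) (linSubst (R g)).toLinearMap v)
      = (symRep T).tprod τ g (vectorPoly b c v) := by
  rw [vectorPoly_apply, vectorPoly_apply, map_sum]
  simp only [tensorAct_apply, AlgHom.toLinearMap_apply, map_sum, map_smul,
    polyEquiv_linSubst b T R hT, TensorProduct.sum_tmul]
  rw [Finset.sum_comm]
  refine Finset.sum_congr rfl fun β _ => ?_
  rw [Representation.tprod_apply, TensorProduct.map_tmul, hc, TensorProduct.tmul_sum]
  exact Finset.sum_congr rfl fun α _ => TensorProduct.smul_tmul _ _ _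

/-- Passing to the contragredient action on some blocks of the even part preserves commutativity of
the equivariant endomorphisms of all components. -/
theorem commOn_tprod_of_contragredient {X' : Type*} [AddCommGroup X'] [Module ℂ X']
    (b : Module.Basis I ℂ X) (b' : Module.Basis I ℂ X') (π : I → Fin s) (JQ : Fin s → Prop)
    {U : Fin s → Submodule ℂ X} {U' : Fin s → Submodule ℂ X'}
    (hU : ∀ q, U q = Submodule.span ℂ (b '' {i | π i = q}))
    (hU' : ∀ q, U' q = Submodule.span ℂ (b' '' {i | π i = q}))
    (T : Representation ℂ G X) (T' : Representation ℂ G X') (R R' : G →* Matrix I I ℂ)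
    (hR : ∀ g i j, π i ≠ π j → R g i j = 0) [DecidablePred JQ]
    (hR' : ∀ g i j, R' g i j = if JQ (π j) then R g⁻¹ j i else R g i j)
    (hT : ∀ g i, T g (b i) = ∑ k, R g k i • b k)
    (hT' : ∀ g i, T' g (b' i) = ∑ k, R' g k i • b' k)
    (τ : Representation ℂ G Z) (N : Submodule ℂ Z) [FiniteDimensional ℂ N]
    (hN : ∀ g, ∀ z ∈ N, τ g z ∈ N)
    (h : ∀ d, CommOn (fun g => (symRep T).tprod τ g)
      (Submodule.map₂ (TensorProduct.mk ℂ _ _) (symComponent U d) N)) (d : Fin s → ℕ) :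
    CommOn (fun g => (symRep T').tprod τ g)
      (Submodule.map₂ (TensorProduct.mk ℂ _ _) (symComponent U' d) N) := by
  let β := Module.finBasis ℂ N
  let c : Fin (Module.finrank ℂ N) → Z := fun α => β α
  have hc : LinearIndependent ℂ c := β.linearIndependent.map' N.subtype (Submodule.ker_subtype N)
  have hspan : Submodule.span ℂ (Set.range c) = N := by
    rw [show Set.range c = N.subtype '' Set.range β from Set.range_comp _ _, Submodule.span_image,
      β.span_eq, Submodule.map_top, Submodule.range_subtype]
  let a : G → Matrix _ _ ℂ := fun g => Matrix.of fun α γ => β.repr ⟨τ g (β γ), hN g _ (β γ).2⟩ α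
  have ha : ∀ g γ, τ g (c γ) = ∑ α, a g α γ • c α := by
    intro g γ
    have := congrArg Subtype.val (β.sum_repr ⟨τ g (β γ), hN g _ (β γ).2⟩)
    rw [AddSubmonoidClass.coe_finsetSum] at this
    exact this.symm
  have hstable : ∀ (R : G →* Matrix I I ℂ), (∀ g i j, π i ≠ π j → R g i j = 0) → ∀ d,
      Stable (fun g => tensorAct (a g) (linSubst (R g)).toLinearMap)
        (Submodule.pi Set.univ fun _ : Fin (Module.finrank ℂ N) => blockHomogeneous π d) := by
    intro R hR d g v hv α _
    rw [tensorAct_apply]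
    exact Submodule.sum_mem _ fun γ _ => Submodule.smul_mem _ _
      (linSubst_mem_blockHomogeneous (hR g) (hv γ trivial))
  have hR'b : ∀ g i j, π i ≠ π j → R' g i j = 0 := by
    intro g i j hij
    rw [hR', hR g i j hij, hR g⁻¹ j i hij.symm, ite_self]
  have h1 : ∀ d, CommOn (fun g => tensorAct (a g) (linSubst (R g)).toLinearMap)
      (Submodule.pi Set.univ fun _ : Fin (Module.finrank ℂ N) => blockHomogeneous π d) := by
    intro d
    refine (h d).of_equiv (hstable R hR d) (vectorPoly b c)
      (fun x _ hx => vectorPoly_injective b hc (hx.trans (map_zero _).symm))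
      (by rw [map_vectorPoly b π hU, hspan]) fun g => ⟨1, one_ne_zero, fun x _ => ?_⟩
    rw [one_smul, vectorPoly_tensorAct b T (fun g => R g) hT c τ a ha]
  have h2 := commOn_of_contragredient π JQ R R' a hR hR' h1 d
  refine h2.of_equiv_symm (hstable R' hR'b d) (vectorPoly b' c)
      (fun x _ hx => vectorPoly_injective b' hc (hx.trans (map_zero _).symm))
      (by rw [map_vectorPoly b' π hU', hspan]) fun g => ⟨1, one_ne_zero, fun x _ => ?_⟩
  rw [one_smul, vectorPoly_tensorAct b' T' (fun g => R' g) hT' c τ a ha]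

end EvenTransfer
end SuperMF

namespace SuperMF

/-! ### Dualizing a summand flips some irreducible constituents -/

section FlipDecomposition

variable {G : Type*} [Group G]

theorem isIrreducible_iff {V : Type*} [AddCommGroup V] [Module ℂ V] {ρ : Representation ℂ G V}
    (U : Subrepresentation ρ) : U.toRepresentation.IsIrreducible ↔ U.toSubmodule ≠ ⊥ ∧
      ∀ N ≤ U.toSubmodule, Stable (fun g => ρ g) N → N = ⊥ ∨ N = U.toSubmodule := by
  constructor
  · intro h
    constructor
    · intro h0
      obtain ⟨a, b, hab⟩ := h.exists_pair_ne
      apply hab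
      apply Subrepresentation.toSubmodule_injective
      have : Subsingleton U.toSubmodule := by rw [h0]; infer_instance
      exact Subsingleton.elim _ _
    · intro N hN hNs
      rcases eq_bot_or_eq_top_of_irreducible h (N.comap U.toSubmodule.subtype)
        (fun g x hx => hNs g _ hx) with h1 | h1
      · left
        rw [eq_bot_iff]
        intro x hx
        have : (⟨x, hN hx⟩ : U.toSubmodule) ∈ N.comap U.toSubmodule.subtype := hx
        rw [h1, Submodule.mem_bot] at this
        exact (Submodule.mem_bot ℂ).2 (congrArg Subtype.val this)
      · right
        refine le_antisymm hN fun x hx => ?_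
        have : (⟨x, hx⟩ : U.toSubmodule) ∈ N.comap U.toSubmodule.subtype := by rw [h1]; trivial
        exact this
  · rintro ⟨h0, h⟩
    have : Nontrivial U.toSubmodule := Submodule.nontrivial_iff_ne_bot.2 h0
    refine irreducible_of_stable _ fun M hM => ?_
    rcases h (M.map U.toSubmodule.subtype) (Submodule.map_subtype_le _ _) (by
      rintro g _ ⟨x, hx, rfl⟩
      exact ⟨_, hM g x hx, rfl⟩) with h1 | h1
    · left
      rw [eq_bot_iff]
      intro x hx
      have : (x : V) ∈ M.map U.toSubmodule.subtype := ⟨x, hx, rfl⟩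
      rw [h1, Submodule.mem_bot] at this
      exact (Submodule.mem_bot ℂ).2 (Subtype.ext this)
    · right
      rw [eq_top_iff]
      intro x _
      have : (x : V) ∈ M.map U.toSubmodule.subtype := by rw [h1]; exact x.2
      obtain ⟨y, hy, hyx⟩ := this
      rwa [← Subtype.ext hyx]

/-- A stable submodule is complementary to a sum of some of the irreducible summands. -/
theorem exists_isCompl_iSup {V : Type*} [AddCommGroup V] [Module ℂ V] {ρ : Representation ℂ G V}
    {k : ℕ} (D : IrredDecomposition ρ k) (A : Submodule ℂ V) (hA : Stable (fun g => ρ g) A) :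
    ∃ Q : Finset (Fin k), IsCompl A (⨆ p ∈ Q, (D.U p).toSubmodule) := by
  classical
  -- A maximal set of summands whose sum is disjoint from A is the required one.
  have hne : (Finset.univ.filter fun Q : Finset (Fin k) =>
      Disjoint A (⨆ p ∈ Q, (D.U p).toSubmodule)).Nonempty := ⟨∅, by simp⟩
  obtain ⟨Q, hQ⟩ := Finset.exists_maximal hne
  have hd : Disjoint A (⨆ p ∈ Q, (D.U p).toSubmodule) := (Finset.mem_filter.1 hQ.1).2
  refine ⟨Q, hd, ?_⟩
  rw [codisjoint_iff, eq_top_iff, ← D.isInternal.submodule_iSup_eq_top, iSup_le_iff]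
  intro p
  have hB : Stable (fun g => ρ g) (A ⊔ ⨆ p ∈ Q, (D.U p).toSubmodule) := by
    intro g
    suffices h : A ⊔ ⨆ p ∈ Q, (D.U p).toSubmodule
        ≤ (A ⊔ ⨆ p ∈ Q, (D.U p).toSubmodule).comap (ρ g) from fun x hx => h hx
    refine sup_le (fun x hx => Submodule.mem_sup_left (hA g x hx)) ?_
    refine iSup₂_le fun q hq x hx => Submodule.mem_sup_right ?_
    exact Submodule.mem_iSup_of_mem q (Submodule.mem_iSup_of_mem hq
      ((D.U q).apply_mem_toSubmodule g hx))
  -- By irreducibility, U p either meets the sum trivially, so that p could be added to Q, or lies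
  -- inside it.
  rcases ((isIrreducible_iff _).1 (D.irreducible p)).2
    ((A ⊔ ⨆ p ∈ Q, (D.U p).toSubmodule) ⊓ (D.U p).toSubmodule) inf_le_right
    (fun g x hx => ⟨hB g x hx.1, (D.U p).apply_mem_toSubmodule g hx.2⟩) with h | h
  · have h1 := hd.disjoint_sup_right_of_disjoint_sup_left (disjoint_iff.2 h)
    have h2 : insert p Q ∈ Finset.univ.filter fun Q : Finset (Fin k) =>
        Disjoint A (⨆ p ∈ Q, (D.U p).toSubmodule) := by
      rw [Finset.mem_filter, Finset.iSup_insert, sup_comm]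
      exact ⟨Finset.mem_univ _, h1⟩
    have h3 : p ∈ Q := hQ.2 h2 (Finset.subset_insert p Q) (Finset.mem_insert_self p Q)
    exact le_trans (le_iSup₂_of_le p h3 le_rfl) le_sup_right
  · exact inf_eq_right.1 h

/-- Two representations with decompositions that are given in adapted bases by the same matrices
on some blocks and by contragredient matrices on the others. -/
structure ContragredientFlip {X X' : Type*} [AddCommGroup X] [Module ℂ X] [AddCommGroup X']
    [Module ℂ X'] {s : ℕ} (T : Representation ℂ G X) (T' : Representation ℂ G X')
    (U : Fin s → Submodule ℂ X) (U' : Fin s → Submodule ℂ X') where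
  /-- the index type of the bases -/
  I : Type
  fintype : Fintype I
  decEq : DecidableEq I
  /-- the block of an index -/
  block : I → Fin s
  /-- the blocks with contragredient matrices -/
  flipped : Fin s → Prop
  decFlipped : DecidablePred flipped
  /-- the basis of the first space -/
  basis : Module.Basis I ℂ X
  /-- the basis of the second space -/
  basis' : Module.Basis I ℂ X'
  /-- the matrices of the first representation -/
  mat : G →* Matrix I I ℂ
  /-- the matrices of the second representation -/
  mat' : G →* Matrix I I ℂ
  span_eq : ∀ q, U q = Submodule.span ℂ (basis '' {i | block i = q})
  span_eq' : ∀ q, U' q = Submodule.span ℂ (basis' '' {i | block i = q})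
  mat_eq_zero : ∀ g i j, block i ≠ block j → mat g i j = 0
  mat'_eq : ∀ g i j, mat' g i j = if flipped (block j) then mat g⁻¹ j i else mat g i j
  apply_basis : ∀ g i, T g (basis i) = ∑ k, mat g k i • basis k
  apply_basis' : ∀ g i, T' g (basis' i) = ∑ k, mat' g k i • basis' k

attribute [instance] ContragredientFlip.fintype ContragredientFlip.decEq
  ContragredientFlip.decFlipped

/-- The vectors indexed by J span a complement of V, so their W-components form a basis of W, while
projecting the others to V along that complement gives a basis of V. The new basis combines the
latter with the dual of the former. -/
theorem exists_flip_basis {V W W' I : Type*} [AddCommGroup V] [Module ℂ V] [AddCommGroup W]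
    [Module ℂ W] [AddCommGroup W'] [Module ℂ W'] [Fintype I] [DecidableEq I]
    (e : W' ≃ₗ[ℂ] Module.Dual ℂ W) (b : Module.Basis I ℂ (V × W)) (J : I → Prop)
    (hc : IsCompl (LinearMap.ker (LinearMap.snd ℂ V W)) (Submodule.span ℂ (b '' {i | J i}))) :
    ∃ (P : V × W →ₗ[ℂ] V) (b' : Module.Basis I ℂ (V × W')), (∀ v, P (v, 0) = v) ∧
      (∀ i, J i → P (b i) = 0) ∧ (∀ i, ¬ J i → b' i = (P (b i), 0)) ∧
      (∀ i, J i → (b' i).1 = 0 ∧ ∀ j, J j → e (b' i).2 (b j).2 = if i = j then 1 else 0) ∧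
      ∀ f f' : Module.Dual ℂ W, (∀ j, J j → f (b j).2 = f' (b j).2) → f = f' := by
  classical
  let P : V × W →ₗ[ℂ] V := LinearMap.fst ℂ V W ∘ₗ Submodule.subtype _ ∘ₗ
    Submodule.projectionOnto _ _ hc
  have hP1 : ∀ v, P (v, 0) = v := by
    intro v
    have hv : ((v, 0) : V × W) ∈ LinearMap.ker (LinearMap.snd ℂ V W) := rfl
    simp only [P, LinearMap.comp_apply]
    rw [Submodule.projectionOnto_apply_of_mem_left hc hv]
    rfl
  have hP2 : ∀ x, P x = 0 ↔ x ∈ Submodule.span ℂ (b '' {i | J i}) := by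
    intro x
    rw [← Submodule.projectionOnto_apply_eq_zero_iff hc]
    simp only [P, LinearMap.comp_apply]
    constructor
    · intro h
      exact Subtype.ext (Prod.ext h (Submodule.projectionOnto _ _ hc x).2)
    · intro h
      rw [h]
      rfl
  have hPJ : ∀ i, J i → P (b i) = 0 := fun i hi => (hP2 _).2 (Submodule.subset_span ⟨i, hi, rfl⟩)
  have hr1 : Set.range (fun i : {i // J i} => b i) = b '' {i | J i} := by
    rw [Set.image_eq_range]; rfl
  have hr2 : Set.range (fun i : {i // ¬ J i} => b i) = b '' {i | ¬ J i} := by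
    rw [Set.image_eq_range]; rfl
  let bW : Module.Basis {i // J i} ℂ W := Module.Basis.mk
    (v := fun i => (LinearMap.snd ℂ V W) (b i))
    ((b.linearIndependent.comp (Subtype.val : {i // J i} → I) Subtype.val_injective).map (by
      rw [show Set.range (b ∘ (Subtype.val : {i // J i} → I)) = _ from hr1]
      exact hc.disjoint.symm)) (by
      rw [Set.range_comp' (LinearMap.snd ℂ V W) (fun i : {i // J i} => b i), Submodule.span_image, hr1]
      intro w _
      obtain ⟨x, hx, y, hy, hxy⟩ := Submodule.mem_sup.1
        (show ((0, w) : V × W) ∈ LinearMap.ker (LinearMap.snd ℂ V W) ⊔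
          Submodule.span ℂ (b '' {i | J i}) by rw [hc.sup_eq_top]; trivial)
      refine ⟨y, hy, ?_⟩
      have h1 := congrArg Prod.snd hxy
      have h2 : x.2 = 0 := hx
      rw [Prod.snd_add, h2, zero_add] at h1
      exact h1)
  let bV : Module.Basis {i // ¬ J i} ℂ V := Module.Basis.mk (v := fun i => P (b i))
    ((b.linearIndependent.comp (Subtype.val : {i // ¬ J i} → I) Subtype.val_injective).map (by
      rw [show Set.range (b ∘ (Subtype.val : {i // ¬ J i} → I)) = _ from hr2]
      have : LinearMap.ker P = Submodule.span ℂ (b '' {i | J i}) := by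
        ext x; exact hP2 x
      rw [this]
      refine b.linearIndependent.disjoint_span_image ?_
      rw [Set.disjoint_left]
      exact fun i hi hi' => hi hi')) (by
      intro v _
      rw [← hP1 v, ← b.sum_repr (v, 0), map_sum]
      refine Submodule.sum_mem _ fun i _ => ?_
      rw [map_smul]
      refine Submodule.smul_mem _ _ ?_
      by_cases hi : J i
      · rw [hPJ i hi]; exact Submodule.zero_mem _
      · exact Submodule.subset_span ⟨⟨i, hi⟩, rfl⟩)
  let bW' : Module.Basis {i // J i} ℂ W' := bW.dualBasis.map e.symm
  refine ⟨P, (bV.prod bW').reindex ((Equiv.sumComm _ _).trans (Equiv.sumCompl J)), hP1, hPJ, ?_, ?_, ?_⟩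
  · intro i hi
    rw [Module.Basis.reindex_apply, Equiv.symm_trans_apply, Equiv.sumCompl_symm_apply_of_neg hi]
    simp [bV]
  · intro i hi
    rw [Module.Basis.reindex_apply, Equiv.symm_trans_apply, Equiv.sumCompl_symm_apply_of_pos hi]
    refine ⟨by simp, fun j hj => ?_⟩
    have h1 : (b j).2 = bW ⟨j, hj⟩ := by simp [bW]
    rw [h1]
    simp [bW', Finsupp.single_apply, Subtype.ext_iff, eq_comm]
  · intro f f' h
    refine bW.ext fun j => ?_
    have h1 := h j j.2
    simpa [bW] using h1

theorem iSup_span_block {X I : Type*} [AddCommGroup X] [Module ℂ X] {s : ℕ}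
    (b : Module.Basis I ℂ X) (π : I → Fin s) (S : Set (Fin s)) :
    ⨆ q ∈ S, Submodule.span ℂ (b '' {i | π i = q}) = Submodule.span ℂ (b '' {i | π i ∈ S}) := by
  simp only [← Submodule.span_iUnion]
  congr 1
  ext x
  simp only [Set.mem_iUnion, Set.mem_image, Set.mem_ofPred_eq]
  constructor
  · rintro ⟨q, hq, i, rfl, rfl⟩; exact ⟨i, hq, rfl⟩
  · rintro ⟨i, hi, rfl⟩; exact ⟨_, hi, i, rfl, rfl⟩

theorem isInternal_span_block {X I : Type*} [AddCommGroup X] [Module ℂ X] {s : ℕ}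
    (b : Module.Basis I ℂ X) (π : I → Fin s) :
    DirectSum.IsInternal fun q => Submodule.span ℂ (b '' {i | π i = q}) := by
  refine DirectSum.isInternal_submodule_of_iSupIndep_of_iSup_eq_top ?_ ?_
  · intro p
    rw [show (⨆ j, ⨆ (_ : j ≠ p), Submodule.span ℂ (b '' {i | π i = j}))
      = Submodule.span ℂ (b '' {i | π i ∈ {j | j ≠ p}}) from iSup_span_block b π {j | j ≠ p}]
    refine b.linearIndependent.disjoint_span_image ?_
    rw [Set.disjoint_left]
    exact fun i hi hi' => hi' hi
  · have h := iSup_span_block b π Set.univ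
    simp only [Set.mem_univ, iSup_pos] at h
    rw [h, ← b.span_eq]
    congr 1
    ext x
    simp

theorem mem_span_block_iff {X I : Type*} [AddCommGroup X] [Module ℂ X] [Fintype I]
    (b : Module.Basis I ℂ X) (S : Set I) (x : X) :
    x ∈ Submodule.span ℂ (b '' S) ↔ ∀ i ∉ S, b.repr x i = 0 := by
  rw [Module.Basis.mem_span_image]
  constructor
  · intro h i hi
    by_contra h0
    exact hi (h (Finsupp.mem_support_iff.2 h0))
  · intro h i hi
    by_contra h0
    exact (Finsupp.mem_support_iff.1 hi) (h i h0)

/-- The matrices of a representation with respect to a basis. -/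
theorem exists_matrix {X I : Type*} [AddCommGroup X] [Module ℂ X] [Fintype I] [DecidableEq I]
    (b : Module.Basis I ℂ X) (T : Representation ℂ G X) :
    ∃ R : G →* Matrix I I ℂ, (∀ g i j, R g i j = b.repr (T g (b j)) i) ∧
      ∀ g i, T g (b i) = ∑ k, R g k i • b k :=
  ⟨{ toFun := fun g => LinearMap.toMatrix b b (T g)
     map_one' := by rw [map_one, LinearMap.toMatrix_one]
     map_mul' := fun g h => by rw [map_mul, LinearMap.toMatrix_mul] },
    fun g i j => LinearMap.toMatrix_apply b b _ i j, fun g i => by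
      conv_lhs => rw [← b.sum_repr (T g (b i))]
      exact Finset.sum_congr rfl fun k _ =>
        congrArg (· • b k) (LinearMap.toMatrix_apply b b _ k i).symm⟩

/-- Replacing the second summand of a representation by its dual replaces some of the irreducible
summands by their duals. -/
theorem exists_contragredientFlip {V W W' : Type*} [AddCommGroup V] [Module ℂ V]
    [FiniteDimensional ℂ V] [AddCommGroup W] [Module ℂ W] [FiniteDimensional ℂ W]
    [AddCommGroup W'] [Module ℂ W'] (ρ : Representation ℂ G V) (σ : Representation ℂ G W)
    (σ' : Representation ℂ G W') (e : W' ≃ₗ[ℂ] Module.Dual ℂ W)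
    (he : ∀ g w', e (σ' g w') = σ.dual g (e w')) {k : ℕ} (D : IrredDecomposition (ρ.prod σ) k) :
    ∃ D' : IrredDecomposition (ρ.prod σ') k, Nonempty (ContragredientFlip (ρ.prod σ) (ρ.prod σ')
      (fun p => (D.U p).toSubmodule) (fun p => (D'.U p).toSubmodule)) := by
  classical
  -- The kernel of the second projection is the copy of V. The summands indexed by Q span a
  -- complement to it, isomorphic to W, and these are the ones to be flipped.
  obtain ⟨Q, hQ⟩ := exists_isCompl_iSup D (LinearMap.ker (LinearMap.snd ℂ V W)) (by
    intro g x hx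
    have h1 : x.2 = 0 := hx
    change σ g x.2 = 0
    rw [h1, map_zero])
  obtain ⟨I, _, _, π, b, hU⟩ : ∃ (I : Type) (_ : Fintype I) (_ : DecidableEq I) (π : I → Fin k)
      (b : Module.Basis I ℂ (V × W)),
      ∀ q, (D.U q).toSubmodule = Submodule.span ℂ (b '' {i | π i = q}) := by
    refine ⟨Σ p, Fin (Module.finrank ℂ (D.U p).toSubmodule), inferInstance, inferInstance,
      Sigma.fst, D.isInternal.collectedBasis fun p => Module.finBasis ℂ (D.U p).toSubmodule, ?_⟩
    intro q
    apply le_antisymm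
    · intro x hx
      rw [mem_span_block_iff]
      intro i hi
      exact D.isInternal.collectedBasis_repr_of_mem_ne _ (i := q) (j := i.1) (Ne.symm hi) hx
    · rw [Submodule.span_le]
      rintro _ ⟨i, rfl, rfl⟩
      exact D.isInternal.collectedBasis_mem _ i
  have hbU : ∀ i : I, b i ∈ (D.U (π i)).toSubmodule := fun i => by
    rw [hU]; exact Submodule.subset_span ⟨i, rfl, rfl⟩
  let J : I → Prop := fun i => π i ∈ Q
  have hspanJ : (⨆ p ∈ Q, (D.U p).toSubmodule) = Submodule.span ℂ (b '' {i | J i}) := by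
    have h := iSup_span_block b π (Q : Set (Fin k))
    simp only [← hU] at h
    exact h
  rw [hspanJ] at hQ
  obtain ⟨P, b', hP1, hPJ, hb'1, hb'2, hext⟩ := exists_flip_basis e b J hQ
  obtain ⟨R, hRapply, hT⟩ := exists_matrix b (ρ.prod σ)
  obtain ⟨R', hR'apply, hT'⟩ := exists_matrix b' (ρ.prod σ')
  have hR : ∀ g i j, π i ≠ π j → R g i j = 0 := by
    intro g i j hij
    rw [hRapply]
    have h1 := (D.U (π j)).apply_mem_toSubmodule g (hbU j)
    rw [hU, mem_span_block_iff] at h1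
    exact h1 i hij
  -- P is the projection onto V along a stable complement, hence equivariant.
  have hPT : ∀ g x, P (ρ.prod σ g x) = ρ g (P x) := by
    intro g x
    obtain ⟨y, hy, z, hz, rfl⟩ := Submodule.mem_sup.1 (show x ∈ LinearMap.ker (LinearMap.snd ℂ V W) ⊔
      Submodule.span ℂ (b '' {i | J i}) by rw [hQ.sup_eq_top]; trivial)
    have hy' : y = (y.1, 0) := Prod.ext rfl hy
    have hPz : ∀ z ∈ Submodule.span ℂ (b '' {i | J i}), P z = 0 := by
      intro z hz
      have : Submodule.span ℂ (b '' {i | J i}) ≤ LinearMap.ker P := by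
        rw [Submodule.span_le]
        rintro _ ⟨i, hi, rfl⟩
        exact hPJ i hi
      exact this hz
    have hTz : ρ.prod σ g z ∈ Submodule.span ℂ (b '' {i | J i}) := by
      rw [← hspanJ] at hz ⊢
      suffices h : (⨆ p ∈ Q, (D.U p).toSubmodule)
        ≤ (⨆ p ∈ Q, (D.U p).toSubmodule).comap (ρ.prod σ g) from h hz
      refine iSup₂_le fun q hq x hx => ?_
      exact Submodule.mem_iSup_of_mem q (Submodule.mem_iSup_of_mem hq
        ((D.U q).apply_mem_toSubmodule g hx))
    rw [map_add, map_add, map_add, hPz z hz, hPz _ hTz, hy']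
    have : ρ.prod σ g (y.1, 0) = (ρ g y.1, 0) := Prod.ext rfl (map_zero (σ g))
    rw [this, hP1, hP1, add_zero, add_zero]
  have hJR : ∀ g i j, J i → ¬ J j → R g i j = 0 := fun g i j hi hj =>
    hR g i j fun h => hj (show π j ∈ Q from h ▸ hi)
  have hJR' : ∀ g i j, ¬ J i → J j → R g i j = 0 := fun g i j hi hj =>
    hR g i j fun h => hi (show π i ∈ Q from h ▸ hj)
  -- Vectors with index outside Q are equivariant images under P and keep their matrices; those with
  -- index in Q pair as a dual basis and receive the contragredient matrices.
  have hact : ∀ g i, ρ.prod σ' g (b' i)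
      = ∑ k, (if J i then R g⁻¹ i k else R g k i) • b' k := by
    intro g i
    by_cases hi : J i
    · simp only [hi, if_true]
      refine Prod.ext ?_ (e.injective (hext _ _ fun j hj => ?_))
      · rw [Prod.fst_sum]
        change ρ g (b' i).1 = _
        rw [(hb'2 i hi).1, map_zero]
        refine (Finset.sum_eq_zero fun k _ => ?_).symm
        by_cases hk : J k
        · rw [Prod.smul_fst, (hb'2 k hk).1, smul_zero]
        · rw [hJR g⁻¹ i k hi hk, zero_smul]; rfl
      · have h1 : σ g⁻¹ (b j).2 = ∑ k, R g⁻¹ k j • (b k).2 := by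
          have := congrArg Prod.snd (hT g⁻¹ j)
          rw [Prod.snd_sum] at this
          exact this
        have h2 : e (σ' g (b' i).2) (b j).2 = e (b' i).2 (σ g⁻¹ (b j).2) := by
          rw [he]; rfl
        change e (σ' g (b' i).2) (b j).2 = _
        rw [h2, h1, Prod.snd_sum, map_sum, map_sum, LinearMap.sum_apply]
        have h3 : ∀ k, e (b' i).2 (R g⁻¹ k j • (b k).2) = if i = k then R g⁻¹ i j else 0 := by
          intro k
          by_cases hk : J k
          · rw [map_smul, (hb'2 i hi).2 k hk]
            split_ifs with h
            · subst h; simp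
            · simp
          · rw [hJR' g⁻¹ k j hk hj, zero_smul, map_zero, if_neg]
            rintro rfl
            exact hk hi
        have h4 : ∀ k, e (R g⁻¹ i k • b' k).2 (b j).2 = if k = j then R g⁻¹ i j else 0 := by
          intro k
          rw [Prod.smul_snd, map_smul, LinearMap.smul_apply]
          by_cases hk : J k
          · rw [(hb'2 k hk).2 j hj]
            split_ifs with h
            · subst h; simp
            · simp
          · rw [hJR g⁻¹ i k hi hk, zero_smul, if_neg]
            rintro rfl
            exact hk hj
        rw [Finset.sum_congr rfl fun k _ => h3 k, Finset.sum_congr rfl fun k _ => h4 k]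
        simp
    · simp only [hi, if_false]
      have h1 : ρ.prod σ' g (b' i) = (P (ρ.prod σ g (b i)), 0) := by
        rw [hb'1 i hi, hPT]
        exact Prod.ext rfl (map_zero (σ' g))
      rw [h1, hT, map_sum]
      have h2 : ∀ k, R g k i • b' k = (P (R g k i • b k), 0) := by
        intro k
        by_cases hk : J k
        · rw [hJR g k i hk hi, zero_smul, zero_smul, map_zero]; rfl
        · rw [hb'1 k hk, map_smul]
          exact Prod.ext rfl (smul_zero _)
      rw [Finset.sum_congr rfl fun k _ => h2 k]
      refine Prod.ext ?_ ?_
      · rw [Prod.fst_sum]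
      · rw [Prod.snd_sum]; exact Finset.sum_const_zero.symm
  have hR' : ∀ g i j, R' g i j = if J j then R g⁻¹ j i else R g i j := by
    intro g i j
    rw [hR'apply, hact, map_sum,
      Finsupp.finsetSum_apply]
    split_ifs <;> simp [Finsupp.single_apply]
  have hstable : ∀ p g, ∀ x ∈ Submodule.span ℂ (b' '' {i | π i = p}),
      ρ.prod σ' g x ∈ Submodule.span ℂ (b' '' {i | π i = p}) := by
    intro p g x hx
    suffices h : Submodule.span ℂ (b' '' {i | π i = p})
      ≤ (Submodule.span ℂ (b' '' {i | π i = p})).comap (ρ.prod σ' g) from h hx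
    rw [Submodule.span_le]
    rintro _ ⟨i, rfl, rfl⟩
    rw [SetLike.mem_coe, Submodule.mem_comap, hact]
    refine Submodule.sum_mem _ fun k _ => ?_
    by_cases hk : π k = π i
    · exact Submodule.smul_mem _ _ (Submodule.subset_span ⟨k, hk, rfl⟩)
    · rw [hR g k i hk, hR g⁻¹ i k (Ne.symm hk), ite_self, zero_smul]
      exact Submodule.zero_mem _
  have hirr : ∀ p, (⟨Submodule.span ℂ (b' '' {i | π i = p}), fun g x hx => hstable p g x hx⟩ :
      Subrepresentation (ρ.prod σ')).toRepresentation.IsIrreducible := by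
    intro p
    obtain ⟨hne, hD⟩ := (isIrreducible_iff _).1 (D.irreducible p)
    rw [isIrreducible_iff]
    refine ⟨?_, fun N hN hNs => ?_⟩
    · intro h0
      have h1 : ∀ i, π i ≠ p := by
        intro i hi
        have : b' i ∈ Submodule.span ℂ (b' '' {i | π i = p}) := Submodule.subset_span ⟨i, hi, rfl⟩
        dsimp only at h0
        rw [h0, Submodule.mem_bot] at this
        exact b'.ne_zero i this
      apply hne
      rw [hU, Submodule.span_eq_bot]
      rintro _ ⟨i, hi, rfl⟩
      exact absurd hi (h1 i)
    dsimp only at hN ⊢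
    have hrepr : ∀ y ∈ N, ∀ i, π i ≠ p → b'.repr y i = 0 := fun y hy i hi =>
      (mem_span_block_iff b' _ y).1 (hN hy) i hi
    by_cases hp : p ∈ Q
    · have hpair : ∀ y ∈ N, ∀ i, π i = p → e y.2 (b i).2 = b'.repr y i := by
        intro y hy i hi
        have hiJ : J i := show π i ∈ Q from hi ▸ hp
        conv_lhs => rw [← b'.sum_repr y]
        rw [Prod.snd_sum, map_sum, LinearMap.sum_apply, Finset.sum_eq_single i]
        · rw [Prod.smul_snd, map_smul, LinearMap.smul_apply, (hb'2 i hiJ).2 i hiJ, if_pos rfl,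
            smul_eq_mul, mul_one]
        · intro k _ hk
          rw [Prod.smul_snd, map_smul, LinearMap.smul_apply]
          by_cases hkp : π k = p
          · rw [(hb'2 k (show π k ∈ Q from hkp ▸ hp)).2 i hiJ, if_neg hk, smul_zero]
          · rw [hrepr y hy k hkp, zero_smul]
        · simp
      -- The annihilator of N in the original summand. It is stable, hence zero or everything, which
      -- makes N everything or zero.
      let M : Submodule ℂ (V × W) := (D.U p).toSubmodule ⊓
        ⨅ y : N, LinearMap.ker (e (y : V × W').2 ∘ₗ LinearMap.snd ℂ V W)
      have hM : ∀ x, x ∈ M ↔ x ∈ (D.U p).toSubmodule ∧ ∀ y ∈ N, e y.2 x.2 = 0 := by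
        intro x
        simp [M, Submodule.mem_iInf]
      rcases hD M inf_le_left (by
        intro g x hx
        rw [hM] at hx ⊢
        refine ⟨(D.U p).apply_mem_toSubmodule g hx.1, fun y hy => ?_⟩
        have h1 := hx.2 _ (hNs g⁻¹ y hy)
        have h2 : e (σ' g⁻¹ y.2) x.2 = e y.2 (σ g x.2) := by
          rw [he]
          change e y.2 (σ g⁻¹⁻¹ x.2) = _
          rw [inv_inv]
        exact h2.symm.trans h1) with h | h
      · right
        refine le_antisymm hN fun y hy => ?_
        by_contra hyN
        obtain ⟨f, hfy, hf⟩ := Submodule.exists_dual_map_eq_bot_of_notMem hyN inferInstance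
        have hfN : ∀ z ∈ N, f z = 0 := by
          intro z hz
          have : f z ∈ N.map f := ⟨z, hz, rfl⟩
          rw [hf] at this
          exact this
        -- A functional killing N corresponds, through the dual bases, to a vector of the
        -- annihilator.
        have hx : ∑ i with π i = p, f (b' i) • b i ∈ M := by
          rw [hM]
          constructor
          · refine Submodule.sum_mem _ fun i hi => Submodule.smul_mem _ _ ?_
            rw [← (Finset.mem_filter.1 hi).2]
            exact hbU i
          · intro z hz
            rw [Prod.snd_sum, map_sum, ← hfN z hz]
            conv_rhs => rw [← b'.sum_repr z, map_sum]
            rw [Finset.sum_filter]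
            refine Finset.sum_congr rfl fun i _ => ?_
            split_ifs with hi
            · rw [Prod.smul_snd, map_smul, hpair z hz i hi, map_smul, smul_eq_mul, smul_eq_mul,
                mul_comm]
            · rw [hrepr z hz i hi, zero_smul, map_zero]
        rw [h, Submodule.mem_bot] at hx
        have hfb : ∀ i, π i = p → f (b' i) = 0 := by
          intro i hi
          have h1 := linearIndependent_iff'.1 b.linearIndependent _ _ hx i
            (Finset.mem_filter.2 ⟨Finset.mem_univ _, hi⟩)
          exact h1
        apply hfy
        have : Submodule.span ℂ (b' '' {i | π i = p}) ≤ LinearMap.ker f := by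
          rw [Submodule.span_le]
          rintro _ ⟨i, hi, rfl⟩
          exact hfb i hi
        exact this hy
      · left
        rw [eq_bot_iff]
        intro y hy
        rw [Submodule.mem_bot, ← b'.repr.map_eq_zero_iff]
        ext i
        rw [Finsupp.zero_apply]
        by_cases hi : π i = p
        · rw [← hpair y hy i hi]
          have : b i ∈ M := by rw [h, ← hi]; exact hbU i
          exact ((hM _).1 this).2 y hy
        · exact hrepr y hy i hi
    · let Ψ : V × W →ₗ[ℂ] V × W' := LinearMap.inl ℂ V W' ∘ₗ P
      have hΨT : ∀ g x, Ψ (ρ.prod σ g x) = ρ.prod σ' g (Ψ x) := by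
        intro g x
        change (P (ρ.prod σ g x), (0 : W')) = (ρ g (P x), σ' g 0)
        rw [hPT, map_zero]
      have hΨb : ∀ i, π i = p → Ψ (b i) = b' i := fun i hi =>
        (hb'1 i fun h => hp (hi ▸ h)).symm
      rcases hD ((D.U p).toSubmodule ⊓ N.comap Ψ) inf_le_left (fun g x hx =>
        ⟨(D.U p).apply_mem_toSubmodule g hx.1, by
          rw [SetLike.mem_coe, Submodule.mem_comap, hΨT]
          exact hNs g _ hx.2⟩) with h | h
      · left
        rw [eq_bot_iff]
        intro y hy
        have hx : ∑ i, b'.repr y i • b i ∈ (D.U p).toSubmodule ⊓ N.comap Ψ := by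
          constructor
          · refine Submodule.sum_mem _ fun i _ => ?_
            by_cases hi : π i = p
            · refine Submodule.smul_mem _ _ ?_
              rw [← hi]
              exact hbU i
            · rw [hrepr y hy i hi, zero_smul]; exact Submodule.zero_mem _
          · rw [SetLike.mem_coe, Submodule.mem_comap, map_sum]
            have : ∑ i, Ψ (b'.repr y i • b i) = y := by
              conv_rhs => rw [← b'.sum_repr y]
              refine Finset.sum_congr rfl fun i _ => ?_
              by_cases hi : π i = p
              · rw [map_smul, hΨb i hi]
              · rw [hrepr y hy i hi, zero_smul, zero_smul, map_zero]
            rw [this]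
            exact hy
        rw [h, Submodule.mem_bot] at hx
        rw [Submodule.mem_bot, ← b'.repr.map_eq_zero_iff]
        ext i
        exact linearIndependent_iff'.1 b.linearIndependent _ _ hx i (Finset.mem_univ i)
      · right
        refine le_antisymm hN ?_
        rw [Submodule.span_le]
        rintro _ ⟨i, hi, rfl⟩
        have : b i ∈ (D.U p).toSubmodule ⊓ N.comap Ψ := by
          rw [h]
          have := hbU i
          rwa [hi] at this
        rw [← hΨb i hi]
        exact this.2
  refine ⟨⟨fun p => ⟨_, fun g x hx => hstable p g x hx⟩, hirr, isInternal_span_block b' π⟩,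
    ⟨I, inferInstance, inferInstance, π, fun p => p ∈ Q, inferInstance, b, b', R, R', hU,
      fun _ => rfl, hR, hR', hT, hT'⟩⟩

end FlipDecomposition
end SuperMF

namespace SuperMF

/-! ### Assembling the criterion and both flips -/

section Main

variable {G : Type*} [Group G]

/-- Every endomorphism of N extends to a linear map of the ambient space, so working with ambient
maps restricted to N loses nothing. `CommOn` uses them to avoid subtypes. -/
theorem commOn_iff {Y : Type*} [AddCommGroup Y] [Module ℂ Y] {ρ : Representation ℂ G Y}
    (N : Subrepresentation ρ) : CommOn (fun g => ρ g) N.toSubmodule ↔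
      ∀ f h : Representation.IntertwiningMap N.toRepresentation N.toRepresentation,
        f * h = h * f := by
  constructor
  · intro hc f h
    have ext : ∀ f : Representation.IntertwiningMap N.toRepresentation N.toRepresentation,
        ∃ F : Y →ₗ[ℂ] Y, ∀ x : N.toSubmodule, F x = f x := by
      intro f
      obtain ⟨F, hF⟩ := LinearMap.exists_extend (N.toSubmodule.subtype ∘ₗ f.toLinearMap)
      exact ⟨F, fun x => LinearMap.congr_fun hF x⟩
    obtain ⟨F, hF⟩ := ext f
    obtain ⟨H, hH⟩ := ext h
    have eqv : ∀ (f : Representation.IntertwiningMap N.toRepresentation N.toRepresentation)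
        (F : Y →ₗ[ℂ] Y), (∀ x : N.toSubmodule, F x = f x) →
        (∀ x ∈ N.toSubmodule, F x ∈ N.toSubmodule) ∧
        ∀ g, ∀ x ∈ N.toSubmodule, F (ρ g x) = ρ g (F x) := by
      intro f F hF
      constructor
      · intro x hx
        rw [hF ⟨x, hx⟩]
        exact (f ⟨x, hx⟩).2
      · intro g x hx
        have h1 := hF (N.toRepresentation g ⟨x, hx⟩)
        have h2 := LinearMap.congr_fun (f.isIntertwining' g) ⟨x, hx⟩
        have h3 := congrArg Subtype.val h2
        rw [hF ⟨x, hx⟩]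
        exact h1.trans h3
    refine Representation.IntertwiningMap.ext (LinearMap.ext fun x => Subtype.ext ?_)
    have h1 := hc F H (eqv f F hF).1 (eqv h H hH).1 (eqv f F hF).2 (eqv h H hH).2 x x.2
    rw [hH, hF, hF, hH] at h1
    exact h1
  · intro hc f h hf hh hfe hhe x hx
    let f' : Representation.IntertwiningMap N.toRepresentation N.toRepresentation :=
      { f.restrict hf with
        isIntertwining' := fun g => LinearMap.ext fun x => Subtype.ext (hfe g x x.2) }
    let h' : Representation.IntertwiningMap N.toRepresentation N.toRepresentation :=
      { h.restrict hh with
        isIntertwining' := fun g => LinearMap.ext fun x => Subtype.ext (hhe g x x.2) }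
    have := congrArg (fun k : Representation.IntertwiningMap N.toRepresentation N.toRepresentation
      => ((k ⟨x, hx⟩ : N.toSubmodule) : Y)) (hc f' h')
    exact this

theorem semisimpleOn_top {Y : Type*} [AddCommGroup Y] [Module ℂ Y] {ρ : Representation ℂ G Y}
    (N : Subrepresentation ρ) (h : SemisimpleOn (fun g => ρ g) N.toSubmodule) :
    SemisimpleOn (fun g => N.toRepresentation g) ⊤ := by
  intro M _ hM
  obtain ⟨M', hM', hs, hinf, hsup⟩ := h (M.map N.toSubmodule.subtype)
    (Submodule.map_subtype_le _ _) (by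
      rintro g _ ⟨x, hx, rfl⟩
      exact ⟨_, hM g x hx, rfl⟩)
  refine ⟨M'.comap N.toSubmodule.subtype, le_top, fun g x hx => hs g _ hx, ?_, ?_⟩
  · rw [eq_bot_iff]
    rintro x ⟨hx, hx'⟩
    have : (x : Y) ∈ M.map N.toSubmodule.subtype ⊓ M' := ⟨⟨x, hx, rfl⟩, hx'⟩
    rw [hinf, Submodule.mem_bot] at this
    exact (Submodule.mem_bot ℂ).2 (Subtype.ext this)
  · rw [eq_top_iff]
    intro x _
    obtain ⟨_, ⟨a, ha, rfl⟩, c, hc, hac⟩ := Submodule.mem_sup.1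
      (show (x : Y) ∈ M.map N.toSubmodule.subtype ⊔ M' by rw [hsup]; exact x.2)
    refine Submodule.mem_sup.2 ⟨a, ha, ⟨c, hM' hc⟩, hc, Subtype.ext hac⟩

section FiniteDimensional

variable {V V₀ V₁ : Type*} [AddCommGroup V] [Module ℂ V] [FiniteDimensional ℂ V]
  [AddCommGroup V₀] [Module ℂ V₀] [FiniteDimensional ℂ V₀]
  [AddCommGroup V₁] [Module ℂ V₁] [FiniteDimensional ℂ V₁]

theorem fg_list_prod {A : Type*} [Ring A] [Algebra ℂ A] (l : List (Submodule ℂ A))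
    (hl : ∀ M ∈ l, M.FG) : l.prod.FG := by
  induction l with
  | nil => rw [List.prod_nil, Submodule.one_eq_span]; exact Submodule.fg_span_singleton _
  | cons M l ih =>
    rw [List.prod_cons]
    exact (hl M List.mem_cons_self).mul (ih fun M hM => hl M (List.mem_cons_of_mem _ hM))

theorem fg_symComponent {k : ℕ} (U : Fin k → Submodule ℂ V) (i : Fin k → ℕ) :
    (symComponent U i).FG := by
  unfold symComponent
  rw [← Finset.prod_map_toList]
  refine fg_list_prod _ fun M hM => ?_
  obtain ⟨p, -, rfl⟩ := List.mem_map.1 hM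
  exact ((IsNoetherian.noetherian (U p)).map _).pow _

theorem fg_extComponent {k : ℕ} (U : Fin k → Submodule ℂ V) (i : Fin k → ℕ) :
    (extComponent U i).FG := by
  unfold extComponent
  refine fg_list_prod _ fun M hM => ?_
  obtain ⟨p, rfl⟩ := List.mem_ofFn.1 hM
  exact ((IsNoetherian.noetherian (U p)).map _).pow _

theorem finiteDimensional_component {ρ₀ : Representation ℂ G V₀} {ρ₁ : Representation ℂ G V₁}
    {k l : ℕ} (U : Fin k → Subrepresentation ρ₀) (Y : Fin l → Subrepresentation ρ₁)
    (i : Fin k → ℕ) (j : Fin l → ℕ) :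
    FiniteDimensional ℂ (component U Y i j).toSubmodule :=
  Module.Finite.iff_fg.2 ((fg_symComponent _ i).map₂ _ (fg_extComponent _ j))

/-- A holomorphic representation of a connected complex Lie group is super multiplicity-free if and
only if the equivariant endomorphisms of all components commute. -/
theorem isSuperMF_iff {E : Type*} [NormedAddCommGroup E] [NormedSpace ℂ E]
    [FiniteDimensional ℂ E] [TopologicalSpace G] [ChartedSpace E G] [LieGroup 𝓘(ℂ, E) ω G]
    [ConnectedSpace G]
    {ρ₀ : Representation ℂ G V₀} {ρ₁ : Representation ℂ G V₁}
    (hρ₀ : IsHolomorphicRep (E := E) ρ₀) (hρ₁ : IsHolomorphicRep (E := E) ρ₁) :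
    IsSuperMF ρ₀ ρ₁ ↔ ∃ (k l : ℕ) (D₀ : IrredDecomposition ρ₀ k) (D₁ : IrredDecomposition ρ₁ l),
      ∀ i j, CommOn (fun g => superSymRep ρ₀ ρ₁ g) (component D₀.U D₁.U i j).toSubmodule := by
  have hss : ∀ {k l : ℕ} (D₀ : IrredDecomposition ρ₀ k) (D₁ : IrredDecomposition ρ₁ l)
      (i : Fin k → ℕ) (j : Fin l → ℕ),
      SemisimpleOn (Y := (component D₀.U D₁.U i j).toSubmodule)
        (fun g : G => (component D₀.U D₁.U i j).toRepresentation g) ⊤ := fun D₀ D₁ i j =>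
    semisimpleOn_top _ (semisimpleOn_component hρ₀ hρ₁ D₀ D₁ i j)
  constructor
  · rintro ⟨k, l, D₀, D₁, h⟩
    refine ⟨k, l, D₀, D₁, fun i j => ?_⟩
    have := finiteDimensional_component D₀.U D₁.U i j
    rw [commOn_iff]
    exact comm_of_rank_le_one _ (hss D₀ D₁ i j) (h i j)
  · rintro ⟨k, l, D₀, D₁, h⟩
    refine ⟨k, l, D₀, D₁, fun i j Γ _ _ _ γ hγ => ?_⟩
    have := finiteDimensional_component D₀.U D₁.U i j
    exact rank_le_one_of_comm _ (hss D₀ D₁ i j) ((commOn_iff _).1 (h i j)) γ hγ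

end FiniteDimensional

section Flip

variable {X₀ X₁ X₀' X₁' : Type*} [AddCommGroup X₀] [Module ℂ X₀] [AddCommGroup X₁] [Module ℂ X₁]
  [FiniteDimensional ℂ X₁]
  [AddCommGroup X₀'] [Module ℂ X₀'] [AddCommGroup X₁'] [Module ℂ X₁']

/-- Commutativity of the equivariant endomorphisms of all components is invariant under
contragredient flips in the even and in the odd part. -/
theorem commOn_component_of_flip {T₀ : Representation ℂ G X₀} {T₁ : Representation ℂ G X₁}
    {T₀' : Representation ℂ G X₀'} {T₁' : Representation ℂ G X₁'} {k l : ℕ}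
    {U : Fin k → Subrepresentation T₀} {Y : Fin l → Subrepresentation T₁}
    {U' : Fin k → Subrepresentation T₀'} {Y' : Fin l → Subrepresentation T₁'}
    (F₀ : ContragredientFlip T₀ T₀' (fun p => (U p).toSubmodule) fun p => (U' p).toSubmodule)
    (F₁ : ContragredientFlip T₁ T₁' (fun p => (Y p).toSubmodule) fun p => (Y' p).toSubmodule)
    (h : ∀ i j, CommOn (fun g => superSymRep T₀ T₁ g) (component U Y i j).toSubmodule)
    (i : Fin k → ℕ) (j : Fin l → ℕ) :
    CommOn (fun g => superSymRep T₀' T₁' g) (component U' Y' i j).toSubmodule := by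
  -- The even part is flipped first, with the odd component as a fixed finite-dimensional
  -- coefficient space.
  have heven : ∀ i j, CommOn (fun g => superSymRep T₀' T₁ g) (component U' Y i j).toSubmodule := by
    intro i j
    have : FiniteDimensional ℂ (extComponent (fun q => (Y q).toSubmodule) j) :=
      Module.Finite.iff_fg.2 (fg_extComponent _ j)
    exact commOn_tprod_of_contragredient F₀.basis F₀.basis' F₀.block F₀.flipped F₀.span_eq
      F₀.span_eq' T₀ T₀' F₀.mat F₀.mat' F₀.mat_eq_zero F₀.mat'_eq F₀.apply_basis F₀.apply_basis'
      (extRep T₁) _ (fun g z hz => extComponent_stable T₁ Y j g ⟨z, hz, rfl⟩)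
      (fun d => h d j) i
  -- The odd part is then flipped by tensoring the star with the identity, which matches each
  -- nonzero component with another component, up to a character.
  obtain ⟨L, hinj, hL, hmap⟩ := exists_star F₁.basis F₁.basis' F₁.block F₁.flipped F₁.span_eq
      F₁.span_eq' T₁ T₁' F₁.mat F₁.mat' F₁.mat_eq_zero F₁.mat'_eq F₁.apply_basis F₁.apply_basis'
  rcases hmap j with h0 | ⟨j', hj'⟩
  · have hbot : (component U' Y' i j).toSubmodule = ⊥ := by
      simp only [component, h0, Submodule.map₂_bot_right]
    intro f h _ _ _ _ x hx
    rw [hbot, Submodule.mem_bot] at hx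
    simp only [hx, map_zero]
  · refine (heven i j').of_equiv
      (fun g x hx => (component U' Y' i j).apply_mem_toSubmodule g hx) (L.lTensor _)
      (fun x _ hx => ?_) ?_ fun g => ?_
    · exact Module.Flat.lTensor_preserves_injective_linearMap L hinj (hx.trans (map_zero _).symm)
    · simp only [component]
      rw [← hj', Submodule.map₂_map_right, Submodule.map_map₂]
      rfl
    · obtain ⟨c, hc, hcL⟩ := hL g
      suffices hx : ∀ x, L.lTensor (SymmetricAlgebra ℂ X₀') (superSymRep T₀' T₁' g x) =
          c • superSymRep T₀' T₁ g (L.lTensor _ x) from ⟨c, hc, fun x _ => hx x⟩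
      intro x
      induction x using TensorProduct.induction_on with
      | zero => simp
      | tmul a y =>
        rw [superSymRep_tmul, LinearMap.lTensor_tmul, LinearMap.lTensor_tmul, superSymRep_tmul,
          hcL, TensorProduct.tmul_smul]
      | add x y hx hy => simp only [map_add, smul_add, hx, hy]

end Flip

theorem IsHolomorphicRep.prod {E : Type*} [NormedAddCommGroup E] [NormedSpace ℂ E]
    [TopologicalSpace G] [ChartedSpace E G]
    {V W : Type*} [AddCommGroup V] [Module ℂ V] [AddCommGroup W] [Module ℂ W]
    {ρ : Representation ℂ G V} {σ : Representation ℂ G W} (hρ : IsHolomorphicRep (E := E) ρ)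
    (hσ : IsHolomorphicRep (E := E) σ) : IsHolomorphicRep (E := E) (ρ.prod σ) := by
  intro v φ
  refine ((hρ v.1 (φ ∘ₗ LinearMap.inl ℂ V W)).add (hσ v.2 (φ ∘ₗ LinearMap.inr ℂ V W))).congr
    fun g => ?_
  simp only [Pi.add_apply, LinearMap.comp_apply, ← map_add]
  congr 1
  simp

/-- In finite dimension every functional on the dual is evaluation at a vector, so a matrix
coefficient of the dual is one of σ composed with the holomorphic inversion. -/
theorem IsHolomorphicRep.dual {E : Type*} [NormedAddCommGroup E] [NormedSpace ℂ E]
    [TopologicalSpace G] [ChartedSpace E G] [LieGroup 𝓘(ℂ, E) ω G]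
    {W : Type*} [AddCommGroup W] [Module ℂ W] [FiniteDimensional ℂ W]
    {σ : Representation ℂ G W} (hσ : IsHolomorphicRep (E := E) σ) :
    IsHolomorphicRep (E := E) σ.dual := by
  intro f φ
  obtain ⟨w, rfl⟩ := (Module.evalEquiv ℂ W).surjective φ
  exact (hσ w f).comp (contMDiff_inv 𝓘(ℂ, E) ω)

/-- One direction of the invariance of super multiplicity-freeness under dualizing a summand. -/
theorem IsSuperMF.flip {E : Type*} [NormedAddCommGroup E] [NormedSpace ℂ E] [FiniteDimensional ℂ E]
    [TopologicalSpace G] [ChartedSpace E G] [LieGroup 𝓘(ℂ, E) ω G] [ConnectedSpace G]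
    {V₀ V₁ W₀ W₁ W₀' W₁' : Type*}
    [AddCommGroup V₀] [Module ℂ V₀] [FiniteDimensional ℂ V₀]
    [AddCommGroup V₁] [Module ℂ V₁] [FiniteDimensional ℂ V₁]
    [AddCommGroup W₀] [Module ℂ W₀] [FiniteDimensional ℂ W₀]
    [AddCommGroup W₁] [Module ℂ W₁] [FiniteDimensional ℂ W₁]
    [AddCommGroup W₀'] [Module ℂ W₀'] [FiniteDimensional ℂ W₀']
    [AddCommGroup W₁'] [Module ℂ W₁'] [FiniteDimensional ℂ W₁']
    {ρ₀ : Representation ℂ G V₀} {ρ₁ : Representation ℂ G V₁}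
    {σ₀ : Representation ℂ G W₀} {σ₁ : Representation ℂ G W₁}
    {σ₀' : Representation ℂ G W₀'} {σ₁' : Representation ℂ G W₁'}
    (hρ₀ : IsHolomorphicRep (E := E) ρ₀) (hρ₁ : IsHolomorphicRep (E := E) ρ₁)
    (hσ₀ : IsHolomorphicRep (E := E) σ₀) (hσ₁ : IsHolomorphicRep (E := E) σ₁)
    (hσ₀' : IsHolomorphicRep (E := E) σ₀') (hσ₁' : IsHolomorphicRep (E := E) σ₁')
    (e₀ : W₀' ≃ₗ[ℂ] Module.Dual ℂ W₀) (he₀ : ∀ g w, e₀ (σ₀' g w) = σ₀.dual g (e₀ w))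
    (e₁ : W₁' ≃ₗ[ℂ] Module.Dual ℂ W₁) (he₁ : ∀ g w, e₁ (σ₁' g w) = σ₁.dual g (e₁ w))
    (h : IsSuperMF (ρ₀.prod σ₀) (ρ₁.prod σ₁)) : IsSuperMF (ρ₀.prod σ₀') (ρ₁.prod σ₁') := by
  rw [isSuperMF_iff (hρ₀.prod hσ₀) (hρ₁.prod hσ₁)] at h
  rw [isSuperMF_iff (hρ₀.prod hσ₀') (hρ₁.prod hσ₁')]
  obtain ⟨k, l, D₀, D₁, h⟩ := h
  obtain ⟨D₀', ⟨F₀⟩⟩ := exists_contragredientFlip ρ₀ σ₀ σ₀' e₀ he₀ D₀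
  obtain ⟨D₁', ⟨F₁⟩⟩ := exists_contragredientFlip ρ₁ σ₁ σ₁' e₁ he₁ D₁
  exact ⟨k, l, D₀', D₁', commOn_component_of_flip F₀ F₁ h⟩

theorem evalEquiv_equivariant {W : Type*} [AddCommGroup W] [Module ℂ W] [FiniteDimensional ℂ W]
    (σ : Representation ℂ G W) (g : G) (w : W) :
    Module.evalEquiv ℂ W (σ g w) = σ.dual.dual g (Module.evalEquiv ℂ W w) := by
  ext f
  change f (σ g w) = f (σ g⁻¹⁻¹ w)
  rw [inv_inv]

end Main
end SuperMF

theorem corollary3p5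
    {E : Type*} [NormedAddCommGroup E] [NormedSpace ℂ E] [FiniteDimensional ℂ E] [CompleteSpace E]
    {G : Type*} [Group G] [TopologicalSpace G] [ChartedSpace E G] [LieGroup 𝓘(ℂ, E) ω G]
    [ConnectedSpace G] [LieAlgebra.IsSemisimple ℂ (GroupLieAlgebra 𝓘(ℂ, E) G)]
    {V₀ V₁ W₀ W₁ : Type*}
    [AddCommGroup V₀] [Module ℂ V₀] [FiniteDimensional ℂ V₀]
    [AddCommGroup V₁] [Module ℂ V₁] [FiniteDimensional ℂ V₁]
    [AddCommGroup W₀] [Module ℂ W₀] [FiniteDimensional ℂ W₀]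
    [AddCommGroup W₁] [Module ℂ W₁] [FiniteDimensional ℂ W₁]
    (ρ₀ : Representation ℂ G V₀) (ρ₁ : Representation ℂ G V₁)
    (σ₀ : Representation ℂ G W₀) (σ₁ : Representation ℂ G W₁)
    (hρ₀ : SuperMF.IsHolomorphicRep (E := E) ρ₀) (hρ₁ : SuperMF.IsHolomorphicRep (E := E) ρ₁)
    (hσ₀ : SuperMF.IsHolomorphicRep (E := E) σ₀) (hσ₁ : SuperMF.IsHolomorphicRep (E := E) σ₁) :
    SuperMF.IsSuperMF (ρ₀.prod σ₀) (ρ₁.prod σ₁) ↔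
      SuperMF.IsSuperMF (ρ₀.prod σ₀.dual) (ρ₁.prod σ₁.dual) := by
  constructor
  · exact SuperMF.IsSuperMF.flip hρ₀ hρ₁ hσ₀ hσ₁ hσ₀.dual hσ₁.dual (.refl ℂ _) (fun _ _ => rfl)
      (.refl ℂ _) fun _ _ => rfl
  -- The converse is the same implication applied to W*, with W identified equivariantly with its
  -- double dual.
  · exact SuperMF.IsSuperMF.flip hρ₀ hρ₁ hσ₀.dual hσ₁.dual hσ₀ hσ₁ (Module.evalEquiv ℂ W₀)
      (SuperMF.evalEquiv_equivariant σ₀) (Module.evalEquiv ℂ W₁) (SuperMF.evalEquiv_equivariant σ₁)
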